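/- **Setting.** Let $L=(L(t))_{t\ge 0}$ be a one-dimensional Lévy process (started at $0$, stationary independent increments, stochastically continuous, càdlàg paths) with Gaussian cumulant, i.e. $\mathbf E e^{i\lambda L(t)}=e^{-t\sigma^2\lambda^2/2}$ for all $t\ge0$, $\lambda\in\mathbb R$, where $\sigma\ge 0$. For $\nu\ge 0$ and integers $n\ge 0$ put $$H_n^\nu(r)=n\frac{J_n(2r)}{r}e^{-\nu r}\quad(r>0),\qquad H_n^\nu(0)=\lim_{r\downarrow0}H^\nu_n(r)=\mathbf 1_{\{n=1\}},$$ $J_n$ being the Bessel function of the first kind. For $s\le 0$ let $L_s(t)=L(t-s)$, $t\ge s$, be the process started at time $s$, and let $$a_n^\nu(0;s)=\int_s^0 H_n^\nu(-r)\,dL_s(r)$$ (a limit in probability of Riemann sums), which is the value at time $0$ of the explicit solution, started from zero at time $s$, of the transport chain $a_0=0$, $da_1=(-a_2-\nu a_1)\,dt+dL_s$, $da_n=(a_{n-1}-a_{n+1}-\nu a_n)\,dt$, $n\ge2$. A *stationary state* is a family of random variables $(a_n^\nu)_{n\ge0}$ whose finite-dimensional distributions are the weak limits, as $s\to-\infty$,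 of those of $(a_n^\nu(0;s))_{n\ge0}$; in particular $a_0^\nu=0$ almost surely. The functions ${}_pF_q$ below denote the principal branch, holomorphic on $\mathbb C\setminus[1,\infty)$, of the generalized hypergeometric series (which converges for $|z|<1$); part of the claim is that these analytic continuations exist. **Claim.** For every $\nu\ge0$ the integrals $\int_0^\infty H_n^\nu(r)\,dL(r)$ (limits in probability of $\int_0^T H_n^\nu(r)\,dL(r)$ as $T\to\infty$) exist and form a stationary state. Every stationary state satisfies the following, for all $m,n\ge 1$ and $\lambda\in\mathbb R$. 1. For $\nu\ge 0$: $(a_n^\nu)_n$ is a centred, jointly Gaussian family, with $$\mathbf E e^{i\lambda a_n^\nu}=\exp\Big(-\frac{\lambda^2\sigma^2}{2}\int_0^\infty H_n^\nu(r)^2\,dr\Big),\qquad \mathbf E a_m^\nu a_n^\nu=\sigma^2\int_0^\infty H_m^\nu(r)H_n^\nu(r)\,dr ,$$ the integrals and moments being finite. 2. For $\nu>0$: $$\mathbf E e^{i\lambda a_n^\nu}=\exp\Big(-\frac{\lambda^2\sigma^2}{4\sqrt\pi}\frac{\Gamma(n-\frac12)}{\Gamma(n)}\nu^{1-2n}\,{}_3F_2\Big(n-\tfrac12,n,n+\tfrac12;\,n+1,2n+1;\,-\tfrac4{\nu^2}\Big)\Big),$$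 equivalently $\mathbf E(a_n^\nu)^2=\frac{\sigma^2}{2\sqrt\pi}\frac{\Gamma(n-1/2)}{\Gamma(n)}\nu^{1-2n}{}_3F_2(\cdots)$ with the same ${}_3F_2$, and $$\mathbf E a_m^\nu a_n^\nu=\sigma^2(2\nu)^{1-m-n}\frac{(m+n-2)!}{(m-1)!(n-1)!}\;{}_4F_3\Big(\tfrac{m+n-1}2,\tfrac{m+n}2,\tfrac{m+n+1}2,\tfrac{m+n}2+1;\,m+1,n+1,m+n+1;\,-\tfrac4{\nu^2}\Big).$$ 3. For $\nu=0$: $$\mathbf E e^{i\lambda a_n^0}=\exp\Big(-\frac{\lambda^2\sigma^2}{\pi}\Big(1-\frac1{4n^2}\Big)^{-1}\Big),\qquad \mathbf E(a_n^0)^2=\frac{2}{\pi}\sigma^2\Big(1-\frac1{4n^2}\Big)^{-1}\xrightarrow[n\to\infty]{}\frac2\pi\sigma^2,$$ $$\mathbf E a_m^0a_n^0=\sigma^2\frac2\pi\cos\Big(\pi\frac{m-n}2\Big)\Big[\frac1{(m+n)^2-1}-\frac1{(m-n)^2-1}\Big]\qquad\text{if }|m-n|\ne1,$$ and $\mathbf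 E a_m^0a_n^0=\sigma^2/2$ if $|m-n|=1$ (the limit of the preceding expression as the difference $m-n$, regarded as a real variable with $m+n$ fixed, tends to $\pm1$). 4. As $\nu\downarrow0$: $$\mathbf E(a_n^\nu)^2=\sigma^2\Big(\frac{8n^2}{\pi(4n^2-1)}-n\nu\Big)+o(\nu),\qquad \mathbf E e^{i\lambda a_n^\nu}\to\mathbf E e^{i\lambda a_n^0}.$$ -/

import Mathlib

open MeasureTheory ProbabilityTheory Filter Topology Set
open scoped NNReal ENNReal Nat

noncomputable section

/-! ### Special functions -/

/-- The Bessel function of the first kind of order `n : ℕ`,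
`J_n(x) = ∑_k (-1)^k / (k! (k+n)!) (x/2)^(2k+n)`. -/
def besselJ (n : ℕ) (x : ℝ) : ℝ :=
  ∑' k : ℕ, (-1 : ℝ) ^ k / ((k ! : ℝ) * ((k + n)! : ℝ)) * (x / 2) ^ (2 * k + n)

/-- The kernel `H_n^ν(r) = n J_n(2r) / r * exp(-ν r)`, extended continuously to `r = 0`
(the value there is `1` for `n = 1` and `0` otherwise). -/
def besselKernel (ν : ℝ) (n : ℕ) (r : ℝ) : ℝ :=
  if r = 0 then (if n = 1 then 1 else 0)
  else n * besselJ n (2 * r) / r * Real.exp (-ν * r)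

/-- `F` is the principal branch of the generalized hypergeometric function with upper parameters
`a` and lower parameters `b`: it is holomorphic on `ℂ \ [1, ∞)`, and on the unit disc it is the sum
of the series `∑_k (∏ (a_i)_k / ∏ (b_j)_k) z^k / k!`.
(Mathlib's `regularizedHGFun` is the sum of this series divided by `∏ Γ(b_j)`.) -/
def IsHypergeometricBranch (a b : Multiset ℂ) (F : ℂ → ℂ) : Prop :=
  DifferentiableOn ℂ F {z : ℂ | 1 - z ∈ Complex.slitPlane} ∧
    ∀ z : ℂ, ‖z‖ < 1 → F z = (b.map Complex.Gamma).prod * Complex.regularizedHGFun a b z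

/-- The principal branch on `ℂ \ [1, ∞)` of the generalized hypergeometric function. It is unique
on this connected domain where it exists, and only used together with a proof of existence. -/
def hypergeometricPFQ (a b : Multiset ℂ) : ℂ → ℂ :=
  Classical.epsilon (IsHypergeometricBranch a b)

/-- The function `₃F₂(n - 1/2, n, n + 1/2; n + 1, 2n + 1; z)`. -/
def hyp32 (n : ℕ) : ℂ → ℂ :=
  hypergeometricPFQ {(n : ℂ) - 1 / 2, (n : ℂ), (n : ℂ) + 1 / 2} {(n : ℂ) + 1, 2 * (n : ℂ) + 1}

/-- The function
`₄F₃((m+n-1)/2, (m+n)/2, (m+n+1)/2, (m+n)/2 + 1; m + 1, n + 1, m + n + 1; z)`. -/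
def hyp43 (m n : ℕ) : ℂ → ℂ :=
  hypergeometricPFQ
    {((m : ℂ) + n - 1) / 2, ((m : ℂ) + n) / 2, ((m : ℂ) + n + 1) / 2, ((m : ℂ) + n) / 2 + 1}
    {(m : ℂ) + 1, (n : ℂ) + 1, (m : ℂ) + n + 1}

/-! ### Lévy processes and stochastic integrals of deterministic integrands -/

/-- `L` is a one-dimensional Lévy process: it starts at the origin, has independent and stationary
increments, is stochastically continuous and has càdlàg paths. -/
structure IsLevyProcess {Ω : Type*} [MeasurableSpace Ω] (P : Measure Ω) (L : ℝ≥0 → Ω → ℝ) :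
    Prop where
  aemeasurable : ∀ t, AEMeasurable (L t) P
  start_zero : ∀ᵐ ω ∂P, L 0 ω = 0
  indep_increments : HasIndepIncrements L P
  stationary_increments : ∀ s t, IdentDistrib (fun ω => L (s + t) ω - L s ω) (L t) P P
  stoch_continuous : ∀ t, TendstoInMeasure P L (𝓝 t) (L t)
  cadlag : ∀ᵐ ω ∂P, ∀ t, ContinuousWithinAt (fun u => L u ω) (Ioi t) t ∧
    ∃ l : ℝ, Tendsto (fun u => L u ω) (𝓝[<] t) (𝓝 l)

/-- The process `L` has cumulant `Ψ`: `E exp(i lam L(t)) = exp(t Ψ(lam))`. -/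
def HasCumulant {Ω : Type*} [MeasurableSpace Ω] (P : Measure Ω) (L : ℝ≥0 → Ω → ℝ)
    (Ψ : ℝ → ℂ) : Prop :=
  ∀ (t : ℝ≥0) (lam : ℝ), charFun (P.map (L t)) lam = Complex.exp (((t : ℝ) : ℂ) * Ψ lam)

/-- The time-shifted process `L_s(t) = L(t - s)`, `t ≥ s`, which starts at the origin at time `s`
(only its values at times `t ≥ s` are meaningful). -/
def timeShift {Ω : Type*} (L : ℝ≥0 → Ω → ℝ) (s t : ℝ) (ω : Ω) : ℝ :=
  L (t - s).toNNReal ω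

/-- `Y = ∫_a^b f(r) dX(r)`: the Riemann sums `∑ f(t_k) (X(t_{k+1}) - X(t_k))` converge to `Y` in
probability as the mesh of the partition `a = t_0 ≤ t_1 ≤ ... ≤ t_N = b` tends to zero. -/
def IsStochIntegral {Ω : Type*} [MeasurableSpace Ω] (P : Measure Ω) (X : ℝ → Ω → ℝ)
    (f : ℝ → ℝ) (a b : ℝ) (Y : Ω → ℝ) : Prop :=
  AEMeasurable Y P ∧
  ∀ ε : ℝ, 0 < ε → ∃ δ : ℝ, 0 < δ ∧ ∀ (N : ℕ) (t : ℕ → ℝ), Monotone t → t 0 = a → t N = b →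
    (∀ k < N, t (k + 1) - t k < δ) →
      P {ω | ε ≤ |∑ k ∈ Finset.range N, f (t k) * (X (t (k + 1)) ω - X (t k) ω) - Y ω|}
        ≤ ENNReal.ofReal ε

/-- `Y = ∫_a^∞ f(r) dX(r)`, the limit in probability of `∫_a^T f(r) dX(r)` as `T → ∞`. -/
def IsStochIntegralIoi {Ω : Type*} [MeasurableSpace Ω] (P : Measure Ω) (X : ℝ → Ω → ℝ)
    (f : ℝ → ℝ) (a : ℝ) (Y : Ω → ℝ) : Prop :=
  AEMeasurable Y P ∧ ∃ I : ℝ → Ω → ℝ,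
    (∀ T, a ≤ T → IsStochIntegral P X f a T (I T)) ∧ TendstoInMeasure P I atTop Y

/-- `a = (a_n)` is (a version of) the stationary state of the chain driven by `L` with viscosity
`ν`, i.e. the pull-back limit as `s → -∞`, in the sense of finite-dimensional distributions, of
the values at time `0`,
`a_n(0; s) = ∫_s^0 H_n^ν(-r) dL_s(r)`, of the solution started from zero at time `s`.
For `n = 0` the kernel vanishes, so `a_0 = 0`. -/
def IsStationaryState {Ω Ω' : Type*} [MeasurableSpace Ω] [MeasurableSpace Ω']
    (P : Measure Ω) [IsProbabilityMeasure P] (L : ℝ≥0 → Ω → ℝ) (ν : ℝ)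
    (Q : Measure Ω') [IsProbabilityMeasure Q] (a : ℕ → Ω' → ℝ) : Prop :=
  ∃ A : ℝ → ℕ → Ω → ℝ,
    (∀ s ≤ 0, ∀ n, IsStochIntegral P (timeShift L s) (fun r => besselKernel ν n (-r)) s 0 (A s n)) ∧
    ∀ I : Finset ℕ, TendstoInDistribution (fun (s : ℝ) ω (i : I) => A s i ω) atBot
      (fun ω (i : I) => a i ω) (fun _ => P) Q

end

/-! ### Bessel functions as entire functions -/

/-! The proof has a probabilistic half, which reduces everything to the integrals of `H_m^ν H_n^ν`
over the half-line, and an analytic half, which evaluates them.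

Probability. Independent stationary increments and the Gaussian cumulant give `E L(s) L(t) = σ²
min(s,t)`, so sending the indicator of `(0,t]` to `L(t)` multiplies inner products by `σ²`. It
extends to `σ` times an isometry `W` on the closed span of the indicators
(`IsLevyProcess.exists_isWienerIntegral`), with centred Gaussian values because that class is closed
in mean square. Riemann sums of a continuous `f` are `W` of step functions, so `W` computes the
stochastic integrals. A translation of time turns `∫_s^0 H(-r) dL_s(r)` into an integral over
`[0,-s]`. Linear combinations of these are therefore centred Gaussian, and their variances converge
as `s → -∞`. Lévy continuity and uniqueness of limits then fix the finite-dimensional laws of every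
stationary state (`IsStationaryState.charFun_sum`).

Zero viscosity. Put `q_n(r) = n J_n(2r)/r = J_{n-1}(2r) + J_{n+1}(2r)`. Then `q_n' = q_{n-1} -
q_{n+1}` with `q_0 = 0`. Integrating `(q_m q_n)'` gives a recurrence for the covariances
(`besselCov_recurrence`) which, with the zero border, determines all of them from the diagonal. The
diagonal comes from `π J_n(2r)² = ∫_0^π J_{2n}(4r sin θ) dθ`: Fubini and a change of scale leave the
integral of `J_{2n}(2r)/r²`, found as a limit of Laplace transforms (`besselCov_self`).

Positive viscosity. For `ν > 2` the power series of `J_m J_n` may be integrated term by term against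
`exp(-2νr)`, which gives the `₄F₃` at `-4/ν²`. The Laplace integral is holomorphic in the right
half-plane. In the coordinate `w = 2/√(-z)` it therefore continues the series to `ℂ \ [0,∞)`;
together with the disc this covers `ℂ \ [1,∞)` (`isHypergeometricBranch_hyp43Branch`). On the
diagonal an upper and a lower parameter cancel, leaving the `₃F₂`.

Vanishing viscosity. The slope of the variance integral at `ν = 0` is `-2 ∫ r q_n² = -n`, an energy
balance for the chain (`integral_mul_besselQuot_sq`). -/

/-- The entire function `∑_k (-y)^k / (k! (k+n)!)`. -/
noncomputable def besselEntire (n : ℕ) (y : ℝ) : ℝ :=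
  ∑' k : ℕ, (-1 : ℝ) ^ k / ((k ! : ℝ) * ((k + n)! : ℝ)) * y ^ k

/-- The function `r ↦ J_n(2r)`. -/
noncomputable def besselTwo (n : ℕ) (r : ℝ) : ℝ := besselJ n (2 * r)

/-- The function `r ↦ n J_n(2r) / r`, in the form `J_{n-1}(2r) + J_{n+1}(2r)`. -/
noncomputable def besselQuot : ℕ → ℝ → ℝ
  | 0, _ => 0
  | n + 1, r => besselTwo n r + besselTwo (n + 2) r

lemma norm_besselEntire_term_le (n k : ℕ) (y : ℝ) :
    ‖(-1 : ℝ) ^ k / ((k ! : ℝ) * ((k + n)! : ℝ)) * y ^ k‖ ≤ |y| ^ k / k ! := by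
  have h1 : (1 : ℝ) ≤ ((k + n)! : ℝ) := by exact_mod_cast Nat.one_le_iff_ne_zero.2 (Nat.factorial_ne_zero _)
  have h2 : (0 : ℝ) < (k ! : ℝ) := by positivity
  rw [norm_mul, norm_div, norm_pow, norm_neg, norm_one, one_pow, norm_pow, Real.norm_eq_abs,
    Real.norm_eq_abs, abs_of_pos (by positivity), div_mul_eq_mul_div, one_mul]
  gcongr
  nlinarith

lemma summable_besselEntire (n : ℕ) (y : ℝ) :
    Summable fun k : ℕ => (-1 : ℝ) ^ k / ((k ! : ℝ) * ((k + n)! : ℝ)) * y ^ k :=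
  Summable.of_norm_bounded (Real.summable_pow_div_factorial |y|) fun k =>
    norm_besselEntire_term_le n k y

lemma hasDerivAt_besselEntire (n : ℕ) (y : ℝ) :
    HasDerivAt (besselEntire n) (-besselEntire (n + 1) y) y := by
  set R : ℝ := |y| + 1
  have hR : 1 ≤ R := by simp [R]
  have hbound : ∀ k : ℕ, ∀ x ∈ Ioo (-R) R,
      -- The factor `k` produced by differentiation is absorbed by `k ≤ 2 ^ k`, whence the `2 * R`.
      ‖(-1 : ℝ) ^ k / ((k ! : ℝ) * ((k + n)! : ℝ)) * (k * x ^ (k - 1))‖ ≤ (2 * R) ^ k / k ! := by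
    intro k x hx
    have hx' : |x| ≤ R := (abs_lt.2 hx).le
    have h1 : (1 : ℝ) ≤ ((k + n)! : ℝ) := by
      exact_mod_cast Nat.one_le_iff_ne_zero.2 (Nat.factorial_ne_zero _)
    have h2 : (0 : ℝ) < (k ! : ℝ) := by positivity
    have h3 : (k : ℝ) ≤ 2 ^ k := by exact_mod_cast Nat.lt_two_pow_self.le
    have h4 : |x| ^ (k - 1) ≤ R ^ k :=
      (pow_le_pow_left₀ (abs_nonneg x) hx' _).trans (pow_le_pow_right₀ hR (Nat.sub_le _ _))
    rw [norm_mul, norm_div, norm_pow, norm_neg, norm_one, one_pow, Real.norm_eq_abs,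
      Real.norm_eq_abs, abs_of_pos (by positivity), abs_mul, abs_pow, Nat.abs_cast,
      div_mul_eq_mul_div, one_mul, mul_pow]
    gcongr
    nlinarith
  have hy : y ∈ Ioo (-R) R := abs_lt.1 (by simp [R])
  have key := hasDerivAt_tsum_of_isPreconnected (Real.summable_pow_div_factorial (2 * R))
    isOpen_Ioo isPreconnected_Ioo
    (fun k x _ => ((hasDerivAt_pow k x).const_mul ((-1 : ℝ) ^ k / ((k ! : ℝ) * ((k + n)! : ℝ)))))
    hbound hy (summable_besselEntire n y) hy
  refine HasDerivAt.congr_deriv (key) ?_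
  have hs : Summable fun k : ℕ =>
      (-1 : ℝ) ^ k / ((k ! : ℝ) * ((k + n)! : ℝ)) * (k * y ^ (k - 1)) :=
    Summable.of_norm_bounded (Real.summable_pow_div_factorial (2 * R)) fun k => hbound k y hy
  rw [hs.tsum_eq_zero_add, besselEntire, ← tsum_neg]
  simp only [Nat.cast_zero, zero_mul, mul_zero, zero_add]
  refine tsum_congr fun k => ?_
  rw [Nat.factorial_succ, add_right_comm, add_assoc k n 1]
  push_cast
  field_simp
  simp [pow_succ, mul_comm]

/-- Write `1/(k+n)! = ((n+1) + k)/(k+n+1)!` in each coefficient; the part with `k` is an index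
shift. This is the three-term Bessel recurrence freed of its division by the argument. -/
lemma besselEntire_eq (n : ℕ) (y : ℝ) :
    besselEntire n y = (n + 1) * besselEntire (n + 1) y - y * besselEntire (n + 2) y := by
  have h1 : Summable fun k : ℕ => (-1 : ℝ) ^ k / ((k ! : ℝ) * ((k + (n + 1))! : ℝ)) * y ^ k * k := by
    refine Summable.of_norm_bounded (Real.summable_pow_div_factorial (2 * |y|)) fun k => ?_
    rw [norm_mul]
    have h3 : (k : ℝ) ≤ 2 ^ k := by exact_mod_cast Nat.lt_two_pow_self.le
    calc _ ≤ |y| ^ k / k ! * 2 ^ k := by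
          gcongr
          · exact norm_besselEntire_term_le _ _ _
          · simpa using h3
      _ = _ := by rw [mul_pow]; ring
  have h2 : y * besselEntire (n + 2) y
      = -∑' k : ℕ, (-1 : ℝ) ^ k / ((k ! : ℝ) * ((k + (n + 1))! : ℝ)) * y ^ k * k := by
    rw [h1.tsum_eq_zero_add, besselEntire, ← tsum_mul_left]
    simp only [Nat.cast_zero, mul_zero, zero_add]
    rw [← tsum_neg]
    refine tsum_congr fun k => ?_
    rw [Nat.factorial_succ, show k + 1 + (n + 1) = k + (n + 2) by ring]
    push_cast
    field_simp
    ring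
  rw [h2, sub_neg_eq_add, besselEntire, besselEntire, ← tsum_mul_left,
    ← ((summable_besselEntire (n + 1) y).mul_left _).tsum_add h1]
  refine tsum_congr fun k => ?_
  rw [← add_assoc, Nat.factorial_succ (k + n)]
  push_cast
  field_simp
  ring

lemma besselTwo_eq (n : ℕ) (r : ℝ) : besselTwo n r = r ^ n * besselEntire n (r ^ 2) := by
  rw [besselTwo, besselJ, besselEntire, ← tsum_mul_left]
  refine tsum_congr fun k => ?_
  rw [mul_div_cancel_left₀ _ two_ne_zero]
  ring

lemma besselEntire_zero (n : ℕ) : besselEntire n 0 = 1 / (n ! : ℝ) := by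
  rw [besselEntire, tsum_eq_single 0 (fun k hk => by simp [hk])]
  simp

lemma besselTwo_zero (n : ℕ) : besselTwo n 0 = if n = 0 then 1 else 0 := by
  rcases n with _ | n <;> simp [besselTwo_eq, besselEntire_zero]

lemma mul_besselQuot (n : ℕ) (r : ℝ) : r * besselQuot n r = n * besselTwo n r := by
  rcases n with _ | n
  · simp [besselQuot]
  · simp only [besselQuot, besselTwo_eq, besselEntire_eq n]
    push_cast
    ring

lemma besselQuot_zero (n : ℕ) : besselQuot n 0 = if n = 1 then 1 else 0 := by
  rcases n with _ | _ | n <;> simp [besselQuot, besselTwo_zero]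

lemma besselKernel_eq (ν : ℝ) (n : ℕ) (r : ℝ) :
    besselKernel ν n r = besselQuot n r * Real.exp (-ν * r) := by
  rw [besselKernel]
  split_ifs with h0 h1
  · subst h0 h1; simp [besselQuot_zero]
  · subst h0; simp [besselQuot_zero, h1]
  · rw [show n * besselJ n (2 * r) = r * besselQuot n r from (mul_besselQuot n r).symm,
      mul_div_cancel_left₀ _ h0]

lemma hasDerivAt_besselEntire_sq (n : ℕ) (r : ℝ) :
    HasDerivAt (fun r => besselEntire n (r ^ 2)) (-(2 * r * besselEntire (n + 1) (r ^ 2))) r := by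
  have h : HasDerivAt (besselEntire n ∘ fun r : ℝ => r ^ 2) _ r :=
    (hasDerivAt_besselEntire n (r ^ 2)).comp r (hasDerivAt_pow 2 r)
  refine HasDerivAt.congr_deriv h ?_
  push_cast; ring

lemma hasDerivAt_besselTwo_zero (r : ℝ) :
    HasDerivAt (besselTwo 0) (-2 * besselTwo 1 r) r := by
  have h : besselTwo 0 = fun r => besselEntire 0 (r ^ 2) := by
    ext r; simp [besselTwo_eq]
  rw [h]
  refine HasDerivAt.congr_deriv (hasDerivAt_besselEntire_sq 0 r) ?_
  rw [besselTwo_eq]; ring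

lemma hasDerivAt_besselTwo_succ (n : ℕ) (r : ℝ) :
    HasDerivAt (besselTwo (n + 1)) (besselTwo n r - besselTwo (n + 2) r) r := by
  have h : besselTwo (n + 1) = fun r => r ^ (n + 1) * besselEntire (n + 1) (r ^ 2) := by
    ext r; simp [besselTwo_eq]
  rw [h]
  refine HasDerivAt.congr_deriv ((hasDerivAt_pow (n + 1) r).mul
    (hasDerivAt_besselEntire_sq (n + 1) r)) ?_
  simp only [besselTwo_eq, besselEntire_eq n, Nat.add_sub_cancel]
  push_cast
  ring

/-- The kernels without damping thus solve the noiseless transport chain with zero boundary at site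
`0`. At site `1`, `J_0' = -J_1` plays the role of the general derivative rule. -/
lemma hasDerivAt_besselQuot_succ (n : ℕ) (r : ℝ) :
    HasDerivAt (besselQuot (n + 1)) (besselQuot n r - besselQuot (n + 2) r) r := by
  rcases n with _ | n
  · refine HasDerivAt.congr_deriv ((hasDerivAt_besselTwo_zero r).add (hasDerivAt_besselTwo_succ 1 r)) ?_
    simp only [besselQuot]; ring
  · refine HasDerivAt.congr_deriv ((hasDerivAt_besselTwo_succ n r).add (hasDerivAt_besselTwo_succ (n + 2) r)) ?_
    simp only [besselQuot]; ring

lemma continuous_besselTwo (n : ℕ) : Continuous (besselTwo n) := by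
  rcases n with _ | n
  · exact continuous_iff_continuousAt.2 fun r => (hasDerivAt_besselTwo_zero r).continuousAt
  · exact continuous_iff_continuousAt.2 fun r => (hasDerivAt_besselTwo_succ n r).continuousAt

lemma continuous_besselQuot (n : ℕ) : Continuous (besselQuot n) := by
  rcases n with _ | n
  · exact continuous_const
  · exact (continuous_besselTwo n).add (continuous_besselTwo (n + 2))

lemma continuous_besselKernel (ν : ℝ) (n : ℕ) : Continuous (besselKernel ν n) := by
  have h : besselKernel ν n = fun r => besselQuot n r * Real.exp (-ν * r) :=
    funext (besselKernel_eq ν n)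
  rw [h]
  exact (continuous_besselQuot n).mul (by fun_prop)

/-! ### Bounds and decay -/

/-- The energy deficit `1 - ∑_{i<n} (J_i² + J_{i+1}²)(2r)`. -/
noncomputable def besselDeficit (n : ℕ) (r : ℝ) : ℝ :=
  1 - ∑ i ∈ Finset.range n, (besselTwo i r ^ 2 + besselTwo (i + 1) r ^ 2)

/-- The derivative of `J_i² + J_{i+1}²` is a difference of fluxes `2 J_{i-1} J_i - 2 J_{i+1}
J_{i+2}`, so the sum telescopes and only the flux out of the last sites survives. -/
lemma hasDerivAt_besselDeficit_succ (n : ℕ) (r : ℝ) :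
    HasDerivAt (besselDeficit (n + 1)) (2 * (besselTwo (n + 1) r * besselQuot (n + 1) r)) r := by
  induction n with
  | zero =>
    have h : besselDeficit (0 + 1) = fun r => 1 - (besselTwo 0 r ^ 2 + besselTwo 1 r ^ 2) := by
      ext r; simp [besselDeficit]
    rw [h]
    refine HasDerivAt.congr_deriv ((((hasDerivAt_besselTwo_zero r).pow 2).add
      ((hasDerivAt_besselTwo_succ 0 r).pow 2)).const_sub 1) ?_
    simp only [besselQuot]; ring
  | succ n ih =>
    have h : besselDeficit (n + 1 + 1) = fun r => besselDeficit (n + 1) r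
        - (besselTwo (n + 1) r ^ 2 + besselTwo (n + 2) r ^ 2) := by
      ext r; rw [besselDeficit, besselDeficit, Finset.sum_range_succ]; ring
    rw [h]
    refine HasDerivAt.congr_deriv (ih.sub (((hasDerivAt_besselTwo_succ n r).pow 2).add
      ((hasDerivAt_besselTwo_succ (n + 1) r).pow 2))) ?_
    simp only [besselQuot]; ring

lemma besselTwo_mul_besselQuot_nonneg (n : ℕ) {r : ℝ} (hr : 0 ≤ r) :
    0 ≤ besselTwo n r * besselQuot n r := by
  rcases hr.eq_or_lt with rfl | hr
  · rw [besselTwo_zero, besselQuot_zero]; split_ifs <;> norm_num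
  · refine nonneg_of_mul_nonneg_right ?_ hr
    have : r * (besselTwo n r * besselQuot n r) = n * besselTwo n r ^ 2 := by
      rw [mul_left_comm, mul_besselQuot]; ring
    rw [this]; positivity

lemma besselDeficit_succ_zero (n : ℕ) : besselDeficit (n + 1) 0 = 0 := by
  simp [besselDeficit, besselTwo_zero]

lemma besselDeficit_succ_nonneg (n : ℕ) {r : ℝ} (hr : 0 ≤ r) : 0 ≤ besselDeficit (n + 1) r := by
  have h : MonotoneOn (besselDeficit (n + 1)) (Ici 0) := by
    refine monotoneOn_of_hasDerivWithinAt_nonneg (convex_Ici 0)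
      (fun x _ => (hasDerivAt_besselDeficit_succ n x).continuousAt.continuousWithinAt)
      (fun x _ => (hasDerivAt_besselDeficit_succ n x).hasDerivWithinAt) fun x hx => ?_
    rw [interior_Ici] at hx
    exact mul_nonneg zero_le_two (besselTwo_mul_besselQuot_nonneg _ (le_of_lt hx))
  simpa [besselDeficit_succ_zero] using h self_mem_Ici hr hr

/-- The deficit starts at `0` and increases, and `J_n²` is one of the squares it subtracts from `1`.
-/
lemma abs_besselTwo_le_one (n : ℕ) {r : ℝ} (hr : 0 ≤ r) : |besselTwo n r| ≤ 1 := by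
  have h := besselDeficit_succ_nonneg n hr
  rw [besselDeficit, Finset.sum_range_succ] at h
  have h2 : 0 ≤ ∑ i ∈ Finset.range n, (besselTwo i r ^ 2 + besselTwo (i + 1) r ^ 2) :=
    Finset.sum_nonneg fun i _ => by positivity
  rw [← sq_le_one_iff_abs_le_one]
  nlinarith [sq_nonneg (besselTwo (n + 1) r)]

lemma abs_besselQuot_le_two (n : ℕ) {r : ℝ} (hr : 0 ≤ r) : |besselQuot n r| ≤ 2 := by
  rcases n with _ | n
  · simp [besselQuot]
  · exact (abs_add_le _ _).trans (by
      linarith [abs_besselTwo_le_one n hr, abs_besselTwo_le_one (n + 2) hr])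

lemma mul_abs_besselQuot_le (n : ℕ) {r : ℝ} (hr : 0 ≤ r) : r * |besselQuot n r| ≤ n := by
  have h : r * |besselQuot n r| = |r * besselQuot n r| := by rw [abs_mul, abs_of_nonneg hr]
  rw [h, mul_besselQuot, abs_mul, Nat.abs_cast]
  exact mul_le_of_le_one_right (by positivity) (abs_besselTwo_le_one n hr)

lemma tendsto_besselQuot_atTop (n : ℕ) : Tendsto (besselQuot n) atTop (𝓝 0) := by
  refine squeeze_zero_norm' (a := fun r : ℝ => (n : ℝ) / r) ?_ (tendsto_const_nhds.div_atTop tendsto_id)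
  filter_upwards [eventually_gt_atTop 0] with r hr
  rw [le_div_iff₀ hr, mul_comm]
  exact mul_abs_besselQuot_le n hr.le

/-- Supplies the decay of `J_0` and `J_1`, which boundedness and the decay of the quotients do not
give. Subtracting `J_0 J_1` from `2r(J_0² + J_1²)` cancels the oscillating part `2J_0² - 2J_1²` of
the derivative and leaves `J_0 J_1 / r ≤ 1/r`, so the growth is at most logarithmic. -/
lemma two_mul_mul_energy_le {r : ℝ} (hr : 1 ≤ r) :
    2 * r * (besselTwo 0 r ^ 2 + besselTwo 1 r ^ 2) ≤ 6 + Real.log r := by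
  set F : ℝ → ℝ := fun r => 2 * r * (besselTwo 0 r ^ 2 + besselTwo 1 r ^ 2)
    - besselTwo 0 r * besselTwo 1 r - Real.log r with hF
  have hd : ∀ r : ℝ, 0 < r → HasDerivAt F ((besselTwo 0 r * besselTwo 1 r - 1) / r) r := by
    intro r hr
    have h1 := (((hasDerivAt_id r).const_mul 2).mul (((hasDerivAt_besselTwo_zero r).pow 2).add
      ((hasDerivAt_besselTwo_succ 0 r).pow 2))).sub
      ((hasDerivAt_besselTwo_zero r).mul (hasDerivAt_besselTwo_succ 0 r)) |>.sub
      (Real.hasDerivAt_log hr.ne')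
    refine HasDerivAt.congr_deriv (h1) ?_
    have h2 := mul_besselQuot 1 r
    simp only [besselQuot, Nat.cast_one, one_mul] at h2
    have h3 : besselTwo 1 r = r * (besselTwo 0 r + besselTwo 2 r) := h2.symm
    simp only [id, Pi.add_apply, Pi.pow_apply]
    field_simp
    rw [h3]
    simp only [besselTwo] at *
    ring
  have hanti : AntitoneOn F (Ici 1) := by
    refine antitoneOn_of_hasDerivWithinAt_nonpos (convex_Ici 1)
      (fun x hx => (hd x (lt_of_lt_of_le one_pos hx)).continuousAt.continuousWithinAt)
      (fun x hx => (hd x ?_).hasDerivWithinAt) fun x hx => ?_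
    · rw [interior_Ici] at hx; exact one_pos.trans hx
    · rw [interior_Ici] at hx
      have hx0 : (0 : ℝ) < x := one_pos.trans hx
      refine div_nonpos_of_nonpos_of_nonneg ?_ hx0.le
      have h1 := abs_le.1 (abs_besselTwo_le_one 0 hx0.le)
      have h2 := abs_le.1 (abs_besselTwo_le_one 1 hx0.le)
      nlinarith
  have hF1 := hanti self_mem_Ici hr hr
  simp only [hF, Real.log_one] at hF1
  have hr0 : (0 : ℝ) ≤ r := zero_le_one.trans hr
  have h1 := abs_le.1 (abs_besselTwo_le_one 0 hr0)
  have h2 := abs_le.1 (abs_besselTwo_le_one 1 hr0)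
  have h3 := abs_le.1 (abs_besselTwo_le_one 0 zero_le_one)
  have h4 := abs_le.1 (abs_besselTwo_le_one 1 zero_le_one)
  -- The `6` is `2·2 + 1` for the value at `1`, plus `1` for `J_0 J_1` at `r`.
  nlinarith

lemma tendsto_besselTwo_atTop (n : ℕ) : Tendsto (besselTwo n) atTop (𝓝 0) := by
  have hE : Tendsto (fun r => besselTwo 0 r ^ 2 + besselTwo 1 r ^ 2) atTop (𝓝 0) := by
    have hlim : Tendsto (fun r : ℝ => (6 / r + Real.log r / r) / 2) atTop (𝓝 0) := by
      have h := ((tendsto_const_nhds (x := (6 : ℝ))).div_atTop tendsto_id).add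
        (Real.isLittleO_log_id_atTop.tendsto_div_nhds_zero)
      simpa using h.div_const 2
    refine squeeze_zero' (Eventually.of_forall fun r => by positivity) ?_ hlim
    filter_upwards [eventually_ge_atTop 1] with r hr
    have := two_mul_mul_energy_le hr
    have hr0 : 0 < r := by linarith
    rw [← add_div, div_div, le_div_iff₀ (by positivity)]
    linarith
  have hsq : ∀ f : ℝ → ℝ, (∀ r, f r ^ 2 ≤ besselTwo 0 r ^ 2 + besselTwo 1 r ^ 2) →
      Tendsto f atTop (𝓝 0) := by
    intro f hf
    have h2 : Tendsto (fun r => f r ^ 2) atTop (𝓝 0) :=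
      squeeze_zero (fun r => sq_nonneg _) hf hE
    have h3 := h2.sqrt
    simp only [Real.sqrt_sq_eq_abs, Real.sqrt_zero] at h3
    exact (tendsto_zero_iff_abs_tendsto_zero f).2 h3
  induction n using Nat.strong_induction_on with
  | _ n ih =>
    rcases n with _ | _ | n
    · exact hsq _ fun r => by nlinarith [sq_nonneg (besselTwo 1 r)]
    · exact hsq _ fun r => by nlinarith [sq_nonneg (besselTwo 0 r)]
    -- `J_{n+2}` is the vanishing quotient minus `J_n`, so decay propagates in steps of two.
    · have h := (tendsto_besselQuot_atTop (n + 1)).sub (ih n (by omega))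
      simp only [besselQuot, sub_zero, add_sub_cancel_left] at h
      exact h

/-! ### Integrability and the first moment of the squared kernel -/

lemma integrableOn_besselQuot_mul (m n : ℕ) :
    IntegrableOn (fun r => besselQuot m r * besselQuot n r) (Ioi 0) := by
  have hI : IntegrableOn (fun r : ℝ => ((2 * 2 : ℝ) + m * n) * (1 + r ^ 2)⁻¹) (Ioi 0) :=
    (integrable_inv_one_add_sq.const_mul _).integrableOn
  refine hI.mono' ((continuous_besselQuot m).mul
    (continuous_besselQuot n)).aestronglyMeasurable ?_
  refine (ae_restrict_iff' measurableSet_Ioi).2 (Eventually.of_forall fun r hr => ?_)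
  have hr : (0 : ℝ) ≤ r := le_of_lt hr
  rw [← div_eq_mul_inv, le_div_iff₀ (by positivity), norm_mul, Real.norm_eq_abs, Real.norm_eq_abs]
  have h1 := mul_le_mul (abs_besselQuot_le_two m hr) (abs_besselQuot_le_two n hr)
    (abs_nonneg _) zero_le_two
  have h2 := mul_le_mul (mul_abs_besselQuot_le m hr) (mul_abs_besselQuot_le n hr)
    (by positivity) (by positivity)
  nlinarith

/-- Since `r q_n² = n J_n q_n`, the integrand is `n/2` times the derivative of the deficit, which
climbs from `0` to `1`. Positivity of this derivative gives integrability as well. -/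
lemma integral_mul_besselQuot_sq (n : ℕ) (hn : 1 ≤ n) :
    IntegrableOn (fun r => r * besselQuot n r ^ 2) (Ioi 0) ∧
      ∫ r in Ioi 0, r * besselQuot n r ^ 2 = n / 2 := by
  obtain ⟨n, rfl⟩ := Nat.exists_eq_add_of_le' hn
  have heq : ∀ r : ℝ, r * besselQuot (n + 1) r ^ 2
      = ((n + 1 : ℕ) / 2 : ℝ) * (2 * (besselTwo (n + 1) r * besselQuot (n + 1) r)) := by
    intro r
    rw [pow_two, ← mul_assoc, mul_besselQuot]; ring
  have hlim : Tendsto (besselDeficit (n + 1)) atTop (𝓝 1) := by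
    have : Tendsto (besselDeficit (n + 1)) atTop
        (𝓝 (1 - ∑ i ∈ Finset.range (n + 1), ((0 : ℝ) ^ 2 + 0 ^ 2))) :=
      tendsto_const_nhds.sub (tendsto_finsetSum _ fun i _ =>
        ((tendsto_besselTwo_atTop i).pow 2).add ((tendsto_besselTwo_atTop (i + 1)).pow 2))
    simpa using this
  have hpos : ∀ x ∈ Ioi (0 : ℝ), 0 ≤ 2 * (besselTwo (n + 1) x * besselQuot (n + 1) x) :=
    fun x hx => mul_nonneg zero_le_two (besselTwo_mul_besselQuot_nonneg _ (le_of_lt hx))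
  have hcont := (hasDerivAt_besselDeficit_succ n 0).continuousAt.continuousWithinAt (s := Ici 0)
  simp only [heq]
  constructor
  · exact (integrableOn_Ioi_deriv_of_nonneg hcont
      (fun x _ => hasDerivAt_besselDeficit_succ n x) hpos hlim).const_mul _
  · rw [integral_const_mul, integral_Ioi_of_hasDerivAt_of_nonneg hcont
      (fun x _ => hasDerivAt_besselDeficit_succ n x) hpos hlim, besselDeficit_succ_zero]
    push_cast; ring

/-! ### Covariances without damping -/

/-- The integral `∫_0^∞ m n J_m(2r) J_n(2r) / r² dr`. -/
noncomputable def besselCov (m n : ℕ) : ℝ := ∫ r in Ioi 0, besselQuot m r * besselQuot n r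

lemma besselCov_comm (m n : ℕ) : besselCov m n = besselCov n m := by
  simp only [besselCov, mul_comm]

lemma besselCov_zero_left (n : ℕ) : besselCov 0 n = 0 := by
  simp [besselCov, besselQuot]

/-- The left side is the integral of `(q_{m+1} q_{n+1})'`. The product vanishes at infinity, and at
`0` it is nonzero only when both indices are `1`. -/
lemma besselCov_recurrence (m n : ℕ) :
    besselCov m (n + 1) - besselCov (m + 2) (n + 1) + besselCov (m + 1) n - besselCov (m + 1) (n + 2)
      = -if m = 0 ∧ n = 0 then 1 else 0 := by
  have hd : ∀ r ∈ Ioi (0 : ℝ), HasDerivAt (fun r => besselQuot (m + 1) r * besselQuot (n + 1) r)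
      (besselQuot m r * besselQuot (n + 1) r - besselQuot (m + 2) r * besselQuot (n + 1) r
        + besselQuot (m + 1) r * besselQuot n r - besselQuot (m + 1) r * besselQuot (n + 2) r) r :=
    fun r _ => ((hasDerivAt_besselQuot_succ m r).mul (hasDerivAt_besselQuot_succ n r)).congr_deriv
      (by ring)
  have hi := fun m n => integrableOn_besselQuot_mul m n
  have h := integral_Ioi_of_hasDerivAt_of_tendsto
    (f := fun r => besselQuot (m + 1) r * besselQuot (n + 1) r) (m := 0)
    ((continuous_besselQuot (m + 1)).mul (continuous_besselQuot (n + 1))).continuousWithinAt hd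
    ((((hi m (n + 1)).sub (hi (m + 2) (n + 1))).add (hi (m + 1) n)).sub (hi (m + 1) (n + 2)))
    (by simpa using (tendsto_besselQuot_atTop (m + 1)).mul (tendsto_besselQuot_atTop (n + 1)))
  rw [integral_sub, integral_add, integral_sub] at h
  · rw [besselCov, besselCov, besselCov, besselCov, h, besselQuot_zero, besselQuot_zero]
    rcases m with _ | m <;> rcases n with _ | n <;> simp
  all_goals first
    | exact hi _ _
    | exact (hi _ _).sub (hi _ _)
    | exact ((hi _ _).sub (hi _ _)).add (hi _ _)

/-- On the diagonal `m = n` the recurrence and symmetry relate two consecutive values only: they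
agree, except that the source at `(0,0)` raises the first from `0` to `1/2`. -/
lemma besselCov_succ (m : ℕ) : besselCov (m + 1) (m + 2) = 1 / 2 := by
  induction m with
  | zero =>
    have h := besselCov_recurrence 0 0
    rw [besselCov_comm (0 + 2), besselCov_comm (0 + 1) 0, besselCov_zero_left] at h
    norm_num at h ⊢
    linarith
  | succ m ih =>
    have h := besselCov_recurrence (m + 1) (m + 1)
    rw [besselCov_comm (m + 1 + 2), besselCov_comm (m + 1 + 1) (m + 1)] at h
    simp [add_assoc] at h ih ⊢
    linarith

/-- The recurrence carries the zero border value along each line of fixed difference. For difference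
`3` the two neighbours of value `1/2` cancel; for larger differences the neighbours vanish by
induction. -/
lemma besselCov_odd (d m : ℕ) : besselCov m (m + 2 * d + 3) = 0 := by
  induction d generalizing m with
  | zero =>
    induction m with
    | zero => exact besselCov_zero_left _
    | succ m ih =>
      have h := besselCov_recurrence m (m + 2)
      have h1 := besselCov_succ m
      have h2 := besselCov_succ (m + 1)
      simp [add_assoc, add_comm, add_left_comm] at h ih h1 h2 ⊢
      linarith
  | succ d ihd =>
    induction m with
    | zero => exact besselCov_zero_left _
    | succ m ih =>
      have h := besselCov_recurrence m (m + 2 * d + 4)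
      have h1 := ihd (m + 1)
      have h2 := ihd (m + 2)
      simp only [show m + 2 * (d + 1) + 3 = m + 2 * d + 5 by ring,
        show m + 1 + 2 * d + 3 = m + 2 * d + 4 by ring,
        show m + 2 + 2 * d + 3 = m + 2 * d + 5 by ring,
        show m + 1 + 2 * (d + 1) + 3 = m + 2 * d + 6 by ring,
        show m + 2 * d + 4 + 1 = m + 2 * d + 5 by ring,
        show m + 2 * d + 4 + 2 = m + 2 * d + 6 by ring] at h ih h1 h2 ⊢
      rw [if_neg (by omega)] at h
      linarith

/-- The recurrence and the zero border propagate the diagonal to every even difference. The answer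
has a d'Alembert form: `g` at the half-sum minus `g` at the half-difference, with alternating sign.
It satisfies the recurrence for any `g`, so the actual diagonal is needed only later. -/
lemma besselCov_even_of_diag {c : ℝ} {g : ℕ → ℝ}
    (hdiag : ∀ m, besselCov m m = c * (g m - g 0)) (d m : ℕ) :
    besselCov m (m + 2 * d) = c * (-1) ^ d * (g (m + d) - g d) := by
  induction d generalizing m with
  | zero => simpa using hdiag m
  | succ d ihd =>
    induction m with
    | zero => simp [besselCov_zero_left]
    | succ m ih =>
      have h := besselCov_recurrence m (m + 2 * d + 1)
      have h1 := ihd (m + 1)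
      have h2 := ihd (m + 2)
      simp only [show m + 2 * (d + 1) = m + 2 * d + 2 by ring,
        show m + 1 + 2 * d = m + 2 * d + 1 by ring,
        show m + 2 + 2 * d = m + 2 * d + 2 by ring,
        show m + 1 + 2 * (d + 1) = m + 2 * d + 3 by ring,
        show m + 2 * d + 1 + 1 = m + 2 * d + 2 by ring,
        show m + 2 * d + 1 + 2 = m + 2 * d + 3 by ring,
        show m + (d + 1) = m + d + 1 by ring,
        show m + 1 + d = m + d + 1 by ring,
        show m + 2 + d = m + d + 2 by ring,
        show m + 1 + (d + 1) = m + d + 2 by ring] at h ih h1 h2 ⊢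
      rw [if_neg (by omega), neg_zero] at h
      rw [pow_succ] at ih ⊢
      linear_combination -h + ih - h2 + h1

/-! ### Laplace transforms -/

lemma integrableOn_one_add_mul_exp {s : ℝ} (hs : 0 < s) :
    IntegrableOn (fun r : ℝ => (1 + r) * Real.exp (-s * r)) (Ioi 0) := by
  have h0 : IntegrableOn (fun r : ℝ => Real.exp (-s * r)) (Ioi 0) :=
    exp_neg_integrableOn_Ioi 0 hs
  have h1 := integrableOn_rpow_mul_exp_neg_mul_rpow (s := 1) (p := 1) (b := s) (by norm_num)
    one_pos hs
  simp only [Real.rpow_one] at h1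
  refine (h0.add h1).congr (Eventually.of_forall fun r => ?_)
  simp only [Pi.add_apply]; ring

lemma integrableOn_exp_mul_of_le {f : ℝ → ℝ} (hf : Continuous f) {C s : ℝ} (hs : 0 < s)
    (hb : ∀ r, 0 ≤ r → |f r| ≤ C * (1 + r)) :
    IntegrableOn (fun r => Real.exp (-s * r) * f r) (Ioi 0) := by
  refine ((integrableOn_one_add_mul_exp hs).const_mul C).mono'
    (by fun_prop : Continuous fun r => Real.exp (-s * r) * f r).aestronglyMeasurable ?_
  refine (ae_restrict_iff' measurableSet_Ioi).2 (Eventually.of_forall fun r hr => ?_)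
  rw [norm_mul, Real.norm_eq_abs, Real.norm_eq_abs, Real.abs_exp]
  have := mul_le_mul_of_nonneg_left (hb r (le_of_lt hr)) (Real.exp_pos (-s * r)).le
  linarith

lemma tendsto_exp_mul_of_le {f : ℝ → ℝ} {C s : ℝ} (hs : 0 < s)
    (hb : ∀ r, 0 ≤ r → |f r| ≤ C * (1 + r)) :
    Tendsto (fun r => Real.exp (-s * r) * f r) atTop (𝓝 0) := by
  have h0 := tendsto_rpow_mul_exp_neg_mul_atTop_nhds_zero 0 s hs
  have h1 := tendsto_rpow_mul_exp_neg_mul_atTop_nhds_zero 1 s hs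
  simp only [Real.rpow_zero, Real.rpow_one] at h0 h1
  have h2 : Tendsto (fun r => C * (1 * Real.exp (-s * r) + r * Real.exp (-s * r))) atTop (𝓝 0) := by
    simpa using (h0.add h1).const_mul C
  refine squeeze_zero_norm' ?_ h2
  filter_upwards [eventually_ge_atTop 0] with r hr
  rw [norm_mul, Real.norm_eq_abs, Real.norm_eq_abs, Real.abs_exp]
  have := mul_le_mul_of_nonneg_left (hb r hr) (Real.exp_pos (-s * r)).le
  linarith

/-- Integration by parts: the rule for the Laplace transform of a derivative. Linear growth is
admitted so that it applies to `r J_n(2r)` too. -/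
lemma mul_laplace_eq {f g : ℝ → ℝ} (hfg : ∀ r, HasDerivAt f (g r) r) (hg : Continuous g)
    {C s : ℝ} (hs : 0 < s) (hf_le : ∀ r, 0 ≤ r → |f r| ≤ C * (1 + r))
    (hg_le : ∀ r, 0 ≤ r → |g r| ≤ C * (1 + r)) :
    s * ∫ r in Ioi 0, Real.exp (-s * r) * f r
      = f 0 + ∫ r in Ioi 0, Real.exp (-s * r) * g r := by
  have hf : Continuous f := continuous_iff_continuousAt.2 fun r => (hfg r).continuousAt
  have hd : ∀ r ∈ Ioi (0 : ℝ), HasDerivAt (fun r => Real.exp (-s * r) * f r)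
      (Real.exp (-s * r) * g r - s * (Real.exp (-s * r) * f r)) r := by
    intro r _
    have h1 : HasDerivAt (fun r : ℝ => Real.exp (-s * r)) (Real.exp (-s * r) * (-s * 1)) r :=
      ((hasDerivAt_id r).const_mul (-s)).exp
    exact (h1.mul (hfg r)).congr_deriv (by ring)
  have hif := integrableOn_exp_mul_of_le hf hs hf_le
  have hig := integrableOn_exp_mul_of_le hg hs hg_le
  have h := integral_Ioi_of_hasDerivAt_of_tendsto
    (by fun_prop : Continuous fun r => Real.exp (-s * r) * f r).continuousWithinAt hd
    (hig.sub (hif.const_mul s)) (tendsto_exp_mul_of_le hs hf_le)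
  rw [integral_sub hig (hif.const_mul s), integral_const_mul] at h
  simp only [mul_zero, Real.exp_zero, one_mul] at h
  linarith

/-- The Laplace transform of `r ↦ J_n(2r)`. -/
noncomputable def besselLaplace (n : ℕ) (s : ℝ) : ℝ := ∫ r in Ioi 0, Real.exp (-s * r) * besselTwo n r

lemma abs_besselTwo_le (n : ℕ) (r : ℝ) (hr : 0 ≤ r) : |besselTwo n r| ≤ 2 * (1 + r) := by
  linarith [abs_besselTwo_le_one n hr]

lemma mul_besselLaplace_zero {s : ℝ} (hs : 0 < s) :
    s * besselLaplace 0 s = 1 - 2 * besselLaplace 1 s := by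
  have h := mul_laplace_eq hasDerivAt_besselTwo_zero
    ((continuous_besselTwo 1).const_mul (-2)) (C := 2) hs (abs_besselTwo_le 0) fun r hr => by
      rw [abs_mul, abs_neg, abs_two]; linarith [abs_besselTwo_le_one 1 hr]
  rw [besselLaplace, h, besselTwo_zero, if_pos rfl, besselLaplace]
  simp only [mul_left_comm _ (-2 : ℝ)]
  rw [integral_const_mul]; ring

lemma mul_besselLaplace_succ (n : ℕ) {s : ℝ} (hs : 0 < s) :
    s * besselLaplace (n + 1) s = besselLaplace n s - besselLaplace (n + 2) s := by
  have h := mul_laplace_eq (hasDerivAt_besselTwo_succ n)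
    ((continuous_besselTwo n).sub (continuous_besselTwo (n + 2))) (C := 2) hs
    (abs_besselTwo_le (n + 1)) fun r hr => (abs_sub _ _).trans (by
      linarith [abs_besselTwo_le_one n hr, abs_besselTwo_le_one (n + 2) hr])
  rw [besselLaplace, h, besselTwo_zero, if_neg (Nat.succ_ne_zero n), zero_add, besselLaplace,
    besselLaplace, ← integral_sub]
  · simp only [mul_sub]
  · exact integrableOn_exp_mul_of_le (continuous_besselTwo n) hs (abs_besselTwo_le n)
  · exact integrableOn_exp_mul_of_le (continuous_besselTwo _) hs (abs_besselTwo_le _)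

lemma hasDerivAt_besselLaplace_zero {s : ℝ} (hs : 0 < s) :
    HasDerivAt (besselLaplace 0)
      (-∫ r in Ioi 0, Real.exp (-s * r) * (r * besselTwo 0 r)) s := by
  have hc := continuous_besselTwo 0
  have h := hasDerivAt_integral_of_dominated_loc_of_deriv_le (μ := volume.restrict (Ioi 0))
    (F := fun s r => Real.exp (-s * r) * besselTwo 0 r)
    (F' := fun s r => -(Real.exp (-s * r) * (r * besselTwo 0 r)))
    (x₀ := s) (s := Ioi (s / 2)) (bound := fun r => (1 + r) * Real.exp (-(s / 2) * r))
    (Ioi_mem_nhds (by linarith))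
    (Eventually.of_forall fun s => (by fun_prop : Continuous
      fun r => Real.exp (-s * r) * besselTwo 0 r).aestronglyMeasurable)
    (integrableOn_exp_mul_of_le hc hs (abs_besselTwo_le 0))
    (by fun_prop : Continuous
      fun r => -(Real.exp (-s * r) * (r * besselTwo 0 r))).aestronglyMeasurable
    ((ae_restrict_iff' measurableSet_Ioi).2 (Eventually.of_forall fun r hr t ht => ?_))
    (integrableOn_one_add_mul_exp (by linarith))
    (Eventually.of_forall fun r t _ => ?_)
  · refine h.2.congr_deriv ?_
    rw [integral_neg]
  · have hr : (0 : ℝ) < r := hr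
    have ht : s / 2 < t := ht
    rw [norm_neg, norm_mul, norm_mul, Real.norm_eq_abs, Real.abs_exp, Real.norm_eq_abs,
      Real.norm_eq_abs, abs_of_pos hr, mul_comm (1 + r)]
    have h1 : Real.exp (-t * r) ≤ Real.exp (-(s / 2) * r) := Real.exp_le_exp.2 (by nlinarith)
    have h2 := abs_besselTwo_le_one 0 hr.le
    refine mul_le_mul h1 ?_ (by positivity) (Real.exp_pos _).le
    nlinarith
  · have h1 : HasDerivAt (fun t : ℝ => Real.exp (-t * r)) (Real.exp (-t * r) * (-1 * r)) t :=
      ((hasDerivAt_id t).neg.mul_const r).exp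
    exact (h1.mul_const _).congr_deriv (by ring)

/-- Apply the derivative rule to `r J_1(2r)`, whose derivative is `2 r J_0(2r)`, and to `r J_0(2r)`,
then eliminate the transform of `r J_1`. Since the integral is minus the derivative of
`besselLaplace 0`, this is a first-order differential equation for it. -/
lemma laplace_mul_besselTwo_zero {s : ℝ} (hs : 0 < s) :
    (s ^ 2 + 4) * ∫ r in Ioi 0, Real.exp (-s * r) * (r * besselTwo 0 r)
      = s * besselLaplace 0 s := by
  have hc0 := continuous_besselTwo 0
  have hc1 := continuous_besselTwo 1
  have hle : ∀ n r, 0 ≤ r → |r * besselTwo n r| ≤ 3 * (1 + r) := fun n r hr => by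
    rw [abs_mul, abs_of_nonneg hr]; nlinarith [abs_besselTwo_le_one n hr]
  have h1 := mul_laplace_eq (f := fun r => r * besselTwo 1 r) (g := fun r => 2 * (r * besselTwo 0 r))
    (fun r => ((hasDerivAt_id r).mul (hasDerivAt_besselTwo_succ 0 r)).congr_deriv (by
      have h2 := mul_besselQuot 1 r
      simp only [besselQuot, Nat.cast_one, one_mul, id] at h2 ⊢
      linear_combination -h2)) (by fun_prop) (C := 3) hs
    (hle 1) (fun r hr => by
      rw [abs_mul, abs_two, abs_mul, abs_of_nonneg hr]; nlinarith [abs_besselTwo_le_one 0 hr])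
  have h2 := mul_laplace_eq (f := fun r => r * besselTwo 0 r)
    (g := fun r => besselTwo 0 r - 2 * (r * besselTwo 1 r))
    (fun r => ((hasDerivAt_id r).mul (hasDerivAt_besselTwo_zero r)).congr_deriv (by
      simp only [id]; ring)) (by fun_prop) (C := 3) hs
    (hle 0) (fun r hr => (abs_sub _ _).trans (by
      rw [abs_mul, abs_two, abs_mul, abs_of_nonneg hr]
      nlinarith [abs_besselTwo_le_one 0 hr, abs_besselTwo_le_one 1 hr]))
  have hi0 := integrableOn_exp_mul_of_le hc0 hs (abs_besselTwo_le 0)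
  have hi1 := integrableOn_exp_mul_of_le (f := fun r => r * besselTwo 1 r) (by fun_prop) hs (hle 1)
  simp only [mul_left_comm _ (2 : ℝ), mul_sub] at h1 h2
  rw [integral_const_mul] at h1
  rw [integral_sub hi0 (hi1.const_mul 2), integral_const_mul] at h2
  simp only [zero_mul, zero_add] at h1 h2
  rw [besselLaplace]
  linear_combination s * h2 - 2 * h1

lemma abs_besselLaplace_le (n : ℕ) {s : ℝ} (hs : 0 < s) : |besselLaplace n s| ≤ 1 / s := by
  have h : ∫ r in Ioi 0, Real.exp (-s * r) = 1 / s := by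
    rw [integral_exp_mul_Ioi (by linarith)]; simp
  rw [← h, ← Real.norm_eq_abs]
  refine norm_integral_le_of_norm_le (exp_neg_integrableOn_Ioi 0 hs)
    ((ae_restrict_iff' measurableSet_Ioi).2 (Eventually.of_forall fun r hr => ?_))
  rw [norm_mul, Real.norm_eq_abs, Real.norm_eq_abs, Real.abs_exp]
  exact mul_le_of_le_one_right (Real.exp_pos _).le (abs_besselTwo_le_one n (le_of_lt hr))

/-- The differential equation makes `besselLaplace 0 t * √(t ^ 2 + 4)` constant; its value is read
off at infinity, where `t * besselLaplace 0 t` tends to `1`. -/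
lemma besselLaplace_zero_eq {s : ℝ} (hs : 0 < s) :
    besselLaplace 0 s = 1 / √(s ^ 2 + 4) := by
  have hsq : ∀ t : ℝ, 0 < √(t ^ 2 + 4) := fun t => Real.sqrt_pos.2 (by positivity)
  have hd : ∀ t : ℝ, 0 < t → HasDerivAt (fun t => besselLaplace 0 t * √(t ^ 2 + 4)) 0 t := by
    intro t ht
    have h1 : HasDerivAt (fun t : ℝ => √(t ^ 2 + 4)) (2 * t / (2 * √(t ^ 2 + 4))) t :=
      (((hasDerivAt_pow 2 t).add_const 4).congr_deriv (by simp)).sqrt (by positivity)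
    refine ((hasDerivAt_besselLaplace_zero ht).mul h1).congr_deriv ?_
    have h2 := laplace_mul_besselTwo_zero ht
    have h3 := hsq t
    have h4 : √(t ^ 2 + 4) ^ 2 = t ^ 2 + 4 := Real.sq_sqrt (by positivity)
    generalize (∫ r in Ioi 0, Real.exp (-t * r) * (r * besselTwo 0 r)) = M at h2 ⊢
    field_simp
    rw [h4]
    linear_combination -h2
  have hconst : ∀ t, 0 < t → besselLaplace 0 t * √(t ^ 2 + 4) = besselLaplace 0 s * √(s ^ 2 + 4) :=
    fun t ht => isOpen_Ioi.is_const_of_deriv_eq_zero isPreconnected_Ioi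
      (fun x hx => (hd x hx).differentiableAt.differentiableWithinAt) (fun x hx => (hd x hx).deriv)
      ht hs
  have hL1 : Tendsto (besselLaplace 1) atTop (𝓝 0) := by
    refine squeeze_zero_norm' (a := fun t : ℝ => 1 / t) ?_ (tendsto_const_nhds.div_atTop tendsto_id)
    filter_upwards [eventually_gt_atTop 0] with t ht using abs_besselLaplace_le 1 ht
  have hsqrt : Tendsto (fun t : ℝ => √(1 + 4 / t ^ 2)) atTop (𝓝 1) := by
    have h : Tendsto (fun t : ℝ => 1 + 4 / t ^ 2) atTop (𝓝 (1 + 0)) :=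
      tendsto_const_nhds.add (tendsto_const_nhds.div_atTop (tendsto_pow_atTop two_ne_zero))
    simpa using h.sqrt
  have hlim : Tendsto (fun t => besselLaplace 0 t * √(t ^ 2 + 4)) atTop (𝓝 1) := by
    have h : Tendsto (fun t => (1 - 2 * besselLaplace 1 t) * √(1 + 4 / t ^ 2)) atTop (𝓝 1) := by
      simpa using ((hL1.const_mul 2).const_sub 1).mul hsqrt
    refine h.congr' ?_
    filter_upwards [eventually_gt_atTop 0] with t ht
    rw [← mul_besselLaplace_zero ht, show t ^ 2 + 4 = t ^ 2 * (1 + 4 / t ^ 2) by field_simp,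
      Real.sqrt_mul (by positivity), Real.sqrt_sq ht.le]
    ring
  have h1 : besselLaplace 0 s * √(s ^ 2 + 4) = 1 := by
    refine tendsto_nhds_unique (tendsto_const_nhds.congr' ?_) hlim
    filter_upwards [eventually_gt_atTop 0] with t ht using (hconst t ht).symm
  rw [eq_div_iff (hsq s).ne', h1]

/-- Abel values of the integrals of `J_n(2r)`. They agree for all `n` because the recurrences in `n`
lose their `s` term in the limit. -/
lemma tendsto_besselLaplace (n : ℕ) : Tendsto (besselLaplace n) (𝓝[>] 0) (𝓝 (1 / 2)) := by
  have hid : Tendsto (fun s : ℝ => s) (𝓝[>] 0) (𝓝 0) := tendsto_nhdsWithin_of_tendsto_nhds tendsto_id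
  have h0 : Tendsto (besselLaplace 0) (𝓝[>] 0) (𝓝 (1 / 2)) := by
    have h : Tendsto (fun s : ℝ => 1 / √(s ^ 2 + 4)) (𝓝[>] 0) (𝓝 (1 / √(0 ^ 2 + 4))) :=
      tendsto_const_nhds.div ((hid.pow 2).add_const 4).sqrt (by positivity)
    rw [show (0 : ℝ) ^ 2 + 4 = 2 ^ 2 by norm_num, Real.sqrt_sq zero_le_two] at h
    refine h.congr' ?_
    filter_upwards [self_mem_nhdsWithin] with s hs using (besselLaplace_zero_eq hs).symm
  induction n using Nat.strong_induction_on with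
  | _ n ih =>
    rcases n with _ | _ | n
    · exact h0
    · have h : Tendsto (fun s => (1 - s * besselLaplace 0 s) / 2) (𝓝[>] 0) (𝓝 (1 / 2)) := by
        simpa using ((hid.mul h0).const_sub 1).div_const 2
      refine h.congr' ?_
      filter_upwards [self_mem_nhdsWithin] with s hs
      rw [mul_besselLaplace_zero hs]; ring
    · have h : Tendsto (fun s => besselLaplace n s - s * besselLaplace (n + 1) s) (𝓝[>] 0)
          (𝓝 (1 / 2)) := by
        simpa using (ih n (by omega)).sub (hid.mul (ih (n + 1) (by omega)))
      refine h.congr' ?_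
      filter_upwards [self_mem_nhdsWithin] with s hs
      rw [mul_besselLaplace_succ n hs]; ring

/-! ### The product series and the diagonal covariances -/

/-- Vandermonde's identity for `(m + n + 2k).choose k`, divided by `(n + k)! (m + k)!`. -/
lemma sum_antidiagonal_inv_factorial (m n k : ℕ) :
    ∑ p ∈ Finset.HasAntidiagonal.antidiagonal k,
        1 / ((p.1 ! : ℝ) * ((p.1 + m)! : ℝ)) * (1 / ((p.2 ! : ℝ) * ((p.2 + n)! : ℝ)))
      = ((m + n + 2 * k)! : ℝ) / (k ! * (m + k)! * (n + k)! * (m + n + k)!) := by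
  have h := Nat.add_choose_eq (n + k) (m + k) k
  have h1 : ((n + k + (m + k)).choose k : ℝ) = (m + n + 2 * k)! / (k ! * (m + n + k)!) := by
    rw [show n + k + (m + k) = k + (m + n + k) by ring, Nat.cast_add_choose,
      show k + (m + n + k) = m + n + 2 * k by ring]
  have h2 : ((n + k + (m + k)).choose k : ℝ) = ∑ p ∈ Finset.HasAntidiagonal.antidiagonal k,
      ((n + k)! / (p.1 ! * (p.2 + n)!) : ℝ) * ((m + k)! / (p.2 ! * (p.1 + m)!)) := by
    rw [h]; push_cast
    refine Finset.sum_congr rfl fun p hp => ?_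
    have hp : p.1 + p.2 = k := Finset.HasAntidiagonal.mem_antidiagonal.1 hp
    rw [show n + k = p.1 + (p.2 + n) by omega, show m + k = p.2 + (p.1 + m) by omega,
      Nat.cast_add_choose, Nat.cast_add_choose]
  have h3 : ((m + n + 2 * k)! : ℝ) / (k ! * (m + k)! * (n + k)! * (m + n + k)!)
      = ((n + k + (m + k)).choose k : ℝ) / ((n + k)! * (m + k)!) := by
    rw [h1]; field_simp
  rw [h3, h2, Finset.sum_div]
  refine Finset.sum_congr rfl fun p _ => ?_
  field_simp

/-- The coefficients of the power series of `J_m(2r) J_n(2r)`. -/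
noncomputable def besselMulCoeff (m n k : ℕ) : ℝ :=
  (-1) ^ k * ((m + n + 2 * k)! / (k ! * (m + k)! * (n + k)! * (m + n + k)!))

lemma hasSum_besselTwo_mul (m n : ℕ) (r : ℝ) :
    HasSum (fun k => besselMulCoeff m n k * r ^ (m + n + 2 * k)) (besselTwo m r * besselTwo n r) := by
  have hm := (summable_besselEntire m (r ^ 2)).norm
  have hn := (summable_besselEntire n (r ^ 2)).norm
  have h := (summable_norm_sum_mul_antidiagonal_of_summable_norm hm hn).of_norm.hasSum.mul_left
    (r ^ m * r ^ n)
  rw [← tsum_mul_tsum_eq_tsum_sum_antidiagonal_of_summable_norm hm hn] at h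
  have hv : besselTwo m r * besselTwo n r
      = r ^ m * r ^ n * (besselEntire m (r ^ 2) * besselEntire n (r ^ 2)) := by
    rw [besselTwo_eq, besselTwo_eq]; ring
  rw [hv]
  refine h.congr_fun fun k => ?_
  rw [besselMulCoeff, ← sum_antidiagonal_inv_factorial, Finset.mul_sum, Finset.mul_sum,
    Finset.sum_mul]
  refine Finset.sum_congr rfl fun p hp => ?_
  have hp : p.1 + p.2 = k := Finset.HasAntidiagonal.mem_antidiagonal.1 hp
  rw [← hp]; ring

lemma hasSum_besselTwo (n : ℕ) (r : ℝ) :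
    HasSum (fun k : ℕ => (-1 : ℝ) ^ k / ((k ! : ℝ) * ((k + n)! : ℝ)) * r ^ (n + 2 * k))
      (besselTwo n r) := by
  have h := (summable_besselEntire n (r ^ 2)).hasSum.mul_left (r ^ n)
  rw [← besselEntire, ← besselTwo_eq] at h
  refine h.congr_fun fun k => ?_
  ring

lemma integral_sin_pow_two_mul (n : ℕ) :
    ∫ θ in (0 : ℝ)..Real.pi, Real.sin θ ^ (2 * n)
      = Real.pi * ((2 * n)! / (4 ^ n * (n ! : ℝ) ^ 2)) := by
  rw [integral_sin_pow_even]
  congr 1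
  induction n with
  | zero => simp
  | succ n ih =>
    rw [Finset.prod_range_succ, ih, show 2 * (n + 1) = 2 * n + 1 + 1 by ring, Nat.factorial_succ,
      Nat.factorial_succ, Nat.factorial_succ]
    push_cast
    field_simp
    ring

/-- Both sides are power series in `r`; Wallis' integral matches the coefficients. The formula
trades a square for a single Bessel function, and the angle enters only through a rescaling of `r`.
-/
lemma besselTwo_sq_eq_integral (n : ℕ) (r : ℝ) :
    ∫ θ in (0 : ℝ)..Real.pi, besselTwo (2 * n) (2 * r * Real.sin θ)
      = Real.pi * besselTwo n r ^ 2 := by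
  have hterm : ∀ k : ℕ, ∫ θ in (0 : ℝ)..Real.pi, (-1 : ℝ) ^ k / ((k ! : ℝ) * ((k + 2 * n)! : ℝ))
      * (2 * r * Real.sin θ) ^ (2 * n + 2 * k)
      = Real.pi * (besselMulCoeff n n k * r ^ (n + n + 2 * k)) := by
    intro k
    simp only [mul_pow _ (Real.sin _), ← mul_add]
    rw [intervalIntegral.integral_const_mul, intervalIntegral.integral_const_mul,
      integral_sin_pow_two_mul, besselMulCoeff, show n + n + 2 * k = 2 * (n + k) by ring,
      show n + n + k = k + 2 * n by ring, mul_pow, pow_mul 2 2]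
    norm_num
    field_simp
  have h1 : HasSum (fun k : ℕ => ∫ θ in (0 : ℝ)..Real.pi,
      (-1 : ℝ) ^ k / ((k ! : ℝ) * ((k + 2 * n)! : ℝ)) * (2 * r * Real.sin θ) ^ (2 * n + 2 * k))
      (∫ θ in (0 : ℝ)..Real.pi, besselTwo (2 * n) (2 * r * Real.sin θ)) := by
    have hs : Summable fun k : ℕ => |2 * r| ^ (2 * n) * ((|2 * r| ^ 2) ^ k / k !) :=
      (Real.summable_pow_div_factorial (|2 * r| ^ 2)).mul_left _
    refine intervalIntegral.hasSum_integral_of_dominated_convergence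
      (fun k _ => |2 * r| ^ (2 * n) * ((|2 * r| ^ 2) ^ k / k !)) (fun k => ?_) (fun k => ?_)
      (Eventually.of_forall fun _ _ => hs) intervalIntegrable_const
      (Eventually.of_forall fun θ _ => hasSum_besselTwo _ _)
    · exact (by fun_prop : Continuous fun θ => (-1 : ℝ) ^ k / ((k ! : ℝ) * ((k + 2 * n)! : ℝ))
        * (2 * r * Real.sin θ) ^ (2 * n + 2 * k)).aestronglyMeasurable
    · refine Eventually.of_forall fun θ _ => ?_
      rw [pow_add, pow_mul _ 2 k, mul_left_comm, norm_mul]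
      refine mul_le_mul ?_ ((norm_besselEntire_term_le _ _ _).trans ?_) (norm_nonneg _)
        (by positivity)
      · rw [norm_pow, norm_mul, Real.norm_eq_abs]
        exact pow_le_pow_left₀ (by positivity)
          (mul_le_of_le_one_right (abs_nonneg _) (Real.abs_sin_le_one θ)) _
      · rw [abs_pow, abs_mul]
        gcongr
        exact mul_le_of_le_one_right (abs_nonneg _) (Real.abs_sin_le_one θ)
  simp only [hterm] at h1
  rw [h1.unique ((hasSum_besselTwo_mul n n r).mul_left _), pow_two]

/-- The function `r ↦ J_{n+2}(2r) / r²`. -/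
noncomputable def besselQuotSq (n : ℕ) (r : ℝ) : ℝ :=
  (besselQuot (n + 1) r / (n + 1) + besselQuot (n + 3) r / (n + 3)) / (n + 2)

lemma sq_mul_besselQuotSq (n : ℕ) (r : ℝ) : r ^ 2 * besselQuotSq n r = besselTwo (n + 2) r := by
  have h1 := mul_besselQuot (n + 1) r
  have h2 := mul_besselQuot (n + 3) r
  have h3 := mul_besselQuot (n + 2) r
  simp only [besselQuot] at h3
  push_cast at h1 h2 h3
  calc r ^ 2 * besselQuotSq n r = r * (r * besselQuot (n + 1) r / (n + 1)
        + r * besselQuot (n + 3) r / (n + 3)) / (n + 2) := by rw [besselQuotSq]; ring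
    _ = r * (besselTwo (n + 1) r + besselTwo (n + 1 + 2) r) / (n + 2) := by
        rw [h1, h2]; congr 2
        rw [mul_div_cancel_left₀ _ (by positivity), mul_div_cancel_left₀ _ (by positivity)]
    _ = _ := by rw [h3, mul_div_cancel_left₀ _ (by positivity)]

lemma continuous_besselQuotSq (n : ℕ) : Continuous (besselQuotSq n) := by
  have h1 := continuous_besselQuot (n + 1)
  have h3 := continuous_besselQuot (n + 3)
  unfold besselQuotSq
  fun_prop

lemma abs_besselQuotSq_le (n : ℕ) {r : ℝ} (hr : 0 ≤ r) : |besselQuotSq n r| ≤ 5 / (1 + r ^ 2) := by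
  have h2 : r ^ 2 * |besselQuotSq n r| ≤ 1 := by
    have h : r ^ 2 * |besselQuotSq n r| = |r ^ 2 * besselQuotSq n r| := by
      rw [abs_mul, abs_of_nonneg (sq_nonneg r)]
    rw [h, sq_mul_besselQuotSq]; exact abs_besselTwo_le_one _ hr
  have h1 : |besselQuotSq n r| ≤ 4 := by
    have h : ∀ x c : ℝ, |x| ≤ 2 → 1 ≤ c → |x / c| ≤ 2 := fun x c hx hc => by
      have hc0 : 0 < c := by linarith
      rw [abs_div, abs_of_pos hc0, div_le_iff₀ hc0]; linarith
    have ha := h _ (n + 1 : ℝ) (abs_besselQuot_le_two (n + 1) hr) (by linarith [n.cast_nonneg (α := ℝ)])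
    have hb := h _ (n + 3 : ℝ) (abs_besselQuot_le_two (n + 3) hr) (by linarith [n.cast_nonneg (α := ℝ)])
    rw [besselQuotSq, abs_div, div_le_iff₀ (by positivity),
      abs_of_nonneg (by positivity : (0 : ℝ) ≤ n + 2)]
    refine (abs_add_le _ _).trans ?_
    linarith [n.cast_nonneg (α := ℝ)]
  rw [le_div_iff₀ (by positivity)]
  nlinarith

lemma integrableOn_besselQuotSq (n : ℕ) : IntegrableOn (besselQuotSq n) (Ioi 0) := by
  refine ((integrable_inv_one_add_sq.const_mul 5).integrableOn).mono'
    (continuous_besselQuotSq n).aestronglyMeasurable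
    ((ae_restrict_iff' measurableSet_Ioi).2 (Eventually.of_forall fun r hr => ?_))
  exact abs_besselQuotSq_le n (le_of_lt hr)

lemma integral_exp_mul_besselQuot_succ (n : ℕ) {s : ℝ} (hs : 0 < s) :
    ∫ r in Ioi 0, Real.exp (-s * r) * besselQuot (n + 1) r
      = besselLaplace n s + besselLaplace (n + 2) s := by
  rw [besselLaplace, besselLaplace, ← integral_add
    (integrableOn_exp_mul_of_le (continuous_besselTwo n) hs (abs_besselTwo_le n))
    (integrableOn_exp_mul_of_le (continuous_besselTwo _) hs (abs_besselTwo_le _))]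
  simp only [besselQuot, mul_add]

/-- `J_{n+2}(2r)/r²` is a combination of `J_n`, `J_{n+2}` and `J_{n+4}`. Their integrals are
available only as Abel limits, so a factor `exp(-sr)` is inserted and removed by dominated
convergence. -/
lemma integral_besselQuotSq (n : ℕ) :
    ∫ r in Ioi 0, besselQuotSq n r = 2 / ((n + 1) * (n + 3)) := by
  have hint : ∀ n : ℕ, ∀ s : ℝ, 0 < s →
      IntegrableOn (fun r => Real.exp (-s * r) * besselQuot n r) (Ioi 0) := fun n s hs =>
    integrableOn_exp_mul_of_le (C := 2) (continuous_besselQuot n) hs fun r hr => by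
      linarith [abs_besselQuot_le_two n hr]
  have h1 : Tendsto (fun s : ℝ => ∫ r in Ioi 0, Real.exp (-s * r) * besselQuotSq n r) (𝓝[>] 0)
      (𝓝 (∫ r in Ioi 0, besselQuotSq n r)) := by
    refine tendsto_integral_filter_of_dominated_convergence (fun r => |besselQuotSq n r|)
      ?_ ?_ (integrableOn_besselQuotSq n).abs ?_
    · have := continuous_besselQuotSq n
      exact Eventually.of_forall fun s => (by fun_prop : Continuous
        fun r => Real.exp (-s * r) * besselQuotSq n r).aestronglyMeasurable
    · filter_upwards [self_mem_nhdsWithin] with s hs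
      refine (ae_restrict_iff' measurableSet_Ioi).2 (Eventually.of_forall fun r hr => ?_)
      rw [norm_mul, Real.norm_eq_abs, Real.abs_exp]
      refine mul_le_of_le_one_left (abs_nonneg _) (Real.exp_le_one_iff.2 ?_)
      have : 0 < s * r := mul_pos hs hr
      linarith
    · refine Eventually.of_forall fun r => ?_
      have h : Tendsto (fun s : ℝ => Real.exp (-s * r) * besselQuotSq n r) (𝓝 0)
          (𝓝 (Real.exp (-0 * r) * besselQuotSq n r)) :=
        (by fun_prop : Continuous fun s : ℝ => Real.exp (-s * r) * besselQuotSq n r).tendsto 0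
      simp only [neg_zero, zero_mul, Real.exp_zero, one_mul] at h
      exact h.mono_left nhdsWithin_le_nhds
  have h2 : Tendsto (fun s : ℝ => ∫ r in Ioi 0, Real.exp (-s * r) * besselQuotSq n r) (𝓝[>] 0)
      (𝓝 (((1 / 2 + 1 / 2) / (n + 1) + (1 / 2 + 1 / 2) / (n + 3)) / (n + 2))) := by
    refine Tendsto.congr' ?_ (((((tendsto_besselLaplace n).add (tendsto_besselLaplace (n + 2))).div_const
      (n + 1 : ℝ)).add (((tendsto_besselLaplace (n + 2)).add (tendsto_besselLaplace (n + 4))).div_const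
      (n + 3 : ℝ))).div_const (n + 2 : ℝ))
    filter_upwards [self_mem_nhdsWithin] with s hs
    have e : ∀ r : ℝ, Real.exp (-s * r) * besselQuotSq n r
        = (Real.exp (-s * r) * besselQuot (n + 1) r / (n + 1)
          + Real.exp (-s * r) * besselQuot (n + 3) r / (n + 3)) / (n + 2) := fun r => by
      rw [besselQuotSq]; ring
    simp only [e]
    rw [integral_div, integral_add ((hint _ s hs).div_const _) ((hint _ s hs).div_const _),
      integral_div, integral_div, integral_exp_mul_besselQuot_succ n hs,
      integral_exp_mul_besselQuot_succ (n + 2) hs]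
  rw [tendsto_nhds_unique h1 h2]
  field_simp
  ring

lemma besselCov_self (n : ℕ) (hn : 1 ≤ n) :
    besselCov n n = 8 * n ^ 2 / (Real.pi * (4 * n ^ 2 - 1)) := by
  obtain ⟨k, rfl⟩ := Nat.exists_eq_add_of_le' hn
  set n := k + 1 with hk
  set q := besselQuotSq (2 * k) with hq
  have hqc : Continuous q := continuous_besselQuotSq _
  have hrep : ∀ r : ℝ, 0 < r → besselQuot n r * besselQuot n r
      = n ^ 2 / Real.pi * ∫ θ in (0 : ℝ)..Real.pi,
          4 * Real.sin θ ^ 2 * q (2 * r * Real.sin θ) := by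
    intro r hr
    have h1 : ∀ θ : ℝ, 4 * Real.sin θ ^ 2 * q (2 * r * Real.sin θ)
        = (1 / r ^ 2) * besselTwo (2 * n) (2 * r * Real.sin θ) := by
      intro θ
      rw [show 2 * n = 2 * k + 2 by omega, ← sq_mul_besselQuotSq]
      field_simp
      ring
    simp only [h1]
    rw [intervalIntegral.integral_const_mul, besselTwo_sq_eq_integral]
    have h2 := mul_besselQuot n r
    field_simp
    linear_combination (r * besselQuot n r + n * besselTwo n r) * h2
  have hint : Integrable (Function.uncurry fun r θ : ℝ => 4 * Real.sin θ ^ 2 * q (2 * r * Real.sin θ))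
      ((volume.restrict (Ioi 0)).prod (volume.restrict (Ioc 0 Real.pi))) := by
    -- `20 = 4 * 5`. The factor `sin² θ` compensates the slow decay of `q (2 r sin θ)` for small
    -- `sin θ`, making the bound uniform in `θ`.
    have hdom : Integrable (fun r : ℝ => 20 * (1 + r ^ 2)⁻¹) (volume.restrict (Ioi (0 : ℝ))) :=
      (integrable_inv_one_add_sq.const_mul 20).integrableOn
    refine (hdom.comp_fst (volume.restrict (Ioc 0 Real.pi))).mono' (by
      exact (by fun_prop : Continuous fun p : ℝ × ℝ =>
        4 * Real.sin p.2 ^ 2 * q (2 * p.1 * Real.sin p.2)).aestronglyMeasurable) ?_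
    rw [Measure.prod_restrict]
    refine (ae_restrict_iff' (measurableSet_Ioi.prod measurableSet_Ioc)).2
      (Eventually.of_forall fun p hp => ?_)
    obtain ⟨hr, hθ⟩ := hp
    have hr : (0 : ℝ) < p.1 := hr
    have hsin : 0 ≤ Real.sin p.2 := Real.sin_nonneg_of_mem_Icc ⟨hθ.1.le, hθ.2⟩
    have h1 := abs_besselQuotSq_le (2 * k) (r := 2 * p.1 * Real.sin p.2) (by positivity)
    simp only [Function.uncurry]
    rw [norm_mul, Real.norm_eq_abs, abs_of_nonneg (by positivity : 0 ≤ 4 * Real.sin p.2 ^ 2)]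
    refine (mul_le_mul_of_nonneg_left h1 (by positivity)).trans ?_
    rw [← div_eq_mul_inv, mul_div_assoc', div_le_div_iff₀ (by positivity) (by positivity)]
    have h2 := Real.sin_sq_le_one p.2
    nlinarith [mul_nonneg (sq_nonneg p.1) (sq_nonneg (Real.sin p.2))]
  have hinner : ∀ θ ∈ Ioc 0 Real.pi, ∫ r in Ioi 0, 4 * Real.sin θ ^ 2 * q (2 * r * Real.sin θ)
      = Real.sin θ * (2 * ∫ r in Ioi 0, q r) := by
    intro θ hθ
    rcases hθ.2.eq_or_lt with rfl | hlt
    · simp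
    · have hs : 0 < Real.sin θ := Real.sin_pos_of_pos_of_lt_pi hθ.1 hlt
      simp only [show ∀ r : ℝ, 2 * r * Real.sin θ = 2 * Real.sin θ * r from fun r => by ring]
      rw [integral_const_mul, integral_comp_mul_left_Ioi q 0 (by positivity : 0 < 2 * Real.sin θ),
        mul_zero, smul_eq_mul]
      field_simp
      ring
  rw [besselCov, setIntegral_congr_fun measurableSet_Ioi hrep, integral_const_mul]
  simp only [intervalIntegral.integral_of_le Real.pi_pos.le]
  rw [integral_integral_swap hint, setIntegral_congr_fun measurableSet_Ioc hinner,
    integral_mul_const, ← intervalIntegral.integral_of_le Real.pi_pos.le, integral_sin, hq,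
    integral_besselQuotSq, hk]
  have h3 : (4 * ((k + 1 : ℕ) : ℝ) ^ 2 - 1) = (2 * k + 1) * (2 * k + 3) := by push_cast; ring
  rw [h3]
  simp only [Real.cos_zero, Real.cos_pi]
  push_cast
  field_simp
  ring

/-- Puts the diagonal in the shape `g n - g 0` required by `besselCov_even_of_diag`, with `g x =
1/((2x)² - 1)`. -/
lemma besselCov_diag (n : ℕ) :
    besselCov n n = 2 / Real.pi * (1 / ((2 * (n : ℝ)) ^ 2 - 1) - 1 / ((2 * ((0 : ℕ) : ℝ)) ^ 2 - 1)) := by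
  rcases n with _ | n
  · simp [besselCov_zero_left]
  · rw [besselCov_self _ (by omega)]
    have h : (2 * ((n + 1 : ℕ) : ℝ)) ^ 2 - 1 = (2 * n + 1) * (2 * n + 3) := by push_cast; ring
    have h' : (4 * ((n + 1 : ℕ) : ℝ) ^ 2 - 1) = (2 * n + 1) * (2 * n + 3) := by push_cast; ring
    rw [h, h']
    push_cast
    field_simp
    ring

lemma besselCov_eq_of_le {m n : ℕ} (hmn : m ≤ n) (h : n ≠ m + 1) :
    besselCov m n = 2 / Real.pi * Real.cos (Real.pi * (((m : ℝ) - n) / 2))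
      * (1 / (((m : ℝ) + n) ^ 2 - 1) - 1 / (((m : ℝ) - n) ^ 2 - 1)) := by
  obtain ⟨d, rfl⟩ := Nat.exists_eq_add_of_le hmn
  obtain ⟨d, rfl | rfl⟩ := d.even_or_odd'
  · rw [besselCov_even_of_diag besselCov_diag]
    have h1 : Real.cos (Real.pi * (((m : ℝ) - (m + 2 * d : ℕ)) / 2)) = (-1) ^ d := by
      rw [← Real.cos_nat_mul_pi d, ← Real.cos_neg]; congr 1; push_cast; ring
    rw [h1]
    push_cast
    rw [show (2 * ((m : ℝ) + d)) = m + (m + 2 * d) by ring,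
      show ((m : ℝ) - (m + 2 * d)) ^ 2 = (2 * d) ^ 2 by ring]
  -- Difference `1` is excluded by hypothesis; from difference `3` on, both the covariance and the
  -- cosine vanish.
  · obtain ⟨d, rfl⟩ : ∃ e, d = e + 1 := Nat.exists_eq_succ_of_ne_zero (by rintro rfl; simp at h)
    rw [show m + (2 * (d + 1) + 1) = m + 2 * d + 3 by ring, besselCov_odd]
    have h1 : Real.cos (Real.pi * (((m : ℝ) - (m + 2 * d + 3 : ℕ)) / 2)) = 0 := by
      rw [Real.cos_eq_zero_iff]
      exact ⟨-(d : ℤ) - 2, by push_cast; ring⟩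
    rw [h1]; ring

lemma besselCov_eq {m n : ℕ} (h1 : m ≠ n + 1) (h2 : n ≠ m + 1) :
    besselCov m n = 2 / Real.pi * Real.cos (Real.pi * (((m : ℝ) - n) / 2))
      * (1 / (((m : ℝ) + n) ^ 2 - 1) - 1 / (((m : ℝ) - n) ^ 2 - 1)) := by
  rcases le_total m n with h | h
  · exact besselCov_eq_of_le h h2
  · rw [besselCov_comm, besselCov_eq_of_le h h1, ← Real.cos_neg, add_comm (n : ℝ),
      show ((n : ℝ) - m) ^ 2 = (m - n) ^ 2 by ring]
    congr 3; ring

/-! ### Damped covariances and hypergeometric functions -/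

/-- The integral `∫_0^∞ m n J_m(2r) J_n(2r) / r² exp(-2wr) dr`. -/
noncomputable def besselDampedCov (m n : ℕ) (w : ℂ) : ℂ :=
  ∫ r in Ioi 0, Complex.exp (-(2 * w) * (r : ℝ)) * ((besselQuot m r * besselQuot n r : ℝ) : ℂ)

lemma abs_besselQuot_mul_le (m n : ℕ) {r : ℝ} (hr : 0 ≤ r) :
    |besselQuot m r * besselQuot n r| ≤ 4 := by
  rw [abs_mul]
  nlinarith [abs_besselQuot_le_two m hr, abs_besselQuot_le_two n hr, abs_nonneg (besselQuot m r),
    abs_nonneg (besselQuot n r)]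

lemma differentiableAt_besselDampedCov (m n : ℕ) {w : ℂ} (hw : 0 < w.re) :
    DifferentiableAt ℂ (besselDampedCov m n) w := by
  have hm := continuous_besselQuot m
  have hn := continuous_besselQuot n
  have hnorm : ∀ (w : ℂ) (r : ℝ), ‖Complex.exp (-(2 * w) * r)‖ = Real.exp (-(2 * w.re) * r) := by
    intro w r; rw [Complex.norm_exp]; simp
  have hcont : ∀ w : ℂ, Continuous fun r : ℝ =>
      Complex.exp (-(2 * w) * r) * ((besselQuot m r * besselQuot n r : ℝ) : ℂ) := fun w => by fun_prop
  have h := hasDerivAt_integral_of_dominated_loc_of_deriv_le (μ := volume.restrict (Ioi 0))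
    (F := fun (w : ℂ) (r : ℝ) =>
      Complex.exp (-(2 * w) * r) * ((besselQuot m r * besselQuot n r : ℝ) : ℂ))
    (F' := fun (w : ℂ) (r : ℝ) => Complex.exp (-(2 * w) * r) * (-2 * r)
      * ((besselQuot m r * besselQuot n r : ℝ) : ℂ))
    (x₀ := w) (s := {z : ℂ | w.re / 2 < z.re})
    (bound := fun r => 8 * ((1 + r) * Real.exp (-w.re * r)))
    ((isOpen_lt continuous_const Complex.continuous_re).mem_nhds (by simp; linarith))
    (Eventually.of_forall fun w => (hcont w).aestronglyMeasurable)
    ?_ (by fun_prop : Continuous fun r : ℝ => Complex.exp (-(2 * w) * r) * (-2 * r)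
      * ((besselQuot m r * besselQuot n r : ℝ) : ℂ)).aestronglyMeasurable
    ((ae_restrict_iff' measurableSet_Ioi).2 (Eventually.of_forall fun r hr z hz => ?_))
    ((integrableOn_one_add_mul_exp hw).const_mul 8)
    (Eventually.of_forall fun r z _ => ?_)
  · exact h.2.differentiableAt
  · refine ((integrableOn_one_add_mul_exp (by linarith : 0 < 2 * w.re)).const_mul 4).mono'
      (hcont w).aestronglyMeasurable
      ((ae_restrict_iff' measurableSet_Ioi).2 (Eventually.of_forall fun r hr => ?_))
    have hr : (0 : ℝ) < r := hr
    rw [norm_mul, hnorm, Complex.norm_real, Real.norm_eq_abs]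
    have h1 := abs_besselQuot_mul_le m n hr.le
    have h2 := Real.exp_pos (-(2 * w.re) * r)
    nlinarith
  · have hr : (0 : ℝ) < r := hr
    have hz : w.re / 2 < z.re := hz
    have h1 := abs_besselQuot_mul_le m n hr.le
    have h2 : Real.exp (-(2 * z.re) * r) ≤ Real.exp (-w.re * r) := Real.exp_le_exp.2 (by nlinarith)
    have h3 : ‖(-2 * r : ℂ)‖ = 2 * r := by
      rw [norm_mul, norm_neg, Complex.norm_real, Real.norm_eq_abs, abs_of_pos hr]; simp
    rw [norm_mul, norm_mul, hnorm, h3, Complex.norm_real, Real.norm_eq_abs]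
    calc _ ≤ Real.exp (-w.re * r) * (2 * r) * 4 := by gcongr
      _ ≤ _ := by nlinarith [Real.exp_pos (-w.re * r)]
  · have h1 : HasDerivAt (fun z : ℂ => Complex.exp (-(2 * z) * r))
        (Complex.exp (-(2 * z) * r) * (-(2 * 1) * r)) z :=
      (((hasDerivAt_id z).const_mul 2).neg.mul_const (r : ℂ)).cexp
    exact (h1.mul_const _).congr_deriv (by ring)

/-- Upper parameters of the `₄F₃` in the covariance formula. -/
noncomputable abbrev hyp43Upper (m n : ℕ) : Multiset ℂ :=
  {((m : ℂ) + n - 1) / 2, ((m : ℂ) + n) / 2, ((m : ℂ) + n + 1) / 2, ((m : ℂ) + n) / 2 + 1}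

/-- Lower parameters of the `₄F₃` in the covariance formula. -/
noncomputable abbrev hyp43Lower (m n : ℕ) : Multiset ℂ :=
  {(m : ℂ) + 1, (n : ℂ) + 1, (m : ℂ) + n + 1}

/-- Coefficients of the `₄F₃` series with parameters `m = p + 1`, `n = q + 1`. -/
noncomputable def hyp43Coeff (p q k : ℕ) : ℝ :=
  ((p + q + 2 * k)! * (p + q + 2 + 2 * k)! * (p + 1)! * (q + 1)!) /
    ((p + q)! * 16 ^ k * (p + 1 + k)! * (q + 1 + k)! * (p + q + 2 + k)! * k !)

lemma hyp43Coeff_succ (p q k : ℕ) : hyp43Coeff p q (k + 1) = hyp43Coeff p q k *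
    (((p + q + 1) / 2 + k) * ((p + q + 2) / 2 + k) * ((p + q + 3) / 2 + k) * ((p + q + 4) / 2 + k)
      / ((p + 2 + k) * (q + 2 + k) * (p + q + 3 + k) * (k + 1))) := by
  rw [hyp43Coeff, hyp43Coeff, show p + q + 2 * (k + 1) = p + q + 2 * k + 1 + 1 by ring,
    show p + q + 2 + 2 * (k + 1) = p + q + 2 + 2 * k + 1 + 1 by ring, ← add_assoc (p + 1),
    ← add_assoc (q + 1), ← add_assoc (p + q + 2), Nat.factorial_succ (p + q + 2 * k + 1),
    Nat.factorial_succ (p + q + 2 * k), Nat.factorial_succ (p + q + 2 + 2 * k + 1),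
    Nat.factorial_succ (p + q + 2 + 2 * k), Nat.factorial_succ (p + 1 + k),
    Nat.factorial_succ (q + 1 + k), Nat.factorial_succ (p + q + 2 + k), Nat.factorial_succ k]
  push_cast
  have h1 : (p + 1 + k + 1 : ℝ) ≠ 0 := by positivity
  have h2 : (q + 1 + k + 1 : ℝ) ≠ 0 := by positivity
  have h3 : (p + q + 2 + k + 1 : ℝ) ≠ 0 := by positivity
  rw [show (p + 2 + k : ℝ) = p + 1 + k + 1 by ring, show (q + 2 + k : ℝ) = q + 1 + k + 1 by ring,
    show (p + q + 3 + k : ℝ) = p + q + 2 + k + 1 by ring]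
  field_simp
  ring

/-- Both sides start at `1` and have the same ratio of consecutive terms, so no duplication formula
for Pochhammer symbols is needed. -/
lemma gamma_prod_mul_regularizedHGFunCoeff (p q k : ℕ) :
    ((hyp43Lower (p + 1) (q + 1)).map Complex.Gamma).prod *
      Complex.regularizedHGFunCoeff (hyp43Upper (p + 1) (q + 1)) (hyp43Lower (p + 1) (q + 1)) k
      = (hyp43Coeff p q k : ℂ) := by
  have hG : ∀ x : ℕ, Complex.Gamma ((x : ℂ) + 1) ≠ 0 := fun x => by
    rw [Complex.Gamma_nat_eq_factorial]; exact_mod_cast Nat.factorial_ne_zero x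
  induction k with
  | zero =>
    have h1 := hG (p + 1)
    have h2 := hG (q + 1)
    have h3 := hG (p + 1 + (q + 1))
    push_cast at h1 h2 h3
    have h4 : hyp43Coeff p q 0 = 1 := by
      rw [hyp43Coeff]; simp; field_simp
    rw [h4, Complex.regularizedHGFunCoeff]
    simp only [hyp43Lower, hyp43Upper, Multiset.insert_eq_cons, Multiset.map_cons,
      Multiset.map_singleton, Multiset.prod_cons, Multiset.prod_singleton]
    push_cast
    simp only [ascPochhammer_zero, Polynomial.eval_one, Nat.factorial_zero, add_zero,
      Nat.cast_one, one_mul]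
    exact mul_one_div_cancel (mul_ne_zero h1 (mul_ne_zero h2 h3))
  | succ k ih =>
    rw [Complex.regularizedHGFunCoeff_add_one, ← mul_assoc, ih, hyp43Coeff_succ]
    · simp only [hyp43Lower, hyp43Upper, Multiset.insert_eq_cons, Multiset.map_cons,
        Multiset.map_singleton, Multiset.prod_cons, Multiset.prod_singleton]
      push_cast
      congr 2 <;> ring
    · intro x hx hxk
      simp only [hyp43Lower, Multiset.insert_eq_cons, Multiset.mem_cons,
        Multiset.mem_singleton] at hx
      rcases hx with rfl | rfl | rfl
      all_goals
        have := congrArg Complex.re hxk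
        simp at this
        linarith [p.cast_nonneg (α := ℝ), q.cast_nonneg (α := ℝ), k.cast_nonneg (α := ℝ)]

/-- The sum of the `₄F₃` series on the unit disc. -/
noncomputable def hyp43Series (m n : ℕ) (z : ℂ) : ℂ :=
  ((hyp43Lower m n).map Complex.Gamma).prod *
    Complex.regularizedHGFun (hyp43Upper m n) (hyp43Lower m n) z

lemma one_le_radius_hyp43 (m n : ℕ) :
    1 ≤ (Complex.regularizedHGFunSeries (hyp43Upper m n) (hyp43Lower m n)).radius :=
  Complex.radius_regularizedHGFunSeries_ge_one (by simp)

lemma differentiableOn_hyp43Series (m n : ℕ) :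
    DifferentiableOn ℂ (hyp43Series m n) (Metric.ball 0 1) := by
  have h := (FormalMultilinearSeries.hasFPowerSeriesOnBall _
    (one_pos.trans_le (one_le_radius_hyp43 m n))).differentiableOn
  refine DifferentiableOn.const_mul (h.mono fun z hz => ?_) _
  rw [← Metric.eball_ofReal, ENNReal.ofReal_one] at hz
  exact Metric.eball_subset_eball (one_le_radius_hyp43 m n) hz

lemma hasSum_hyp43Series (p q : ℕ) {z : ℂ} (hz : ‖z‖ < 1) :
    HasSum (fun k => (hyp43Coeff p q k : ℂ) * z ^ k) (hyp43Series (p + 1) (q + 1) z) ∧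
      Summable fun k => ‖(hyp43Coeff p q k : ℂ) * z ^ k‖ := by
  have hmem : z ∈ Metric.eball (0 : ℂ)
      (Complex.regularizedHGFunSeries (hyp43Upper (p + 1) (q + 1))
        (hyp43Lower (p + 1) (q + 1))).radius := by
    refine Metric.eball_subset_eball (one_le_radius_hyp43 _ _) ?_
    rw [← ENNReal.ofReal_one, Metric.eball_ofReal]
    simpa using hz
  have hterm : ∀ k, (hyp43Coeff p q k : ℂ) * z ^ k
      = ((hyp43Lower (p + 1) (q + 1)).map Complex.Gamma).prod *
        (Complex.regularizedHGFunSeries (hyp43Upper (p + 1) (q + 1))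
          (hyp43Lower (p + 1) (q + 1)) k fun _ => z) := by
    intro k
    rw [← gamma_prod_mul_regularizedHGFunCoeff, Complex.regularizedHGFunSeries]
    simp
    ring
  have hs := FormalMultilinearSeries.summable_norm_apply _ hmem
  simp only [hterm]
  refine ⟨hs.of_norm.hasSum.mul_left _, ?_⟩
  simp only [norm_mul]
  exact hs.mul_left _

lemma integral_pow_mul_exp_neg {x : ℝ} (hx : 0 < x) (n : ℕ) :
    IntegrableOn (fun r : ℝ => r ^ n * Real.exp (-x * r)) (Ioi 0) ∧
      ∫ r in Ioi 0, r ^ n * Real.exp (-x * r) = n ! / x ^ (n + 1) := by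
  have h1 := Real.integral_rpow_mul_exp_neg_mul_Ioi (a := n + 1) (r := x) (by positivity) hx
  have h2 := integrableOn_rpow_mul_exp_neg_mul_rpow (s := n) (p := 1) (b := x)
    (by linarith [n.cast_nonneg (α := ℝ)]) one_pos hx
  simp only [add_sub_cancel_right, Real.rpow_natCast, Real.rpow_one] at h1 h2
  refine ⟨h2, ?_⟩
  simp only [neg_mul]
  rw [h1, Real.Gamma_nat_eq_factorial, show ((n : ℝ) + 1) = (n + 1 : ℕ) by push_cast; ring,
    Real.rpow_natCast, one_div, inv_pow, div_eq_inv_mul]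

/-- The left side is the integral of the `k`-th term of the product series against `exp(-2tr)`; the
right side is a `₄F₃` term at `-4/t²`. -/
lemma besselMulCoeff_mul_eq (p q k : ℕ) {t : ℝ} (ht : 0 < t) :
    (p + 1) * (q + 1) * besselMulCoeff (p + 1) (q + 1) k
        * ((p + q + 2 * k)! / (2 * t) ^ (p + q + 2 * k + 1))
      = (p + q)! / (p ! * q ! * (2 * t) ^ (p + q + 1))
        * (hyp43Coeff p q k * (-4 / t ^ 2) ^ k) := by
  rw [besselMulCoeff, hyp43Coeff, show p + 1 + (q + 1) + 2 * k = p + q + 2 + 2 * k by ring,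
    show p + 1 + (q + 1) + k = p + q + 2 + k by ring, Nat.factorial_succ p, Nat.factorial_succ q,
    div_pow, show ((-4 : ℝ)) ^ k = (-1) ^ k * 4 ^ k by rw [← mul_pow]; norm_num,
    show (16 : ℝ) ^ k = 4 ^ k * 4 ^ k by rw [← mul_pow]; norm_num,
    show p + q + 2 * k + 1 = p + q + 1 + 2 * k by ring, pow_add (2 * t), pow_mul (2 * t),
    mul_pow 2 t 2, mul_pow _ _ k]
  norm_num
  field_simp

/-- For `t > 2` the point `-4/t²` lies in the unit disc. Absolute convergence of the `₄F₃` series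
there is precisely the summability that permits exchanging sum and integral. -/
lemma besselDampedCov_ofReal (p q : ℕ) {t : ℝ} (ht : 2 < t) :
    besselDampedCov (p + 1) (q + 1) t
      = (p + q)! / (p ! * q ! * (2 * t) ^ (p + q + 1)) * hyp43Series (p + 1) (q + 1) (-4 / t ^ 2) := by
  have ht0 : 0 < t := by linarith
  have hz : ‖(-4 / t ^ 2 : ℂ)‖ < 1 := by
    rw [norm_div, norm_neg, norm_pow, Complex.norm_real, Real.norm_eq_abs, abs_of_pos ht0,
      div_lt_one (by positivity)]
    norm_num; nlinarith
  obtain ⟨hsum, hnorm⟩ := hasSum_hyp43Series p q hz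
  set c : ℝ := (p + q)! / (p ! * q ! * (2 * t) ^ (p + q + 1)) with hc
  have hc0 : 0 < c := by positivity
  set F : ℕ → ℝ → ℝ := fun k r => (p + 1) * (q + 1) * besselMulCoeff (p + 1) (q + 1) k *
    (r ^ (p + q + 2 * k) * Real.exp (-(2 * t) * r)) with hF
  have hi := fun k => integral_pow_mul_exp_neg (by positivity : 0 < 2 * t) (p + q + 2 * k)
  have hFint : ∀ k, ∫ r in Ioi 0, F k r = c * (hyp43Coeff p q k * (-4 / t ^ 2) ^ k) := by
    intro k
    rw [integral_const_mul, (hi k).2, besselMulCoeff_mul_eq p q k ht0]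
  have hFnorm : ∀ k, ∫ r in Ioi 0, ‖F k r‖ = c * |hyp43Coeff p q k * (-4 / t ^ 2) ^ k| := by
    intro k
    have e : ∀ r ∈ Ioi (0 : ℝ), ‖F k r‖ = |(p + 1) * (q + 1) * besselMulCoeff (p + 1) (q + 1) k|
        * (r ^ (p + q + 2 * k) * Real.exp (-(2 * t) * r)) := fun r hr => by
      rw [norm_mul, Real.norm_eq_abs, Real.norm_eq_abs, abs_of_nonneg (a := r ^ _ * _)]
      have : (0 : ℝ) < r := hr
      positivity
    have h0 : 0 ≤ ((p + q + 2 * k)! / (2 * t) ^ (p + q + 2 * k + 1) : ℝ) := by positivity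
    rw [setIntegral_congr_fun measurableSet_Ioi e, integral_const_mul, (hi k).2,
      ← abs_of_nonneg h0, ← abs_mul, besselMulCoeff_mul_eq p q k ht0, abs_mul, abs_of_pos hc0]
  have hcast : ∀ k, (hyp43Coeff p q k : ℂ) * (-4 / t ^ 2) ^ k
      = ((hyp43Coeff p q k * (-4 / t ^ 2) ^ k : ℝ) : ℂ) := fun k => by push_cast; ring
  simp only [hcast, Complex.norm_real, Real.norm_eq_abs] at hsum hnorm
  have hmain := hasSum_integral_of_summable_integral_norm (μ := volume.restrict (Ioi 0)) (F := F)
    (fun k => (hi k).1.const_mul _) (by simp only [hFnorm]; exact hnorm.mul_left c)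
  have hpt : ∀ r ∈ Ioi (0 : ℝ), ∑' k, F k r
      = Real.exp (-(2 * t) * r) * (besselQuot (p + 1) r * besselQuot (q + 1) r) := by
    intro r hr
    have hr : (0 : ℝ) < r := hr
    have h1 := (hasSum_besselTwo_mul (p + 1) (q + 1) r).mul_left
      ((p + 1) * (q + 1) * Real.exp (-(2 * t) * r) / r ^ 2)
    have h2 := mul_besselQuot (p + 1) r
    have h3 := mul_besselQuot (q + 1) r
    push_cast at h2 h3
    rw [show (p + 1) * (q + 1) * Real.exp (-(2 * t) * r) / r ^ 2
        * (besselTwo (p + 1) r * besselTwo (q + 1) r)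
        = Real.exp (-(2 * t) * r) * (((p + 1) * besselTwo (p + 1) r) * ((q + 1) * besselTwo (q + 1) r))
          / r ^ 2 by ring, ← h2, ← h3] at h1
    rw [show Real.exp (-(2 * t) * r) * (besselQuot (p + 1) r * besselQuot (q + 1) r)
      = Real.exp (-(2 * t) * r) * (r * besselQuot (p + 1) r * (r * besselQuot (q + 1) r)) / r ^ 2 by
        field_simp, ← h1.tsum_eq]
    refine tsum_congr fun k => ?_
    rw [show p + 1 + (q + 1) + 2 * k = p + q + 2 * k + 2 by ring, pow_add r _ 2]
    simp only [hF]
    field_simp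
    ring
  rw [setIntegral_congr_fun measurableSet_Ioi hpt] at hmain
  simp only [hFint] at hmain
  have h4 := Complex.hasSum_ofReal.2 hmain
  have h5 := hsum.mul_left (c : ℂ)
  have h6 : ((∫ r in Ioi 0, Real.exp (-(2 * t) * r) * (besselQuot (p + 1) r * besselQuot (q + 1) r)
      : ℝ) : ℂ) = c * hyp43Series (p + 1) (q + 1) (-4 / t ^ 2) :=
    h4.unique (h5.congr_fun fun k => by push_cast; ring)
  have h7 : besselDampedCov (p + 1) (q + 1) t = ((∫ r in Ioi 0, Real.exp (-(2 * t) * r)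
      * (besselQuot (p + 1) r * besselQuot (q + 1) r) : ℝ) : ℂ) := by
    rw [besselDampedCov, ← integral_complex_ofReal]
    refine integral_congr_ae (Eventually.of_forall fun r => ?_)
    push_cast; rfl
  rw [h7, h6, hc]
  push_cast; rfl

/-- The square-root coordinate `w = 2 / √(-z)`, in which `z = -4 / w²`. -/
noncomputable def sqrtCoord (z : ℂ) : ℂ := 2 * Complex.exp (-Complex.log (-z) / 2)

/-- Halving the argument of `-z` keeps it inside `(-π/2, π/2)`, so the coordinate lands in the
half-plane where the Laplace integral is holomorphic. -/
lemma sqrtCoord_re_pos {z : ℂ} (hz : -z ∈ Complex.slitPlane) : 0 < (sqrtCoord z).re := by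
  have h1 : (sqrtCoord z).re = 2 * (Real.exp (-Complex.log (-z) / 2).re
      * Real.cos (-Complex.log (-z) / 2).im) := by
    rw [sqrtCoord, ← Complex.exp_re]; simp
  have h2 : (-Complex.log (-z) / 2).im = -(Complex.arg (-z) / 2) := by
    rw [Complex.div_ofNat_im, Complex.neg_im, Complex.log_im]; ring
  rw [h1, h2, Real.cos_neg]
  have h3 := Complex.neg_pi_lt_arg (-z)
  have h4 := Complex.arg_le_pi (-z)
  have h5 := (Complex.mem_slitPlane_iff_arg.1 hz).1
  have h6 : 0 < Real.cos (Complex.arg (-z) / 2) :=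
    Real.cos_pos_of_mem_Ioo ⟨by linarith, by linarith [lt_of_le_of_ne h4 h5]⟩
  positivity

lemma sqrtCoord_neg_four_div_sq {t : ℝ} (ht : 0 < t) : sqrtCoord (-4 / (t : ℂ) ^ 2) = t := by
  have h1 : -(-4 / (t : ℂ) ^ 2) = ((4 / t ^ 2 : ℝ) : ℂ) := by push_cast; ring
  have h2 : Real.log (4 / t ^ 2) = 2 * Real.log (2 / t) := by
    rw [show (4 : ℝ) / t ^ 2 = (2 / t) ^ 2 by rw [div_pow]; norm_num, Real.log_pow]; norm_num
  rw [sqrtCoord, h1, ← Complex.ofReal_log (by positivity), h2]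
  have h3 : -((2 * Real.log (2 / t) : ℝ) : ℂ) / 2 = ((-Real.log (2 / t) : ℝ) : ℂ) := by
    push_cast; ring
  rw [h3, ← Complex.ofReal_exp, Real.exp_neg, Real.exp_log (by positivity)]
  push_cast
  have : (t : ℂ) ≠ 0 := by exact_mod_cast ht.ne'
  field_simp

lemma isOpen_neg_slitPlane : IsOpen {z : ℂ | -z ∈ Complex.slitPlane} :=
  Complex.isOpen_slitPlane.preimage continuous_neg

/-- The Laplace-transform representation of the `₄F₃` with parameters `m = p + 1`, `n = q + 1`. -/
noncomputable def hyp43Laplace (p q : ℕ) (z : ℂ) : ℂ :=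
  p ! * q ! * (2 * sqrtCoord z) ^ (p + q + 1) / (p + q)! * besselDampedCov (p + 1) (q + 1) (sqrtCoord z)

lemma differentiableAt_hyp43Laplace (p q : ℕ) {z : ℂ} (hz : -z ∈ Complex.slitPlane) :
    DifferentiableAt ℂ (hyp43Laplace p q) z := by
  have h1 : DifferentiableAt ℂ sqrtCoord z := by
    have : DifferentiableAt ℂ (fun z : ℂ => Complex.log (-z)) z :=
      (differentiableAt_id.neg).clog hz
    unfold sqrtCoord
    fun_prop
  have h2 : DifferentiableAt ℂ (fun z => besselDampedCov (p + 1) (q + 1) (sqrtCoord z)) z :=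
    (differentiableAt_besselDampedCov _ _ (sqrtCoord_re_pos hz)).comp z h1
  unfold hyp43Laplace
  fun_prop

lemma hyp43Laplace_eq_series_of_neg (p q : ℕ) {x : ℝ} (h1 : -1 < x) (h0 : x < 0) :
    hyp43Laplace p q x = hyp43Series (p + 1) (q + 1) x := by
  set t : ℝ := 2 / √(-x) with ht
  have hs : 0 < √(-x) := Real.sqrt_pos.2 (by linarith)
  have hs1 : √(-x) < 1 := by rw [Real.sqrt_lt' one_pos]; linarith
  have ht2 : 2 < t := by rw [ht, lt_div_iff₀ hs]; linarith
  have ht0 : (t : ℂ) ≠ 0 := by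
    exact_mod_cast (by linarith : (0 : ℝ) < t).ne'
  have hx : (x : ℂ) = -4 / (t : ℂ) ^ 2 := by
    have : x = -4 / t ^ 2 := by
      rw [ht, div_pow, Real.sq_sqrt (by linarith)]; norm_num; field_simp
    rw [this]; push_cast; ring
  rw [hx, hyp43Laplace, sqrtCoord_neg_four_div_sq (by linarith), besselDampedCov_ofReal p q ht2]
  have := Nat.factorial_ne_zero p
  have := Nat.factorial_ne_zero q
  have := Nat.factorial_ne_zero (p + q)
  field_simp

/-- Identity theorem: the two functions agree on the real segment `(-1, 0)`, and the slit disc is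
star-shaped about `-1/2`, hence connected. -/
lemma hyp43Laplace_eqOn_series (p q : ℕ) :
    EqOn (hyp43Laplace p q) (hyp43Series (p + 1) (q + 1))
      (Metric.ball 0 1 ∩ {z : ℂ | -z ∈ Complex.slitPlane}) := by
  have hopen : IsOpen (Metric.ball (0 : ℂ) 1 ∩ {z : ℂ | -z ∈ Complex.slitPlane}) :=
    Metric.isOpen_ball.inter isOpen_neg_slitPlane
  have hmem : ((-1 / 2 : ℝ) : ℂ) ∈ Metric.ball (0 : ℂ) 1 ∩ {z : ℂ | -z ∈ Complex.slitPlane} := by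
    refine ⟨by simp; norm_num, ?_⟩
    show -((-1 / 2 : ℝ) : ℂ) ∈ Complex.slitPlane
    rw [← Complex.ofReal_neg, Complex.ofReal_mem_slitPlane]; norm_num
  have hstar : StarConvex ℝ ((-1 / 2 : ℝ) : ℂ)
      (Metric.ball (0 : ℂ) 1 ∩ {z : ℂ | -z ∈ Complex.slitPlane}) := by
    refine ((convex_ball (0 : ℂ) 1).starConvex hmem.1).inter ?_
    have h := (Complex.starConvex_ofReal_slitPlane (x := 1 / 2) (by norm_num)).neg
    have e : ((-1 / 2 : ℝ) : ℂ) = -((1 / 2 : ℝ) : ℂ) := by push_cast; ring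
    rw [e]; exact h
  have hf : AnalyticOnNhd ℂ (hyp43Laplace p q) _ := DifferentiableOn.analyticOnNhd
    (fun z hz => (differentiableAt_hyp43Laplace p q hz.2).differentiableWithinAt) hopen
  have hg := ((differentiableOn_hyp43Series (p + 1) (q + 1)).mono
    (inter_subset_left (t := {z : ℂ | -z ∈ Complex.slitPlane}))).analyticOnNhd hopen
  refine hf.eqOn_of_preconnected_of_frequently_eq hg
    (hstar.isPathConnected hmem).isConnected.isPreconnected hmem ?_
  have hreal : ∃ᶠ x : ℝ in 𝓝[≠] (-1 / 2), hyp43Laplace p q x = hyp43Series (p + 1) (q + 1) x := by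
    refine Eventually.frequently (nhdsWithin_le_nhds ?_)
    filter_upwards [Ioo_mem_nhds (by norm_num : (-1 : ℝ) < -1 / 2) (by norm_num : (-1 / 2 : ℝ) < 0)]
      with x hx using hyp43Laplace_eq_series_of_neg p q hx.1 hx.2
  refine Tendsto.frequently (f := fun x : ℝ => (x : ℂ)) ?_ hreal
  exact tendsto_nhdsWithin_of_tendsto_nhds_of_eventually_within _
    (Complex.continuous_ofReal.continuousAt.tendsto.mono_left nhdsWithin_le_nhds)
    (eventually_nhdsWithin_of_forall fun x hx h => hx (Complex.ofReal_injective h))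

open Classical in
/-- The principal branch of the `₄F₃` with parameters `m = p + 1`, `n = q + 1`. -/
noncomputable def hyp43Branch (p q : ℕ) (z : ℂ) : ℂ :=
  if -z ∈ Complex.slitPlane then hyp43Laplace p q z else hyp43Series (p + 1) (q + 1) z

lemma hyp43Branch_eq_series (p q : ℕ) {z : ℂ} (hz : ‖z‖ < 1) :
    hyp43Branch p q z = hyp43Series (p + 1) (q + 1) z := by
  rw [hyp43Branch]
  split_ifs with h
  · exact hyp43Laplace_eqOn_series p q ⟨by simpa using hz, h⟩
  · rfl

/-- A point of `ℂ \ [1,∞)` at which the Laplace formula is unavailable lies in `[0,1)`, hence in the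
disc, and there the series describes the function on a whole neighbourhood. -/
lemma isHypergeometricBranch_hyp43Branch (p q : ℕ) :
    IsHypergeometricBranch (hyp43Upper (p + 1) (q + 1)) (hyp43Lower (p + 1) (q + 1))
      (hyp43Branch p q) := by
  refine ⟨fun z hz => ?_, fun z hz => hyp43Branch_eq_series p q hz⟩
  refine DifferentiableAt.differentiableWithinAt ?_
  by_cases h : -z ∈ Complex.slitPlane
  · refine (differentiableAt_hyp43Laplace p q h).congr_of_eventuallyEq ?_
    filter_upwards [isOpen_neg_slitPlane.mem_nhds h] with y hy
    exact if_pos hy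
  · have hz1 : ‖z‖ < 1 := by
      rw [mem_ofPred_eq, Complex.mem_slitPlane_iff] at hz
      rw [Complex.mem_slitPlane_iff] at h
      push Not at h
      simp at hz h
      have him : z.im = 0 := h.2
      have hre : z.re < 1 := by simpa [him] using hz
      have e : z = (z.re : ℂ) := Complex.ext rfl (by simp [him])
      rw [e, Complex.norm_real, Real.norm_eq_abs, abs_of_nonneg h.1]
      exact hre
    have hball : Metric.ball (0 : ℂ) 1 ∈ 𝓝 z := Metric.isOpen_ball.mem_nhds (by simpa using hz1)
    refine ((differentiableOn_hyp43Series (p + 1) (q + 1)).differentiableAt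
      hball).congr_of_eventuallyEq ?_
    filter_upwards [hball] with y hy
    exact hyp43Branch_eq_series p q (by simpa using hy)

lemma isHypergeometricBranch_hyp43 (m n : ℕ) (hm : 1 ≤ m) (hn : 1 ≤ n) :
    IsHypergeometricBranch (hyp43Upper m n) (hyp43Lower m n) (hyp43 m n) := by
  obtain ⟨p, rfl⟩ := Nat.exists_eq_add_of_le' hm
  obtain ⟨q, rfl⟩ := Nat.exists_eq_add_of_le' hn
  exact Classical.epsilon_spec (p := IsHypergeometricBranch (hyp43Upper (p + 1) (q + 1))
    (hyp43Lower (p + 1) (q + 1))) ⟨_, isHypergeometricBranch_hyp43Branch p q⟩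

/-- Uniqueness of the continuation on a domain star-shaped about `0`. It transfers the Laplace
formula to the branch picked by `Classical.epsilon`. -/
lemma IsHypergeometricBranch.eqOn {a b : Multiset ℂ} {F G : ℂ → ℂ}
    (hF : IsHypergeometricBranch a b F) (hG : IsHypergeometricBranch a b G) :
    EqOn F G {z : ℂ | 1 - z ∈ Complex.slitPlane} := by
  have hopen : IsOpen {z : ℂ | 1 - z ∈ Complex.slitPlane} :=
    Complex.isOpen_slitPlane.preimage (by fun_prop)
  have hmem : (0 : ℂ) ∈ {z : ℂ | 1 - z ∈ Complex.slitPlane} := by simp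
  have hstar : StarConvex ℝ (0 : ℂ) {z : ℂ | 1 - z ∈ Complex.slitPlane} := by
    intro y hy s t hs ht hst
    have h := Complex.starConvex_one_slitPlane hy hs ht hst
    show 1 - (s • (0 : ℂ) + t • y) ∈ Complex.slitPlane
    convert h using 1
    have hst' : (s : ℂ) + t = 1 := by exact_mod_cast hst
    simp only [Complex.real_smul]
    linear_combination -hst'
  refine (hF.1.analyticOnNhd hopen).eqOn_of_preconnected_of_eventuallyEq (hG.1.analyticOnNhd hopen)
    (hstar.isPathConnected hmem).isConnected.isPreconnected hmem ?_
  filter_upwards [Metric.ball_mem_nhds (0 : ℂ) one_pos] with z hz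
  have hz : ‖z‖ < 1 := by simpa using hz
  rw [hF.2 z hz, hG.2 z hz]

lemma hyp43_neg_four_div_sq (p q : ℕ) {ν : ℝ} (hν : 0 < ν) :
    hyp43 (p + 1) (q + 1) (-4 / (ν : ℂ) ^ 2)
      = p ! * q ! * (2 * ν) ^ (p + q + 1) / (p + q)! * besselDampedCov (p + 1) (q + 1) ν := by
  have hz : -(-4 / (ν : ℂ) ^ 2) ∈ Complex.slitPlane := by
    rw [show -(-4 / (ν : ℂ) ^ 2) = ((4 / ν ^ 2 : ℝ) : ℂ) by push_cast; ring,
      Complex.ofReal_mem_slitPlane]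
    positivity
  have hz1 : 1 - (-4 / (ν : ℂ) ^ 2) ∈ Complex.slitPlane := by
    rw [show 1 - (-4 / (ν : ℂ) ^ 2) = ((1 + 4 / ν ^ 2 : ℝ) : ℂ) by push_cast; ring,
      Complex.ofReal_mem_slitPlane]
    positivity
  rw [(isHypergeometricBranch_hyp43 (p + 1) (q + 1) (by omega) (by omega)).eqOn
    (isHypergeometricBranch_hyp43Branch p q) hz1, hyp43Branch, if_pos hz, hyp43Laplace,
    sqrtCoord_neg_four_div_sq hν]

/-! ### Reduction of `₄F₃` to `₃F₂` on the diagonal -/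

/-- A parameter common to both lists cancels term by term: its Pochhammer symbol above against `Γ(c
+ k)/Γ(c)` below. -/
lemma gamma_prod_mul_regularizedHGFun_cons (a b : Multiset ℂ) {c : ℂ} (hc : ∀ k : ℕ, c ≠ -k)
    (z : ℂ) : ((c ::ₘ b).map Complex.Gamma).prod * Complex.regularizedHGFun (c ::ₘ a) (c ::ₘ b) z
      = (b.map Complex.Gamma).prod * Complex.regularizedHGFun a b z := by
  have hterm : ∀ k, Complex.Gamma c * Complex.regularizedHGFunCoeff (c ::ₘ a) (c ::ₘ b) k
      = Complex.regularizedHGFunCoeff a b k := by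
    intro k
    have hG : Complex.Gamma c ≠ 0 := Complex.Gamma_ne_zero hc
    have hGk : Complex.Gamma (c + k) ≠ 0 := Complex.Gamma_ne_zero fun j h => hc (j + k) (by
      push_cast; linear_combination h)
    have h := Complex.Gamma_add_nat_div_Gamma_eq (n := k) c hc
    rw [div_eq_iff hG] at h
    simp only [Complex.regularizedHGFunCoeff, Multiset.map_cons, Multiset.prod_cons]
    rw [h] at hGk ⊢
    have hP := left_ne_zero_of_mul hGk
    rw [show ∀ x y u v w : ℂ, x * (y * u / (v * (y * x * w))) = (x * y) * u / ((x * y) * (v * w)) from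
      fun x y u v w => by ring, mul_div_mul_left _ _ (mul_ne_zero hG hP)]
  have hsum : ∀ a b : Multiset ℂ, Complex.regularizedHGFun a b z
      = ∑' k, Complex.regularizedHGFunCoeff a b k * z ^ k := fun a b => by
    simp [Complex.regularizedHGFun, FormalMultilinearSeries.sum, Complex.regularizedHGFunSeries,
      mul_comm]
  rw [hsum, hsum, Multiset.map_cons, Multiset.prod_cons, mul_assoc, mul_left_comm, ← tsum_mul_left]
  simp only [← mul_assoc, hterm]

lemma hypergeometricPFQ_cons (a b : Multiset ℂ) {c : ℂ} (hc : ∀ k : ℕ, c ≠ -k) :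
    IsHypergeometricBranch (c ::ₘ a) (c ::ₘ b) = IsHypergeometricBranch a b := by
  ext F
  simp only [IsHypergeometricBranch, gamma_prod_mul_regularizedHGFun_cons a b hc]

lemma isHypergeometricBranch_hyp43_self (n : ℕ) :
    IsHypergeometricBranch (hyp43Upper n n) (hyp43Lower n n) = IsHypergeometricBranch
      {(n : ℂ) - 1 / 2, (n : ℂ), (n : ℂ) + 1 / 2} {(n : ℂ) + 1, 2 * (n : ℂ) + 1} := by
  have hu : hyp43Upper n n = ((n : ℂ) + 1) ::ₘ {(n : ℂ) - 1 / 2, (n : ℂ), (n : ℂ) + 1 / 2} := by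
    rw [hyp43Upper, show ((n : ℂ) + n - 1) / 2 = n - 1 / 2 by ring,
      show ((n : ℂ) + n) / 2 = n by ring, show ((n : ℂ) + n + 1) / 2 = n + 1 / 2 by ring]
    simp only [Multiset.insert_eq_cons, ← Multiset.singleton_add]
    abel
  have hl : hyp43Lower n n = ((n : ℂ) + 1) ::ₘ {(n : ℂ) + 1, 2 * (n : ℂ) + 1} := by
    rw [hyp43Lower, two_mul]; rfl
  rw [hu, hl, hypergeometricPFQ_cons]
  intro k h
  have := congrArg Complex.re h
  simp at this
  linarith [n.cast_nonneg (α := ℝ), k.cast_nonneg (α := ℝ)]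

/-- The defining predicates of the two branches are equal, so the choice operator returns the same
function, even off the domain. -/
lemma hyp32_eq_hyp43 (n : ℕ) : hyp32 n = hyp43 n n := by
  rw [hyp32, hyp43, hypergeometricPFQ, hypergeometricPFQ, ← isHypergeometricBranch_hyp43_self]

lemma isHypergeometricBranch_hyp32 (n : ℕ) (hn : 1 ≤ n) : IsHypergeometricBranch
    {(n : ℂ) - 1 / 2, (n : ℂ), (n : ℂ) + 1 / 2} {(n : ℂ) + 1, 2 * (n : ℂ) + 1} (hyp32 n) := by
  rw [hyp32_eq_hyp43, ← isHypergeometricBranch_hyp43_self]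
  exact isHypergeometricBranch_hyp43 n n hn hn

/-! ### The covariance integrals as hypergeometric functions -/

lemma integral_besselKernel_mul_eq_damped (ν : ℝ) (m n : ℕ) :
    ((∫ r in Ioi 0, besselKernel ν m r * besselKernel ν n r : ℝ) : ℂ) = besselDampedCov m n ν := by
  rw [besselDampedCov, ← integral_complex_ofReal]
  refine integral_congr_ae (Eventually.of_forall fun r => ?_)
  simp only [besselKernel_eq]
  push_cast
  rw [show -(2 * (ν : ℂ)) * r = -ν * r + -ν * r by ring, Complex.exp_add]
  ring

lemma integral_besselKernel_mul_eq_hyp43 {ν : ℝ} (hν : 0 < ν) {m n : ℕ} (hm : 1 ≤ m) (hn : 1 ≤ n) :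
    ((∫ r in Ioi 0, besselKernel ν m r * besselKernel ν n r : ℝ) : ℂ)
      = (((2 * ν) ^ (1 - (m : ℤ) - (n : ℤ))
          * (((m + n - 2)! : ℝ) / (((m - 1)! : ℝ) * ((n - 1)! : ℝ))) : ℝ) : ℂ)
        * hyp43 m n (-4 / (ν : ℂ) ^ 2) := by
  obtain ⟨p, rfl⟩ := Nat.exists_eq_add_of_le' hm
  obtain ⟨q, rfl⟩ := Nat.exists_eq_add_of_le' hn
  rw [integral_besselKernel_mul_eq_damped, hyp43_neg_four_div_sq p q hν,
    show p + 1 + (q + 1) - 2 = p + q by omega, Nat.add_sub_cancel, Nat.add_sub_cancel,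
    show (1 - ((p + 1 : ℕ) : ℤ) - ((q + 1 : ℕ) : ℤ)) = -((p + q + 1 : ℕ) : ℤ) by push_cast; ring,
    zpow_neg, zpow_natCast]
  push_cast
  have h1 := Nat.factorial_ne_zero p
  have h2 := Nat.factorial_ne_zero q
  have h3 := Nat.factorial_ne_zero (p + q)
  have h4 : (ν : ℂ) ≠ 0 := by exact_mod_cast hν.ne'
  field_simp

lemma gamma_ratio_eq (p : ℕ) {ν : ℝ} (hν : 0 < ν) :
    (2 * ν) ^ (1 - ((p + 1 : ℕ) : ℤ) - ((p + 1 : ℕ) : ℤ)) * (((p + p)! : ℝ) / ((p ! : ℝ) * (p ! : ℝ)))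
      = 1 / (2 * √Real.pi) * (Real.Gamma ((p + 1 : ℕ) - 1 / 2) / Real.Gamma (p + 1 : ℕ))
        * ν ^ (1 - 2 * ((p + 1 : ℕ) : ℤ)) := by
  have h1 : Real.Gamma ((p + 1 : ℕ) - 1 / 2) = (p + p)! * √Real.pi / (4 ^ p * p !) := by
    have h := Real.Gamma_nat_add_half p
    have e : ((p + 1 : ℕ) - 1 / 2 : ℝ) = p + 1 / 2 := by push_cast; ring
    rw [e, h]
    rcases p with _ | p
    · simp
    · have h2 := Nat.factorial_eq_mul_doubleFactorial (2 * p + 1)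
      have h3 := Nat.doubleFactorial_two_mul (p + 1)
      rw [show 2 * p + 1 + 1 = 2 * (p + 1) by ring, h3] at h2
      rw [show p + 1 + (p + 1) = 2 * (p + 1) by ring, h2,
        show 2 * (p + 1) - 1 = 2 * p + 1 by omega, show (4 : ℝ) = 2 * 2 by norm_num, mul_pow]
      push_cast
      have := Nat.factorial_ne_zero (p + 1)
      field_simp
  rw [h1, Nat.cast_succ p, Nat.cast_succ p, Real.Gamma_nat_eq_factorial,
    show (1 - (((p : ℕ) : ℤ) + 1) - (((p : ℕ) : ℤ) + 1)) = -((2 * p + 1 : ℕ) : ℤ) by push_cast; ring,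
    show (1 - 2 * (((p : ℕ) : ℤ) + 1)) = -((2 * p + 1 : ℕ) : ℤ) by push_cast; ring, zpow_neg, zpow_neg,
    zpow_natCast, zpow_natCast, mul_pow, pow_succ 2, pow_mul 2 2 p]
  have h5 : √Real.pi ≠ 0 := (Real.sqrt_pos.2 Real.pi_pos).ne'
  norm_num
  field_simp

lemma integral_besselKernel_sq_eq_hyp32 {ν : ℝ} (hν : 0 < ν) {n : ℕ} (hn : 1 ≤ n) :
    ((∫ r in Ioi 0, besselKernel ν n r * besselKernel ν n r : ℝ) : ℂ)
      = ((1 / (2 * √Real.pi) * (Real.Gamma (n - 1 / 2) / Real.Gamma n)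
          * ν ^ (1 - 2 * (n : ℤ)) : ℝ) : ℂ) * hyp32 n (-4 / (ν : ℂ) ^ 2) := by
  obtain ⟨p, rfl⟩ := Nat.exists_eq_add_of_le' hn
  rw [integral_besselKernel_mul_eq_hyp43 hν hn hn, hyp32_eq_hyp43, ← gamma_ratio_eq p hν,
    show p + 1 + (p + 1) - 2 = p + p by omega, Nat.add_sub_cancel]

/-! ### Integrability of the damped kernels and the limit of vanishing damping -/

lemma integrableOn_besselKernel_mul {ν : ℝ} (hν : 0 ≤ ν) (m n : ℕ) :
    IntegrableOn (fun r => besselKernel ν m r * besselKernel ν n r) (Ioi 0) := by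
  refine (integrableOn_besselQuot_mul m n).norm.mono'
    ((continuous_besselKernel ν m).mul (continuous_besselKernel ν n)).aestronglyMeasurable
    ((ae_restrict_iff' measurableSet_Ioi).2 (Eventually.of_forall fun r hr => ?_))
  have h1 : Real.exp (-ν * r) ≤ 1 := Real.exp_le_one_iff.2 (by
    have := mul_nonneg hν (le_of_lt hr); linarith)
  have h0 := Real.exp_pos (-ν * r)
  rw [besselKernel_eq, besselKernel_eq, mul_mul_mul_comm, norm_mul]
  refine mul_le_of_le_one_right (norm_nonneg _) ?_
  rw [Real.norm_eq_abs, abs_of_pos (by positivity)]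
  nlinarith

lemma integral_besselKernel_zero (m n : ℕ) :
    ∫ r in Ioi 0, besselKernel 0 m r * besselKernel 0 n r = besselCov m n := by
  simp [besselCov, besselKernel_eq]

/-- The difference quotient of `exp(-2νr)` at `ν = 0` is bounded by `2r`, and `r q_n²` is
integrable, so dominated convergence gives the slope `-2 ∫ r q_n² = -n`. -/
lemma isLittleO_integral_besselKernel_sq (n : ℕ) (hn : 1 ≤ n) :
    (fun ν : ℝ => (∫ r in Ioi 0, besselKernel ν n r * besselKernel ν n r)
      - (8 * (n : ℝ) ^ 2 / (Real.pi * (4 * (n : ℝ) ^ 2 - 1)) - n * ν)) =o[𝓝[>] 0] fun ν : ℝ => ν := by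
  have hc := continuous_besselQuot n
  obtain ⟨hint, hval⟩ := integral_mul_besselQuot_sq n hn
  have hlim : Tendsto (fun ν : ℝ => ∫ r in Ioi 0,
      besselQuot n r ^ 2 * ((Real.exp (-(2 * ν) * r) - 1) / ν)) (𝓝[>] 0)
      (𝓝 (∫ r in Ioi 0, besselQuot n r ^ 2 * (-(2 * r)))) := by
    refine tendsto_integral_filter_of_dominated_convergence
      (fun r => 2 * (r * besselQuot n r ^ 2)) ?_ ?_ (hint.const_mul 2) ?_
    · exact Eventually.of_forall fun ν => (by fun_prop : Continuous fun r =>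
        besselQuot n r ^ 2 * ((Real.exp (-(2 * ν) * r) - 1) / ν)).aestronglyMeasurable
    · filter_upwards [self_mem_nhdsWithin] with ν hν
      have hν : (0 : ℝ) < ν := hν
      refine (ae_restrict_iff' measurableSet_Ioi).2 (Eventually.of_forall fun r hr => ?_)
      have hr : (0 : ℝ) < r := hr
      have h1 := Real.add_one_le_exp (-(2 * ν) * r)
      have h2 : Real.exp (-(2 * ν) * r) ≤ 1 := Real.exp_le_one_iff.2 (by
        have := mul_pos hν hr; linarith)
      have h3 : ‖(Real.exp (-(2 * ν) * r) - 1) / ν‖ ≤ 2 * r := by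
        rw [norm_div, Real.norm_eq_abs, Real.norm_eq_abs, abs_of_pos hν, div_le_iff₀ hν,
          abs_of_nonpos (by linarith)]
        linarith
      rw [norm_mul, norm_pow, Real.norm_eq_abs, sq_abs]
      nlinarith [mul_le_mul_of_nonneg_left h3 (sq_nonneg (besselQuot n r))]
    · refine Eventually.of_forall fun r => ?_
      have hd : HasDerivAt (fun ν : ℝ => Real.exp (-(2 * ν) * r)) (-(2 * r)) 0 := by
        have h : HasDerivAt (fun ν : ℝ => Real.exp (-(2 * ν) * r))
            (Real.exp (-(2 * 0) * r) * (-(2 * 1) * r)) 0 :=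
          (((hasDerivAt_id (0 : ℝ)).const_mul 2).neg.mul_const r).exp
        exact h.congr_deriv (by simp)
      have h := (hasDerivAt_iff_tendsto_slope.1 hd).mono_left
        (nhdsWithin_mono 0 (fun x (hx : x ∈ Ioi (0 : ℝ)) => ne_of_gt hx))
      refine (h.const_mul (besselQuot n r ^ 2)).congr fun ν => ?_
      simp [slope, div_eq_inv_mul]
  have hval2 : ∫ r in Ioi 0, besselQuot n r ^ 2 * (-(2 * r)) = -(n : ℝ) := by
    have e : ∀ r : ℝ, besselQuot n r ^ 2 * (-(2 * r)) = -2 * (r * besselQuot n r ^ 2) := fun r => by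
      ring
    simp only [e]
    rw [integral_const_mul, hval]; ring
  rw [hval2] at hlim
  refine (Asymptotics.isLittleO_iff_tendsto' ?_).2 ?_
  · filter_upwards [self_mem_nhdsWithin] with ν hν h0
    exact absurd h0 (ne_of_gt hν)
  · have h := hlim.add_const (n : ℝ)
    rw [neg_add_cancel] at h
    refine h.congr' ?_
    filter_upwards [self_mem_nhdsWithin] with ν hν
    have hν : (0 : ℝ) < ν := hν
    rw [← besselCov_self n hn, besselCov, eq_div_iff hν.ne', add_mul, ← integral_mul_const,
      sub_sub_eq_add_sub, ← sub_add_eq_add_sub, ← integral_sub (integrableOn_besselKernel_mul hν.le n n)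
        (integrableOn_besselQuot_mul n n)]
    congr 1
    refine integral_congr_ae (Eventually.of_forall fun r => ?_)
    simp only [besselKernel_eq]
    rw [show -(2 * ν) * r = -ν * r + -ν * r by ring, Real.exp_add]
    field_simp

lemma tendsto_integral_besselKernel_sq (n : ℕ) (hn : 1 ≤ n) :
    Tendsto (fun ν : ℝ => ∫ r in Ioi 0, besselKernel ν n r * besselKernel ν n r) (𝓝[>] 0)
      (𝓝 (∫ r in Ioi 0, besselKernel 0 n r * besselKernel 0 n r)) := by
  have hid : Tendsto (fun ν : ℝ => ν) (𝓝[>] 0) (𝓝 0) := tendsto_nhdsWithin_of_tendsto_nhds tendsto_id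
  have h := ((isLittleO_integral_besselKernel_sq n hn).trans_tendsto hid).add
    ((hid.const_mul (n : ℝ)).const_sub (8 * (n : ℝ) ^ 2 / (Real.pi * (4 * (n : ℝ) ^ 2 - 1))))
  rw [integral_besselKernel_zero, besselCov_self n hn]
  simpa using h

/-! ### Isometries determined by their Gram matrices -/

/-- Two families in Hilbert spaces whose Gram matrices agree up to the factor `σ ^ 2` are related
by a bounded operator, which is `σ` times an isometry on the closed span of the first one. -/
theorem exists_clm_of_inner_eq {ι H K : Type*} [NormedAddCommGroup H] [InnerProductSpace ℝ H]
    [CompleteSpace H] [NormedAddCommGroup K] [InnerProductSpace ℝ K] [CompleteSpace K]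
    (σ : ℝ) (hσ : 0 ≤ σ) (e : ι → H) (u : ι → K)
    (h : ∀ i j, inner ℝ (u i) (u j) = σ ^ 2 * inner ℝ (e i) (e j)) :
    ∃ W : H →L[ℝ] K, (∀ i, W (e i) = u i) ∧
      ∀ x ∈ (Submodule.span ℝ (Set.range e)).topologicalClosure, ‖W x‖ = σ * ‖x‖ := by
  classical
  set S := (Submodule.span ℝ (Set.range e)).topologicalClosure with hS
  have : CompleteSpace S := (Submodule.isClosed_topologicalClosure _).completeSpace_coe
  have hnorm : ∀ c : ι →₀ ℝ, ‖Finsupp.linearCombination ℝ u c‖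
      = σ * ‖Finsupp.linearCombination ℝ e c‖ := by
    intro c
    have h2 : ‖Finsupp.linearCombination ℝ u c‖ ^ 2
        = (σ * ‖Finsupp.linearCombination ℝ e c‖) ^ 2 := by
      rw [mul_pow, ← real_inner_self_eq_norm_sq, ← real_inner_self_eq_norm_sq,
        Finsupp.linearCombination_apply, Finsupp.linearCombination_apply, Finsupp.sum, Finsupp.sum,
        sum_inner, sum_inner, Finset.mul_sum]
      refine Finset.sum_congr rfl fun i _ => ?_
      rw [inner_sum, inner_sum, Finset.mul_sum]
      refine Finset.sum_congr rfl fun j _ => ?_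
      simp only [real_inner_smul_left, real_inner_smul_right, h]
      ring
    exact (pow_left_inj₀ (norm_nonneg _) (by positivity) two_ne_zero).1 h2
  have hmem : ∀ c : ι →₀ ℝ, Finsupp.linearCombination ℝ e c ∈ S := fun c =>
    Submodule.le_topologicalClosure _
      (by rw [← Finsupp.range_linearCombination]; exact LinearMap.mem_range_self _ c)
  set E : (ι →₀ ℝ) →ₗ[ℝ] S := (Finsupp.linearCombination ℝ e).codRestrict S hmem with hE
  have hdense : DenseRange E := by
    rw [DenseRange, dense_iff_closure_eq, Set.eq_univ_iff_forall]
    intro x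
    rw [closure_subtype]
    have hx : (x : H) ∈ closure (Submodule.span ℝ (Set.range e) : Set H) := x.2
    convert hx
    ext y
    rw [← Finsupp.range_linearCombination]
    constructor
    · rintro ⟨_, ⟨c, rfl⟩, rfl⟩
      exact ⟨c, rfl⟩
    · rintro ⟨c, rfl⟩
      exact ⟨E c, ⟨c, rfl⟩, rfl⟩
  have hle : ∀ c, ‖Finsupp.linearCombination ℝ u c‖ ≤ σ * ‖E c‖ := fun c => (hnorm c).le
  -- Projecting first onto the closed span defines the operator on the whole space; the orthogonal
  -- complement goes to `0`.
  refine ⟨((Finsupp.linearCombination ℝ u).extendOfNorm E).comp S.orthogonalProjectionOnto,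
    fun i => ?_, ?_⟩
  · have h1 : e i ∈ S := Submodule.le_topologicalClosure _ (Submodule.subset_span ⟨i, rfl⟩)
    have h2 : (⟨e i, h1⟩ : S) = E (Finsupp.single i 1) := by
      ext
      simp [hE]
    have h3 : S.orthogonalProjectionOnto (e i) = E (Finsupp.single i 1) := by
      rw [← h2]
      exact Submodule.orthogonalProjectionOnto_mem_subspace_eq_self (⟨e i, h1⟩ : S)
    rw [ContinuousLinearMap.comp_apply, h3, LinearMap.extendOfNorm_eq hdense ⟨σ, hle⟩]
    simp
  · intro x hx
    have h3 : S.orthogonalProjectionOnto x = ⟨x, hx⟩ :=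
      Submodule.orthogonalProjectionOnto_mem_subspace_eq_self (⟨x, hx⟩ : S)
    rw [ContinuousLinearMap.comp_apply, h3]
    have hcl : IsClosed {y : S | ‖(Finsupp.linearCombination ℝ u).extendOfNorm E y‖ = σ * ‖y‖} :=
      isClosed_eq (by fun_prop) (by fun_prop)
    refine hdense.induction_on (p := fun y : S =>
      ‖(Finsupp.linearCombination ℝ u).extendOfNorm E y‖ = σ * ‖y‖) ⟨x, hx⟩ hcl fun c => ?_
    rw [LinearMap.extendOfNorm_eq hdense ⟨σ, hle⟩]
    exact hnorm c

/-! ### Centred Gaussian variables -/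

/-- Convergence in distribution implies pointwise convergence of the characteristic functions. -/
theorem tendsto_charFun_of_tendstoInDistribution {ι Ω' : Type*} {Ω : ι → Type*}
    [∀ i, MeasurableSpace (Ω i)] [MeasurableSpace Ω'] {μ : ∀ i, Measure (Ω i)}
    [∀ i, IsProbabilityMeasure (μ i)] {μ' : Measure Ω'} [IsProbabilityMeasure μ']
    {X : ∀ i, Ω i → ℝ} {Z : Ω' → ℝ} {l : Filter ι}
    (h : TendstoInDistribution X l Z μ μ') (t : ℝ) :
    Tendsto (fun i => charFun ((μ i).map (X i)) t) l (𝓝 (charFun (μ'.map Z) t)) := by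
  have h1 := (ProbabilityMeasure.tendsto_iff_forall_integral_rclike_tendsto ℂ).1 h.tendsto
  simp_rw [charFun_eq_integral_innerProbChar]
  exact h1 (BoundedContinuousFunction.innerProbChar t)

/-- Mean-square convergence implies convergence in distribution, so both sides of the equation are
continuous in `Z`. Hence the Gaussian law passes from finite combinations of `L(t)` to their closed
span. -/
theorem isClosed_gaussian_Lp {Ω : Type*} [MeasurableSpace Ω] (P : Measure Ω)
    [IsProbabilityMeasure P] (t : ℝ) :
    IsClosed {Z : Lp ℝ 2 P | charFun (P.map Z) t = Complex.exp (-(t ^ 2 * ‖Z‖ ^ 2 / 2 : ℝ))} := by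
  refine isClosed_eq ?_ (by fun_prop)
  rw [continuous_iff_seqContinuous]
  intro Z Z₀ hZ
  refine tendsto_charFun_of_tendstoInDistribution (μ := fun _ => P) (μ' := P) ?_ t
  exact (tendstoInMeasure_of_tendsto_Lp hZ).tendstoInDistribution
    fun i => (Lp.aestronglyMeasurable _).aemeasurable

theorem charFun_map_of_hasGaussianLaw {Ω : Type*} [MeasurableSpace Ω] {P : Measure Ω}
    [IsProbabilityMeasure P] {Z : Ω → ℝ} (hZ : HasGaussianLaw Z P) (h0 : ∫ ω, Z ω ∂P = 0)
    (t : ℝ) : charFun (P.map Z) t = Complex.exp (-(t ^ 2 * (∫ ω, Z ω ^ 2 ∂P) / 2 : ℝ)) := by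
  rw [hZ.map_eq_gaussianReal, charFun_gaussianReal, variance_eq_sub hZ.memLp_two, h0]
  have h1 : 0 ≤ ∫ ω, Z ω ^ 2 ∂P := integral_nonneg fun ω => sq_nonneg _
  simp only [Pi.pow_apply]
  rw [Real.coe_toNNReal _ (by simpa using h1)]
  push_cast
  congr 1
  ring

/-- The value `v = 0` is admitted, giving a Dirac mass; this covers `σ = 0`. -/
theorem hasGaussianLaw_of_charFun {Ω : Type*} [MeasurableSpace Ω] {P : Measure Ω}
    [IsProbabilityMeasure P] {Z : Ω → ℝ} (hZ : AEMeasurable Z P) {v : ℝ} (hv : 0 ≤ v)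
    (h : ∀ t : ℝ, charFun (P.map Z) t = Complex.exp (-(t ^ 2 * v / 2 : ℝ))) :
    HasGaussianLaw Z P ∧ ∫ ω, Z ω ∂P = 0 ∧ ∫ ω, Z ω ^ 2 ∂P = v := by
  have hp : IsProbabilityMeasure (P.map Z) := Measure.isProbabilityMeasure_map hZ
  have h1 : P.map Z = gaussianReal 0 v.toNNReal := by
    refine Measure.ext_of_charFun (funext fun t => ?_)
    rw [h, charFun_gaussianReal, Real.coe_toNNReal v hv]
    push_cast
    congr 1
    simp
    ring
  have hG : HasGaussianLaw Z P := ⟨by rw [h1]; infer_instance⟩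
  have h2 : ∫ ω, Z ω ∂P = 0 := by
    have := integral_map (f := fun x : ℝ => x) hZ (by fun_prop)
    rw [← this, h1, integral_id_gaussianReal]
  refine ⟨hG, h2, ?_⟩
  have h3 : Var[Z; P] = v := by
    have := variance_map (X := fun x : ℝ => x) (μ := P) (Y := Z) (by fun_prop) hZ
    rw [h1] at this
    have h4 := variance_id_gaussianReal (μ := 0) (v := v.toNNReal)
    simp only [Function.comp_def] at this
    rw [← this]
    exact h4.trans (Real.coe_toNNReal v hv)
  rw [variance_eq_sub hG.memLp_two, h2] at h3
  simpa using h3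

/-! ### Square integrable functions on the half-line -/

theorem norm_sq_Lp_two {α : Type*} [MeasurableSpace α] {μ : Measure α} (Z : Lp ℝ 2 μ) :
    ‖Z‖ ^ 2 = ∫ x, Z x ^ 2 ∂μ := by
  rw [← real_inner_self_eq_norm_sq, L2.inner_def]
  refine integral_congr_ae (Eventually.of_forall fun x => ?_)
  simp [sq]

theorem norm_sq_of_ae_eq_indicator {g : Lp ℝ 2 (volume : Measure ℝ)} {S : Set ℝ}
    (hS : MeasurableSet S) {f : ℝ → ℝ} (h : g =ᵐ[volume] S.indicator f) :
    ‖g‖ ^ 2 = ∫ r in S, f r ^ 2 := by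
  rw [norm_sq_Lp_two, ← integral_indicator hS]
  refine integral_congr_ae ?_
  filter_upwards [h] with x hx
  rw [hx]
  by_cases hxS : x ∈ S <;> simp [hxS]

theorem exists_Lp_ae_eq_indicator {f : ℝ → ℝ} (hf : Continuous f) {S : Set ℝ}
    (hS : MeasurableSet S) (h : IntegrableOn (fun r => f r ^ 2) S) :
    ∃ g : Lp ℝ 2 (volume : Measure ℝ), g =ᵐ[volume] S.indicator f := by
  have h1 : MemLp (S.indicator f) 2 volume := by
    rw [memLp_indicator_iff_restrict hS]
    exact (memLp_two_iff_integrable_sq hf.aestronglyMeasurable).2 h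
  exact ⟨h1.toLp, h1.coeFn_toLp⟩

/-- The indicator function of `(0, t]`. -/
noncomputable def timeIndicator (t : ℝ) : Lp ℝ 2 (volume : Measure ℝ) :=
  indicatorConstLp 2 (measurableSet_Ioc (a := (0 : ℝ)) (b := t)) (by simp) 1

theorem inner_timeIndicator {s t : ℝ} (hs : 0 ≤ s) (hst : s ≤ t) :
    inner ℝ (timeIndicator s) (timeIndicator t) = s := by
  rw [timeIndicator, timeIndicator, L2.real_inner_indicatorConstLp_one_indicatorConstLp_one
    measurableSet_Ioc measurableSet_Ioc (by simp) (by simp),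
    Set.Ioc_inter_Ioc]
  simp [min_eq_left hst, hs]

theorem sum_indicator_Ioc {t : ℕ → ℝ} (ht : Monotone t) (N : ℕ) (x : ℝ) :
    ∑ k ∈ Finset.range N, (Ioc (t k) (t (k + 1))).indicator (fun _ => (1 : ℝ)) x
      = (Ioc (t 0) (t N)).indicator (fun _ => (1 : ℝ)) x := by
  induction N with
  | zero => simp
  | succ N ih =>
    rw [Finset.sum_range_succ, ih]
    have h1 := ht (Nat.zero_le N)
    have h2 := ht (Nat.le_succ N)
    simp only [Set.indicator, Set.mem_Ioc]
    split_ifs <;> grind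

theorem timeIndicator_sub_ae {s t : ℝ} (hs : 0 ≤ s) (hst : s ≤ t) :
    (timeIndicator t - timeIndicator s : Lp ℝ 2 (volume : Measure ℝ))
      =ᵐ[volume] (Ioc s t).indicator fun _ => (1 : ℝ) := by
  have h1 : timeIndicator t =ᵐ[volume] _ := indicatorConstLp_coeFn
  have h2 : timeIndicator s =ᵐ[volume] _ := indicatorConstLp_coeFn
  filter_upwards [Lp.coeFn_sub (timeIndicator t) (timeIndicator s), h1, h2] with x hx h1 h2
  rw [hx, Pi.sub_apply, h1, h2]
  simp only [Set.indicator, Set.mem_Ioc]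
  split_ifs <;> grind

theorem coeFn_sum_smul {α ι : Type*} [MeasurableSpace α] {μ : Measure α} (s : Finset ι)
    (c : ι → ℝ) (Z : ι → Lp ℝ 2 μ) :
    ⇑(∑ k ∈ s, c k • Z k) =ᵐ[μ] fun x => ∑ k ∈ s, c k * Z k x := by
  classical
  induction s using Finset.induction_on with
  | empty => simpa using! Lp.coeFn_zero ℝ 2 μ
  | insert a s ha ih =>
    simp only [Finset.sum_insert ha]
    filter_upwards [ih, Lp.coeFn_add (c a • Z a) (∑ k ∈ s, c k • Z k),
      Lp.coeFn_smul (c a) (Z a)] with x h1 h2 h3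
    rw [h2, Pi.add_apply, h1, h3]
    rfl

/-- Step functions along fine partitions approximate a continuous function in mean square. -/
theorem exists_norm_sum_timeIndicator_sub_le {f : ℝ → ℝ} (hf : Continuous f) {T : ℝ}
    {g : Lp ℝ 2 (volume : Measure ℝ)} (hg : g =ᵐ[volume] (Ioc 0 T).indicator f)
    {ε : ℝ} (hε : 0 < ε) :
    ∃ δ : ℝ, 0 < δ ∧ ∀ (N : ℕ) (t : ℕ → ℝ), Monotone t → t 0 = 0 → t N = T →
      (∀ k < N, t (k + 1) - t k < δ) →
      ‖∑ k ∈ Finset.range N, f (t k) • (timeIndicator (t (k + 1)) - timeIndicator (t k)) - g‖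
        ≤ ε := by
  -- A uniform error on `(0, T]` costs at most that error times the norm of the indicator; the `+ 1`
  -- avoids division by zero.
  obtain ⟨δ, hδ, hδf⟩ := Metric.uniformContinuousOn_iff.1
    ((isCompact_Icc (a := (0 : ℝ)) (b := T)).uniformContinuousOn_of_continuous hf.continuousOn)
    (ε / (‖timeIndicator T‖ + 1)) (by positivity)
  refine ⟨δ, hδ, fun N t ht h0 hN hmesh => ?_⟩
  have hpos : ∀ k, 0 ≤ t k := fun k => h0 ▸ ht (Nat.zero_le k)
  have key : ‖∑ k ∈ Finset.range N, f (t k) • (timeIndicator (t (k + 1)) - timeIndicator (t k)) - g‖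
      ≤ ε / (‖timeIndicator T‖ + 1) * ‖timeIndicator T‖ := by
    refine Lp.norm_le_mul_norm_of_ae_le_mul ?_
    have h1 : timeIndicator T =ᵐ[volume] _ := indicatorConstLp_coeFn
    have h2 : ∀ᵐ x, ∀ k, (timeIndicator (t (k + 1)) - timeIndicator (t k) :
        Lp ℝ 2 (volume : Measure ℝ)) x = (Ioc (t k) (t (k + 1))).indicator (fun _ => (1 : ℝ)) x :=
      ae_all_iff.2 fun k => timeIndicator_sub_ae (hpos k) (ht (Nat.le_succ k))
    filter_upwards [Lp.coeFn_sub (∑ k ∈ Finset.range N,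
        f (t k) • (timeIndicator (t (k + 1)) - timeIndicator (t k))) g, h1, h2, hg,
      coeFn_sum_smul (Finset.range N) (fun k => f (t k))
        (fun k => timeIndicator (t (k + 1)) - timeIndicator (t k))]
      with x hx h1 h2 h3 h4
    rw [hx, Pi.sub_apply, h4, h3, h1]
    simp only [h2]
    have h5 : (Ioc 0 T).indicator f x = ∑ k ∈ Finset.range N,
        f x * (Ioc (t k) (t (k + 1))).indicator (fun _ => (1 : ℝ)) x := by
      rw [← Finset.mul_sum, sum_indicator_Ioc ht, h0, hN]
      by_cases hxS : x ∈ Ioc 0 T <;> simp [hxS]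
    have h6 : ‖(Ioc 0 T).indicator (fun _ => (1 : ℝ)) x‖ = ∑ k ∈ Finset.range N,
        (Ioc (t k) (t (k + 1))).indicator (fun _ => (1 : ℝ)) x := by
      rw [sum_indicator_Ioc ht, h0, hN, Real.norm_of_nonneg]
      exact Set.indicator_nonneg (fun _ _ => zero_le_one) _
    rw [h5, h6, ← Finset.sum_sub_distrib, Finset.mul_sum]
    refine (norm_sum_le _ _).trans (Finset.sum_le_sum fun k hk => ?_)
    have hk' := Finset.mem_range.1 hk
    rw [← sub_mul, norm_mul]
    by_cases hxk : x ∈ Ioc (t k) (t (k + 1))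
    · simp only [hxk, Set.indicator_of_mem, norm_one, mul_one]
      have hx1 : x ≤ T := hN ▸ hxk.2.trans (ht hk')
      have hx2 : t k ≤ T := hxk.1.le.trans hx1
      refine (hδf (t k) ⟨hpos k, hx2⟩ x ⟨(hpos k).trans hxk.1.le, hx1⟩ ?_).le
      rw [dist_comm, Real.dist_eq, abs_of_nonneg (by linarith [hxk.1])]
      linarith [hmesh k hk', hxk.2]
    · simp [hxk]
  refine key.trans ?_
  rw [div_mul_eq_mul_div, div_le_iff₀ (by positivity)]
  nlinarith [norm_nonneg (timeIndicator T)]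

/-! ### Uniform partitions -/

/-- The uniform partition of `[a, b]` into `n + 1` intervals, continued beyond `b`. -/
noncomputable def uniformPartition (a b : ℝ) (n k : ℕ) : ℝ := a + k * ((b - a) / (n + 1))

theorem monotone_uniformPartition {a b : ℝ} (hab : a ≤ b) (n : ℕ) :
    Monotone (uniformPartition a b n) := fun i j hij => by
  have h : 0 ≤ (b - a) / ((n : ℝ) + 1) := div_nonneg (sub_nonneg.2 hab) (by positivity)
  have : (i : ℝ) ≤ j := by exact_mod_cast hij
  unfold uniformPartition
  gcongr

theorem uniformPartition_zero (a b : ℝ) (n : ℕ) : uniformPartition a b n 0 = a := by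
  simp [uniformPartition]

theorem uniformPartition_last (a b : ℝ) (n : ℕ) : uniformPartition a b n (n + 1) = b := by
  have : (n : ℝ) + 1 ≠ 0 := by positivity
  unfold uniformPartition
  push_cast
  field_simp
  ring

theorem eventually_uniformPartition_lt (a b : ℝ) {δ : ℝ} (hδ : 0 < δ) :
    ∀ᶠ n : ℕ in atTop, ∀ k, uniformPartition a b n (k + 1) - uniformPartition a b n k < δ := by
  have h : Tendsto (fun n : ℕ => (b - a) / ((n : ℝ) + 1)) atTop (𝓝 0) :=
    tendsto_const_nhds.div_atTop (tendsto_atTop_add_const_right _ _ tendsto_natCast_atTop_atTop)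
  filter_upwards [h.eventually_lt_const hδ] with n hn k
  unfold uniformPartition
  push_cast
  linarith

/-- The functions supported in `[0, T]` lie in the closed span of the indicators. -/
theorem mem_closure_span_timeIndicator {f : ℝ → ℝ} (hf : Continuous f) {T : ℝ} (hT : 0 ≤ T)
    {g : Lp ℝ 2 (volume : Measure ℝ)} (hg : g =ᵐ[volume] (Ioc 0 T).indicator f) :
    g ∈ (Submodule.span ℝ (Set.range fun t : ℝ≥0 => timeIndicator t)).topologicalClosure := by
  refine Metric.mem_closure_iff.2 fun ε hε => ?_
  obtain ⟨δ, hδ, h⟩ := exists_norm_sum_timeIndicator_sub_le hf hg (half_pos hε)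
  obtain ⟨n, hn⟩ := (eventually_uniformPartition_lt 0 T hδ).exists
  have hlt := h (n + 1) (uniformPartition 0 T n) (monotone_uniformPartition hT n)
    (uniformPartition_zero 0 T n) (uniformPartition_last 0 T n) fun k _ => hn k
  rw [← dist_eq_norm, dist_comm] at hlt
  have hpos : ∀ k, 0 ≤ uniformPartition 0 T n k := fun k => by
    have := monotone_uniformPartition hT n (Nat.zero_le k)
    rwa [uniformPartition_zero] at this
  have hmem : ∀ k, timeIndicator (uniformPartition 0 T n k)
      ∈ Submodule.span ℝ (Set.range fun t : ℝ≥0 => timeIndicator t) := fun k =>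
    Submodule.subset_span ⟨⟨_, hpos k⟩, rfl⟩
  exact ⟨_, Submodule.sum_mem _ fun k _ =>
    Submodule.smul_mem _ _ (Submodule.sub_mem _ (hmem _) (hmem _)),
    hlt.trans_lt (half_lt_self hε)⟩

/-! ### Wiener integrals with respect to a Gaussian Lévy process -/

/-- `W` is the Wiener integral `f ↦ ∫ f dL` of square integrable functions on the half-line. -/
structure IsWienerIntegral {Ω : Type*} [MeasurableSpace Ω] (P : Measure Ω) (L : ℝ≥0 → Ω → ℝ)
    (σ : ℝ) (W : Lp ℝ 2 (volume : Measure ℝ) →L[ℝ] Lp ℝ 2 P) : Prop where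
  map_timeIndicator : ∀ t : ℝ≥0, W (timeIndicator t) =ᵐ[P] L t
  charFun_eq : ∀ g ∈ (Submodule.span ℝ
    (Set.range fun t : ℝ≥0 => timeIndicator t)).topologicalClosure, ∀ t : ℝ,
    charFun (P.map (W g)) t = Complex.exp (-(t ^ 2 * (σ ^ 2 * ‖g‖ ^ 2) / 2 : ℝ))

section

variable {Ω : Type*} [MeasurableSpace Ω] {P : Measure Ω}
  {L : ℝ≥0 → Ω → ℝ} {σ : ℝ}

theorem IsLevyProcess.hasGaussianLaw [IsProbabilityMeasure P] (hL : IsLevyProcess P L)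
    (hΨ : HasCumulant P L (fun lam => -(σ : ℂ) ^ 2 * (lam : ℂ) ^ 2 / 2)) (t : ℝ≥0) :
    HasGaussianLaw (L t) P ∧ ∫ ω, L t ω ∂P = 0 ∧ ∫ ω, L t ω ^ 2 ∂P = σ ^ 2 * t := by
  refine hasGaussianLaw_of_charFun (hL.aemeasurable t) (by positivity) fun u => ?_
  rw [hΨ]
  push_cast
  congr 1
  ring

theorem IsLevyProcess.isGaussianProcess [IsProbabilityMeasure P] (hL : IsLevyProcess P L)
    (hΨ : HasCumulant P L (fun lam => -(σ : ℂ) ^ 2 * (lam : ℂ) ^ 2 / 2)) :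
    IsGaussianProcess L P :=
  hL.indep_increments.isGaussianProcess (fun t => (hL.hasGaussianLaw hΨ t).1) hL.start_zero

/-- Stationarity gives `E(L(t) - L(s))² = σ²(t - s)`; expanding the square isolates the mixed
moment. -/
theorem IsLevyProcess.integral_mul [IsProbabilityMeasure P] (hL : IsLevyProcess P L)
    (hΨ : HasCumulant P L (fun lam => -(σ : ℂ) ^ 2 * (lam : ℂ) ^ 2 / 2)) {s t : ℝ≥0}
    (hst : s ≤ t) : ∫ ω, L s ω * L t ω ∂P = σ ^ 2 * s := by
  have hs := hL.hasGaussianLaw hΨ s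
  have ht := hL.hasGaussianLaw hΨ t
  have h1 : ∫ ω, (L t ω - L s ω) ^ 2 ∂P = σ ^ 2 * ((t : ℝ) - s) := by
    have h := ((hL.stationary_increments s (t - s)).comp (u := fun x : ℝ => x ^ 2)
      (by fun_prop)).integral_eq
    rw [add_tsub_cancel_of_le hst] at h
    simp only [Function.comp_def] at h
    rw [h, (hL.hasGaussianLaw hΨ (t - s)).2.2, NNReal.coe_sub hst]
  have h2 : ∫ ω, (L t ω - L s ω) ^ 2 ∂P
      = ∫ ω, L t ω ^ 2 ∂P - 2 * ∫ ω, L s ω * L t ω ∂P + ∫ ω, L s ω ^ 2 ∂P := by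
    have i1 := hs.1.memLp_two.integrable_sq
    have i2 := ht.1.memLp_two.integrable_sq
    have i3 : Integrable (fun ω => L s ω * L t ω) P := hs.1.memLp_two.integrable_mul ht.1.memLp_two
    have i4 : Integrable (fun ω => L t ω ^ 2 - 2 * (L s ω * L t ω)) P := i2.sub (i3.const_mul 2)
    rw [← integral_const_mul, ← integral_sub i2 (i3.const_mul 2), ← integral_add i4 i1]
    exact integral_congr_ae (Eventually.of_forall fun ω => by simp only []; ring)
  rw [h1, hs.2.2, ht.2.2] at h2
  linarith

theorem IsLevyProcess.exists_isWienerIntegral [IsProbabilityMeasure P]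
    (hL : IsLevyProcess P L) (hσ : 0 ≤ σ)
    (hΨ : HasCumulant P L (fun lam => -(σ : ℂ) ^ 2 * (lam : ℂ) ^ 2 / 2)) :
    ∃ W, IsWienerIntegral P L σ W := by
  have hmem : ∀ t, MemLp (L t) 2 P := fun t => (hL.hasGaussianLaw hΨ t).1.memLp_two
  have hinner : ∀ s t : ℝ≥0, s ≤ t → inner ℝ ((hmem s).toLp) ((hmem t).toLp)
      = σ ^ 2 * inner ℝ (timeIndicator s) (timeIndicator t) := by
    intro s t hst
    rw [inner_timeIndicator s.coe_nonneg (NNReal.coe_le_coe.2 hst), ← hL.integral_mul hΨ hst, L2.inner_def]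
    refine integral_congr_ae ?_
    filter_upwards [(hmem s).coeFn_toLp, (hmem t).coeFn_toLp] with ω h1 h2
    rw [h1, h2]
    simp [mul_comm]
  obtain ⟨W, hW, hnorm⟩ := exists_clm_of_inner_eq σ hσ (fun t : ℝ≥0 => timeIndicator t)
    (fun t => (hmem t).toLp) (fun s t => by
      rcases le_total s t with h | h
      · exact hinner s t h
      · rw [real_inner_comm, hinner t s h, real_inner_comm])
  refine ⟨W, fun t => (hW t) ▸ (hmem t).coeFn_toLp, fun g hg t => ?_⟩
  rw [← mul_pow, ← hnorm g hg]
  -- By closedness it suffices to treat finite combinations of indicators, whose images are finite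
  -- combinations of values of the Gaussian process `L`.
  have hcl := (isClosed_gaussian_Lp P t).preimage W.continuous
  refine closure_minimal ?_ hcl hg
  intro x hx
  obtain ⟨c, rfl⟩ : ∃ c, Finsupp.linearCombination ℝ (fun t : ℝ≥0 => timeIndicator t) c = x := by
    rwa [← LinearMap.mem_range, Finsupp.range_linearCombination]
  have hsum : W (Finsupp.linearCombination ℝ (fun t : ℝ≥0 => timeIndicator t) c)
      =ᵐ[P] fun ω => ∑ i ∈ c.support, c i * L i ω := by
    rw [Finsupp.linearCombination_apply, Finsupp.sum, map_sum]
    simp only [map_smul, hW]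
    refine (coeFn_sum_smul c.support c _).trans ?_
    have : ∀ᵐ ω ∂P, ∀ i : c.support, ((hmem i).toLp : Ω → ℝ) ω = L i ω :=
      ae_all_iff.2 fun i => (hmem i).coeFn_toLp
    filter_upwards [this] with ω hω
    exact Finset.sum_congr rfl fun i hi => by rw [hω ⟨i, hi⟩]
  have hGauss : HasGaussianLaw (fun ω => ∑ i ∈ c.support, c i * L i ω) P :=
    ((hL.isGaussianProcess hΨ).smul c).hasGaussianLaw_fun_sum
  have hG := hGauss.congr hsum.symm
  have h0 : ∫ ω, W (Finsupp.linearCombination ℝ (fun t : ℝ≥0 => timeIndicator t) c) ω ∂P = 0 := by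
    rw [integral_congr_ae hsum, integral_finsetSum _ fun i _ =>
      (hL.hasGaussianLaw hΨ i).1.integrable.const_mul _]
    refine Finset.sum_eq_zero fun i _ => ?_
    rw [integral_const_mul, (hL.hasGaussianLaw hΨ i).2.1, mul_zero]
  show charFun _ t = _
  rw [charFun_map_of_hasGaussianLaw hG h0 t, ← norm_sq_Lp_two]

variable {W : Lp ℝ 2 (volume : Measure ℝ) →L[ℝ] Lp ℝ 2 P}

/-- A Riemann sum is almost surely `W` of a step function. Fine step functions are close to `g` in
mean square, and `W` is continuous into convergence in measure. -/
theorem IsWienerIntegral.isStochIntegral (hW : IsWienerIntegral P L σ W) {f : ℝ → ℝ}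
    (hf : Continuous f) {T : ℝ} {g : Lp ℝ 2 (volume : Measure ℝ)}
    (hg : g =ᵐ[volume] (Ioc 0 T).indicator f) :
    IsStochIntegral P (timeShift L 0) f 0 T (W g) := by
  refine ⟨(Lp.aestronglyMeasurable _).aemeasurable, fun ε hε => ?_⟩
  have h1 : TendstoInMeasure P (fun h : Lp ℝ 2 (volume : Measure ℝ) => (W h : Ω → ℝ)) (𝓝 g) (W g) :=
    tendstoInMeasure_of_tendsto_Lp W.continuous.continuousAt
  rw [tendstoInMeasure_iff_norm] at h1
  have h2 := (h1 ε hε).eventually_lt_const (ENNReal.ofReal_pos.2 hε)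
  obtain ⟨η, hη, hlt⟩ := Metric.eventually_nhds_iff.1 h2
  obtain ⟨δ, hδ, h3⟩ := exists_norm_sum_timeIndicator_sub_le hf hg (half_pos hη)
  refine ⟨δ, hδ, fun N t ht h0 hN hmesh => ?_⟩
  have h4 := h3 N t ht h0 hN hmesh
  rw [← dist_eq_norm] at h4
  have h5 := hlt (h4.trans_lt (half_lt_self hη))
  refine le_trans (le_of_eq (measure_congr ?_)) h5.le
  have hpos : ∀ k, 0 ≤ t k := fun k => h0 ▸ ht (Nat.zero_le k)
  have hL : ∀ᵐ ω ∂P, ∀ k, W (timeIndicator (t k)) ω = timeShift L 0 (t k) ω := by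
    refine ae_all_iff.2 fun k => ?_
    have := hW.map_timeIndicator (t k).toNNReal
    rw [Real.coe_toNNReal _ (hpos k)] at this
    filter_upwards [this] with ω hω
    rw [hω, timeShift, sub_zero]
  have hsub : ∀ᵐ ω ∂P, ∀ k, W (timeIndicator (t (k + 1)) - timeIndicator (t k)) ω
      = W (timeIndicator (t (k + 1))) ω - W (timeIndicator (t k)) ω := by
    refine ae_all_iff.2 fun k => ?_
    rw [map_sub]
    exact Lp.coeFn_sub _ _
  have hsum := coeFn_sum_smul (Finset.range N) (fun k => f (t k))
    (fun k => W (timeIndicator (t (k + 1)) - timeIndicator (t k)))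
  simp only [← map_smul] at hsum
  rw [← map_sum] at hsum
  filter_upwards [hL, hsub, hsum] with ω h1 h2 h3
  refine propext ?_
  show ε ≤ |_| ↔ ε ≤ ‖_‖
  rw [h3, Real.norm_eq_abs]
  simp only [h2, h1]

theorem IsStochIntegral.tendstoInMeasure {X : ℝ → Ω → ℝ} {f : ℝ → ℝ} {a b : ℝ} (hab : a ≤ b)
    {Y : Ω → ℝ} (h : IsStochIntegral P X f a b Y) :
    TendstoInMeasure P (fun (n : ℕ) ω => ∑ k ∈ Finset.range (n + 1), f (uniformPartition a b n k) *
      (X (uniformPartition a b n (k + 1)) ω - X (uniformPartition a b n k) ω)) atTop Y := by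
  rw [tendstoInMeasure_iff_norm]
  intro ε hε
  rw [ENNReal.tendsto_nhds_zero]
  intro η hη
  obtain ⟨κ, hκ, hκη⟩ : ∃ κ : ℝ, 0 < κ ∧ ENNReal.ofReal κ ≤ η := by
    rcases eq_or_ne η ∞ with rfl | h
    · exact ⟨1, one_pos, le_top⟩
    · exact ⟨η.toReal, ENNReal.toReal_pos hη.ne' h, ENNReal.ofReal_toReal_le⟩
  -- `IsStochIntegral` uses one number for both the deviation and its probability; the minimum
  -- serves the two separately.
  obtain ⟨δ, hδ, h1⟩ := h.2 (min ε κ) (lt_min hε hκ)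
  filter_upwards [eventually_uniformPartition_lt a b hδ] with n hn
  refine le_trans (measure_mono fun ω hω => ?_) ((h1 (n + 1) _ (monotone_uniformPartition hab n)
    (uniformPartition_zero a b n) (uniformPartition_last a b n) fun k _ => hn k).trans
    ((ENNReal.ofReal_le_ofReal (min_le_right _ _)).trans hκη))
  have hω' : ε ≤ ‖_‖ := hω
  exact (min_le_left _ _).trans hω'

theorem IsStochIntegral.ae_eq {X : ℝ → Ω → ℝ} {f : ℝ → ℝ} {a b : ℝ} (hab : a ≤ b)
    {Y Y' : Ω → ℝ} (h : IsStochIntegral P X f a b Y) (h' : IsStochIntegral P X f a b Y') :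
    Y =ᵐ[P] Y' :=
  tendstoInMeasure_ae_unique (h.tendstoInMeasure hab) (h'.tendstoInMeasure hab)

/-- Translating a partition leaves every increment literally unchanged, because `timeShift L s` at
`t` depends on `t - s` only. The same variable `Y` works, with no appeal to stationarity. -/
theorem IsStochIntegral.timeShift {f : ℝ → ℝ} {s b : ℝ} {Y : Ω → ℝ}
    (h : IsStochIntegral P (timeShift L s) f s b Y) (s' : ℝ) :
    IsStochIntegral P (_root_.timeShift L s') (fun r => f (r - s' + s)) s' (b - s + s') Y := by
  refine ⟨h.1, fun ε hε => ?_⟩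
  obtain ⟨δ, hδ, h1⟩ := h.2 ε hε
  refine ⟨δ, hδ, fun N t ht h0 hN hmesh => ?_⟩
  have h2 := h1 N (fun k => t k - s' + s) (fun i j hij => by have := ht hij; simp only []; linarith)
    (by simp [h0]) (by simp only [hN]; ring) (fun k hk => by have := hmesh k hk; linarith)
  simp only [_root_.timeShift, add_sub_cancel_right] at h2 ⊢
  exact h2

theorem IsWienerIntegral.ae_eq (hW : IsWienerIntegral P L σ W) {f : ℝ → ℝ}
    (hf : Continuous f) {T : ℝ} (hT : 0 ≤ T) {g : Lp ℝ 2 (volume : Measure ℝ)}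
    (hg : g =ᵐ[volume] (Ioc 0 T).indicator f) {Y : Ω → ℝ}
    (hY : IsStochIntegral P (timeShift L 0) f 0 T Y) : Y =ᵐ[P] W g :=
  hY.ae_eq hT (hW.isStochIntegral hf hg)

/-- The truncations to `[0, T]` converge in mean square. -/
theorem tendsto_of_ae_eq_indicator {f : ℝ → ℝ} (hf2 : IntegrableOn (fun r => f r ^ 2) (Ioi 0))
    {g : Lp ℝ 2 (volume : Measure ℝ)} (hg : g =ᵐ[volume] (Ioi 0).indicator f)
    {G : ℝ → Lp ℝ 2 (volume : Measure ℝ)}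
    (hG : ∀ T, G T =ᵐ[volume] (Ioc 0 T).indicator f) : Tendsto G atTop (𝓝 g) := by
  rw [tendsto_iff_norm_sub_tendsto_zero]
  have h1 : ∀ᶠ T in atTop, √(∫ r in Ioi T, f r ^ 2) = ‖G T - g‖ := by
    filter_upwards [eventually_ge_atTop 0] with T hT
    have h2 : (g - G T : Lp ℝ 2 (volume : Measure ℝ)) =ᵐ[volume] (Ioi T).indicator f := by
      filter_upwards [Lp.coeFn_sub g (G T), hg, hG T] with x hx h1 h2
      rw [hx, Pi.sub_apply, h1, h2]
      simp only [Set.indicator, Set.mem_Ioc, Set.mem_Ioi]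
      split_ifs <;> grind
    rw [← norm_sq_of_ae_eq_indicator measurableSet_Ioi h2, Real.sqrt_sq (norm_nonneg _),
      norm_sub_rev]
  refine Tendsto.congr' h1 ?_
  rw [← Real.sqrt_zero]
  refine (Real.continuous_sqrt.tendsto 0).comp ?_
  have h3 := (intervalIntegral_tendsto_integral_Ioi 0 hf2 tendsto_id).const_sub
    (∫ r in Ioi (0 : ℝ), f r ^ 2)
  rw [sub_self] at h3
  refine h3.congr' ?_
  filter_upwards [eventually_ge_atTop 0] with T hT
  rw [id, ← intervalIntegral.integral_Ioi_sub_Ioi hf2 hT]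
  ring

theorem exists_truncations {f : ℝ → ℝ} (hf : Continuous f) :
    ∃ G : ℝ → Lp ℝ 2 (volume : Measure ℝ), ∀ T, G T =ᵐ[volume] (Ioc 0 T).indicator f := by
  have := fun T : ℝ => exists_Lp_ae_eq_indicator hf (measurableSet_Ioc (a := (0 : ℝ)) (b := T))
    (hf.pow 2).integrableOn_Ioc
  choose G hG using this
  exact ⟨G, hG⟩

theorem IsWienerIntegral.isStochIntegralIoi (hW : IsWienerIntegral P L σ W) {f : ℝ → ℝ}
    (hf : Continuous f) (hf2 : IntegrableOn (fun r => f r ^ 2) (Ioi 0))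
    {g : Lp ℝ 2 (volume : Measure ℝ)} (hg : g =ᵐ[volume] (Ioi 0).indicator f) :
    IsStochIntegralIoi P (timeShift L 0) f 0 (W g) := by
  obtain ⟨G, hG⟩ := exists_truncations hf
  refine ⟨(Lp.aestronglyMeasurable _).aemeasurable, fun T => W (G T),
    fun T _ => hW.isStochIntegral hf (hG T), tendstoInMeasure_of_tendsto_Lp ?_⟩
  exact (W.continuous.tendsto g).comp (tendsto_of_ae_eq_indicator hf2 hg hG)

theorem IsWienerIntegral.ae_eq_Ioi (hW : IsWienerIntegral P L σ W) {f : ℝ → ℝ}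
    (hf : Continuous f) (hf2 : IntegrableOn (fun r => f r ^ 2) (Ioi 0))
    {g : Lp ℝ 2 (volume : Measure ℝ)} (hg : g =ᵐ[volume] (Ioi 0).indicator f) {Y : Ω → ℝ}
    (hY : IsStochIntegralIoi P (timeShift L 0) f 0 Y) : Y =ᵐ[P] W g := by
  obtain ⟨G, hG⟩ := exists_truncations hf
  obtain ⟨-, I, hI, hIY⟩ := hY
  refine tendstoInMeasure_ae_unique (hIY.congr' (f' := fun T => W (G T)) ?_ EventuallyEq.rfl)
    (tendstoInMeasure_of_tendsto_Lp
      ((W.continuous.tendsto g).comp (tendsto_of_ae_eq_indicator hf2 hg hG)))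
  filter_upwards [eventually_ge_atTop 0] with T hT
  exact hW.ae_eq hf hT (hG T) (hI T hT)

end

/-! ### Joint laws and stationary states -/

/-- The Cramér–Wold reduction: a joint characteristic function is that of a linear combination at
`1`. -/
theorem charFun_map_toLp {Ω ι : Type*} [MeasurableSpace Ω] [Fintype ι] {P : Measure Ω}
    {U : Ω → ι → ℝ} (hU : AEMeasurable U P) (c : EuclideanSpace ℝ ι) :
    charFun (P.map fun ω => (WithLp.toLp 2 (U ω) : EuclideanSpace ℝ ι)) c
      = charFun (P.map fun ω => ∑ i, c i * U ω i) 1 := by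
  have hU' : ∀ i, AEMeasurable (fun ω => U ω i) P := fun i =>
    (measurable_pi_apply i).comp_aemeasurable hU
  have hU2 : AEMeasurable (fun ω => (WithLp.toLp 2 (U ω) : EuclideanSpace ℝ ι)) P :=
    (by fun_prop : Measurable (WithLp.toLp 2 : (ι → ℝ) → EuclideanSpace ℝ ι)).comp_aemeasurable hU
  rw [charFun_apply, charFun_apply, integral_map hU2 (by fun_prop),
    integral_map (Finset.aemeasurable_fun_sum _ fun i _ => (hU' i).const_mul _) (by fun_prop)]
  refine integral_congr_ae (Eventually.of_forall fun ω => ?_)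
  simp [PiLp.inner_apply]

theorem integral_add_sq {α : Type*} [MeasurableSpace α] {μ : Measure α} {x y : α → ℝ}
    (hx : Integrable (fun z => x z ^ 2) μ) (hy : Integrable (fun z => y z ^ 2) μ)
    (hxy : Integrable (fun z => x z * y z) μ) :
    ∫ z, (x z + y z) ^ 2 ∂μ
      = (∫ z, x z ^ 2 ∂μ) + (∫ z, y z ^ 2 ∂μ) + 2 * ∫ z, x z * y z ∂μ := by
  have hxy' : Integrable (fun z => x z ^ 2 + y z ^ 2) μ := hx.add hy
  rw [← integral_const_mul, ← integral_add hx hy, ← integral_add hxy' (hxy.const_mul 2)]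
  exact integral_congr_ae (Eventually.of_forall fun z => by simp only []; ring)

/-- Convergence of the characteristic functions of all linear combinations of the coordinates
implies joint convergence in distribution. -/
theorem tendstoInDistribution_of_tendsto_charFun {Ω Ω' ι κ : Type*} [MeasurableSpace Ω]
    [MeasurableSpace Ω'] [Fintype ι] {P : Measure Ω} [IsProbabilityMeasure P] {Q : Measure Ω'}
    [IsProbabilityMeasure Q] {l : Filter κ} [l.IsCountablyGenerated] {X : κ → Ω → ι → ℝ}
    {Z : Ω' → ι → ℝ} (hX : ∀ k, AEMeasurable (X k) P) (hZ : AEMeasurable Z Q)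
    (h : ∀ c : ι → ℝ, Tendsto (fun k => charFun (P.map fun ω => ∑ i, c i * X k ω i) 1) l
      (𝓝 (charFun (Q.map fun ω => ∑ i, c i * Z ω i) 1))) :
    TendstoInDistribution X l Z (fun _ => P) Q := by
  have hcont : Continuous (WithLp.toLp 2 : (ι → ℝ) → EuclideanSpace ℝ ι) := by fun_prop
  have h1 : TendstoInDistribution
      (fun k ω => (WithLp.toLp 2 (X k ω) : EuclideanSpace ℝ ι)) l
      (fun ω => (WithLp.toLp 2 (Z ω) : EuclideanSpace ℝ ι)) (fun _ => P) Q := by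
    refine ⟨fun k => hcont.measurable.comp_aemeasurable (hX k),
      hcont.measurable.comp_aemeasurable hZ, ?_⟩
    -- Lévy's continuity theorem is applied along sequences, which suffice as the filter is
    -- countably generated.
    refine tendsto_of_seq_tendsto fun u hu => ?_
    refine ProbabilityMeasure.tendsto_of_tendsto_charFun fun c => ?_
    have h2 := (h c).comp hu
    rw [← charFun_map_toLp hZ c] at h2
    refine h2.congr fun n => ?_
    exact (charFun_map_toLp (hX _) c).symm
  exact h1.continuous_comp (g := (WithLp.ofLp : EuclideanSpace ℝ ι → ι → ℝ)) (by fun_prop)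

section

variable {Ω : Type*} [MeasurableSpace Ω] {P : Measure Ω}
  {L : ℝ≥0 → Ω → ℝ} {σ : ℝ} {W : Lp ℝ 2 (volume : Measure ℝ) →L[ℝ] Lp ℝ 2 P}

theorem IsWienerIntegral.charFun_sum {ι : Type*} (hW : IsWienerIntegral P L σ W) {S : Set ℝ}
    (hS : MeasurableSet S) (I : Finset ι) (c : ι → ℝ) {f : ι → ℝ → ℝ}
    {g : ι → Lp ℝ 2 (volume : Measure ℝ)} (hg : ∀ i, g i =ᵐ[volume] S.indicator (f i))
    (hmem : ∀ i, g i ∈ (Submodule.span ℝ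
      (Set.range fun t : ℝ≥0 => timeIndicator t)).topologicalClosure)
    {Y : ι → Ω → ℝ} (hY : ∀ i, Y i =ᵐ[P] W (g i)) (t : ℝ) :
    charFun (P.map fun ω => ∑ i ∈ I, c i * Y i ω) t
      = Complex.exp (-(t ^ 2 * (σ ^ 2 * ∫ r in S, (∑ i ∈ I, c i * f i r) ^ 2) / 2 : ℝ)) := by
  have h1 : (∑ i ∈ I, c i • g i : Lp ℝ 2 (volume : Measure ℝ))
      =ᵐ[volume] S.indicator fun r => ∑ i ∈ I, c i * f i r := by
    have : ∀ᵐ r, ∀ i : I, g i r = S.indicator (f i) r := ae_all_iff.2 fun i => hg i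
    filter_upwards [coeFn_sum_smul I c g, this] with r hr hr'
    rw [hr]
    by_cases hrS : r ∈ S
    · rw [Set.indicator_of_mem hrS]
      exact Finset.sum_congr rfl fun i hi => by rw [hr' ⟨i, hi⟩, Set.indicator_of_mem hrS]
    · rw [Set.indicator_of_notMem hrS]
      exact Finset.sum_eq_zero fun i hi => by
        rw [hr' ⟨i, hi⟩, Set.indicator_of_notMem hrS, mul_zero]
  have h2 : (fun ω => ∑ i ∈ I, c i * Y i ω) =ᵐ[P] W (∑ i ∈ I, c i • g i) := by
    rw [map_sum]
    simp only [map_smul]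
    have : ∀ᵐ ω ∂P, ∀ i : I, Y i ω = W (g i) ω := ae_all_iff.2 fun i => hY i
    filter_upwards [coeFn_sum_smul I c fun i => W (g i), this] with ω hω hω'
    rw [hω]
    exact Finset.sum_congr rfl fun i hi => by rw [hω' ⟨i, hi⟩]
  rw [Measure.map_congr h2, hW.charFun_eq _ (Submodule.sum_mem _ fun i _ =>
    Submodule.smul_mem _ _ (hmem i)), norm_sq_of_ae_eq_indicator hS h1]

theorem IsWienerIntegral.charFun_sum_Ioi {ι : Type*} (hW : IsWienerIntegral P L σ W)
    (I : Finset ι) (c : ι → ℝ) {f : ι → ℝ → ℝ} (hf : ∀ i, Continuous (f i))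
    (hf2 : ∀ i, IntegrableOn (fun r => f i r ^ 2) (Ioi 0)) {Y : ι → Ω → ℝ}
    (hY : ∀ i, IsStochIntegralIoi P (timeShift L 0) (f i) 0 (Y i)) (t : ℝ) :
    charFun (P.map fun ω => ∑ i ∈ I, c i * Y i ω) t
      = Complex.exp (-(t ^ 2 * (σ ^ 2 * ∫ r in Ioi 0, (∑ i ∈ I, c i * f i r) ^ 2) / 2 : ℝ)) := by
  choose g hg using fun i => exists_Lp_ae_eq_indicator (hf i) measurableSet_Ioi (hf2 i)
  refine hW.charFun_sum measurableSet_Ioi I c hg (fun i => ?_)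
    (fun i => hW.ae_eq_Ioi (hf i) (hf2 i) (hg i) (hY i)) t
  obtain ⟨G, hG⟩ := exists_truncations (hf i)
  refine (Submodule.isClosed_topologicalClosure _).mem_of_tendsto
    (tendsto_of_ae_eq_indicator (hf2 i) (hg i) hG) ?_
  filter_upwards [eventually_ge_atTop 0] with T hT
  exact mem_closure_span_timeIndicator (hf i) hT (hG T)

/-- The joint law of the integrals `∫_s^0 f_i(-r) dL_s(r)`. -/
theorem IsWienerIntegral.charFun_sum_reversed {ι : Type*} (hW : IsWienerIntegral P L σ W)
    (I : Finset ι) (c : ι → ℝ) {f : ι → ℝ → ℝ} (hf : ∀ i, Continuous (f i)) {s : ℝ} (hs : s ≤ 0)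
    {Y : ι → Ω → ℝ} (hY : ∀ i, IsStochIntegral P (timeShift L s) (fun r => f i (-r)) s 0 (Y i))
    (t : ℝ) :
    charFun (P.map fun ω => ∑ i ∈ I, c i * Y i ω) t = Complex.exp
      (-(t ^ 2 * (σ ^ 2 * ∫ r in (0 : ℝ)..(-s), (∑ i ∈ I, c i * f i r) ^ 2) / 2 : ℝ)) := by
  have hs' : 0 ≤ -s := neg_nonneg.2 hs
  have hc : ∀ i, Continuous fun r => f i (-s - r) := fun i =>
    (hf i).comp (continuous_const.sub continuous_id)
  -- Restarting the clock at `0` changes the integrand to `f(-s - r)`; reflecting `[0,-s]` in the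
  -- variance integral below restores `f`.
  have hY' : ∀ i, IsStochIntegral P (timeShift L 0) (fun r => f i (-s - r)) 0 (-s) (Y i) := by
    intro i
    have h := (hY i).timeShift 0
    rw [zero_sub, add_zero] at h
    convert h using 3
    ring
  choose g hg using fun i => exists_Lp_ae_eq_indicator (hc i)
    (measurableSet_Ioc (a := (0 : ℝ)) (b := -s)) ((hc i).pow 2).integrableOn_Ioc
  rw [hW.charFun_sum measurableSet_Ioc I c hg
    (fun i => mem_closure_span_timeIndicator (hc i) hs' (hg i))
    (fun i => hW.ae_eq (hc i) hs' (hg i) (hY' i)) t, ← intervalIntegral.integral_of_le hs',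
    intervalIntegral.integral_comp_sub_left (fun r => (∑ i ∈ I, c i * f i r) ^ 2) (-s)]
  simp

theorem IsWienerIntegral.exists_isStochIntegral_reversed (hW : IsWienerIntegral P L σ W)
    {f : ℝ → ℝ} (hf : Continuous f) (s : ℝ) :
    ∃ Y, IsStochIntegral P (timeShift L s) (fun r => f (-r)) s 0 Y := by
  have hc : Continuous fun r => f (-s - r) := hf.comp (continuous_const.sub continuous_id)
  obtain ⟨g, hg⟩ := exists_Lp_ae_eq_indicator hc
    (measurableSet_Ioc (a := (0 : ℝ)) (b := -s)) (hc.pow 2).integrableOn_Ioc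
  have h := (hW.isStochIntegral hc hg).timeShift s
  refine ⟨W g, ?_⟩
  convert h using 3
  · ring
  · ring

end

theorem integrableOn_sum_besselKernel_sq {ν : ℝ} (hν : 0 ≤ ν) (I : Finset ℕ) (c : ℕ → ℝ) :
    IntegrableOn (fun r => (∑ i ∈ I, c i * besselKernel ν i r) ^ 2) (Ioi 0) := by
  have h : (fun r => (∑ i ∈ I, c i * besselKernel ν i r) ^ 2) = fun r =>
      ∑ i ∈ I, ∑ j ∈ I, c i * c j * (besselKernel ν i r * besselKernel ν j r) := by
    funext r
    rw [sq, Finset.sum_mul_sum]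
    exact Finset.sum_congr rfl fun i _ => Finset.sum_congr rfl fun j _ => by ring
  rw [h]
  exact integrable_finsetSum _ fun i _ => integrable_finsetSum _ fun j _ =>
    (integrableOn_besselKernel_mul hν i j).const_mul _

theorem integrableOn_besselKernel_sq {ν : ℝ} (hν : 0 ≤ ν) (n : ℕ) :
    IntegrableOn (fun r => besselKernel ν n r ^ 2) (Ioi 0) := by
  simpa only [sq] using integrableOn_besselKernel_mul hν n n

section

variable {Ω Ω' : Type*} [MeasurableSpace Ω] [MeasurableSpace Ω'] {P : Measure Ω}
  {L : ℝ≥0 → Ω → ℝ} {σ : ℝ}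
  {W : Lp ℝ 2 (volume : Measure ℝ) →L[ℝ] Lp ℝ 2 P}

/-- The law depends on `s` only through the upper limit `-s` of the variance integral, which
converges by square integrability of the kernels. -/
theorem IsWienerIntegral.tendsto_charFun (hW : IsWienerIntegral P L σ W) {ν : ℝ} (hν : 0 ≤ ν)
    {A : ℝ → ℕ → Ω → ℝ} (hA : ∀ s ≤ 0, ∀ n,
      IsStochIntegral P (timeShift L s) (fun r => besselKernel ν n (-r)) s 0 (A s n))
    (I : Finset ℕ) (c : ℕ → ℝ) (t : ℝ) :
    Tendsto (fun s => charFun (P.map fun ω => ∑ i ∈ I, c i * A s i ω) t) atBot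
      (𝓝 (Complex.exp (-(t ^ 2 * (σ ^ 2 *
        ∫ r in Ioi 0, (∑ i ∈ I, c i * besselKernel ν i r) ^ 2) / 2 : ℝ)))) := by
  have h1 := intervalIntegral_tendsto_integral_Ioi 0 (integrableOn_sum_besselKernel_sq hν I c)
    tendsto_neg_atBot_atTop
  have h2 := (Complex.continuous_exp.comp (Complex.continuous_ofReal.comp
    (by fun_prop : Continuous fun x : ℝ => -(t ^ 2 * (σ ^ 2 * x) / 2)))).tendsto
      (∫ r in Ioi 0, (∑ i ∈ I, c i * besselKernel ν i r) ^ 2)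
  simp only [Function.comp_def, Complex.ofReal_neg] at h2
  refine (h2.comp h1).congr' ?_
  filter_upwards [eventually_le_atBot 0] with s hs
  rw [hW.charFun_sum_reversed I c (fun i => continuous_besselKernel ν i) hs (hA s hs) t]
  rfl

theorem IsWienerIntegral.isStationaryState [IsProbabilityMeasure P] (hW : IsWienerIntegral P L σ W)
    {ν : ℝ} (hν : 0 ≤ ν) {X : ℕ → Ω → ℝ}
    (hX : ∀ n, IsStochIntegralIoi P (timeShift L 0) (besselKernel ν n) 0 (X n)) :
    IsStationaryState P L ν P X := by
  choose B hB using fun (s : ℝ) (n : ℕ) =>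
    hW.exists_isStochIntegral_reversed (continuous_besselKernel ν n) s
  refine ⟨B, fun s _ n => hB s n, fun I => ?_⟩
  refine tendstoInDistribution_of_tendsto_charFun
    (fun s => aemeasurable_pi_lambda _ fun i => (hB s i).1)
    (aemeasurable_pi_lambda _ fun i => (hX i).1) fun c => ?_
  classical
  -- Extension by zero moves the coefficients from the subtype to all of `ℕ`, where the laws of sums
  -- are stated.
  set c' : ℕ → ℝ := fun i => if h : i ∈ I then c ⟨i, h⟩ else 0 with hc'
  have hsum : ∀ y : ℕ → ℝ, ∑ i : I, c i * y i = ∑ i ∈ I, c' i * y i := by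
    intro y
    rw [← Finset.sum_coe_sort I]
    exact Finset.sum_congr rfl fun i _ => by simp [hc']
  simp only [fun s ω => hsum fun i => B s i ω, fun ω => hsum fun i => X i ω]
  rw [hW.charFun_sum_Ioi I c' (fun i => continuous_besselKernel ν i)
    (fun i => integrableOn_besselKernel_sq hν i) hX]
  exact hW.tendsto_charFun hν (fun s _ n => hB s n) I c' 1

variable [IsProbabilityMeasure P]

/-- The approximants may be any versions of the integrals; continuous mapping and uniqueness of
limits determine the law of each linear combination. -/
theorem IsStationaryState.charFun_sum (hW : IsWienerIntegral P L σ W) {ν : ℝ} (hν : 0 ≤ ν)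
    {Q : Measure Ω'} [IsProbabilityMeasure Q] {a : ℕ → Ω' → ℝ} (ha : IsStationaryState P L ν Q a)
    (I : Finset ℕ) (c : ℕ → ℝ) (t : ℝ) :
    charFun (Q.map fun ω => ∑ i ∈ I, c i * a i ω) t = Complex.exp (-(t ^ 2 * (σ ^ 2 *
      ∫ r in Ioi 0, (∑ i ∈ I, c i * besselKernel ν i r) ^ 2) / 2 : ℝ)) := by
  obtain ⟨A, hA, hlim⟩ := ha
  have h1 := (hlim I).continuous_comp (g := fun x : I → ℝ => ∑ i : I, c i * x i) (by fun_prop)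
  have h2 := tendsto_charFun_of_tendstoInDistribution h1 t
  refine tendsto_nhds_unique ?_ (hW.tendsto_charFun hν hA I c t)
  simp only [Function.comp_def, fun (s : ℝ) ω => Finset.sum_coe_sort I fun i => c i * A s i ω,
    fun ω => Finset.sum_coe_sort I fun i => c i * a i ω] at h2
  exact h2

theorem IsStationaryState.aemeasurable {ν : ℝ} {Q : Measure Ω'} [IsProbabilityMeasure Q]
    {a : ℕ → Ω' → ℝ} (ha : IsStationaryState P L ν Q a) (n : ℕ) : AEMeasurable (a n) Q := by
  obtain ⟨A, -, hlim⟩ := ha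
  exact (measurable_pi_apply (⟨n, Finset.mem_singleton_self n⟩ : ({n} : Finset ℕ))).comp_aemeasurable
    (hlim {n}).aemeasurable_limit

theorem IsStationaryState.hasGaussianLaw_sum (hW : IsWienerIntegral P L σ W) {ν : ℝ} (hν : 0 ≤ ν)
    {Q : Measure Ω'} [IsProbabilityMeasure Q] {a : ℕ → Ω' → ℝ} (ha : IsStationaryState P L ν Q a)
    (I : Finset ℕ) (c : ℕ → ℝ) :
    HasGaussianLaw (fun ω => ∑ i ∈ I, c i * a i ω) Q ∧ ∫ ω, ∑ i ∈ I, c i * a i ω ∂Q = 0 ∧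
      ∫ ω, (∑ i ∈ I, c i * a i ω) ^ 2 ∂Q
        = σ ^ 2 * ∫ r in Ioi 0, (∑ i ∈ I, c i * besselKernel ν i r) ^ 2 :=
  hasGaussianLaw_of_charFun
    (Finset.aemeasurable_fun_sum _ fun i _ => (ha.aemeasurable i).const_mul _)
    (mul_nonneg (sq_nonneg σ) (integral_nonneg fun _ => sq_nonneg _))
    fun t => ha.charFun_sum hW hν I c t

theorem IsStationaryState.hasGaussianLaw (hW : IsWienerIntegral P L σ W) {ν : ℝ} (hν : 0 ≤ ν)
    {Q : Measure Ω'} [IsProbabilityMeasure Q] {a : ℕ → Ω' → ℝ} (ha : IsStationaryState P L ν Q a)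
    (n : ℕ) : HasGaussianLaw (a n) Q ∧ ∫ ω, a n ω ∂Q = 0 ∧
      ∫ ω, a n ω ^ 2 ∂Q = σ ^ 2 * ∫ r in Ioi 0, besselKernel ν n r ^ 2 := by
  have h := ha.hasGaussianLaw_sum hW hν {n} fun _ => 1
  simpa only [Finset.sum_singleton, one_mul] using h

theorem IsStationaryState.isGaussianProcess (hW : IsWienerIntegral P L σ W) {ν : ℝ} (hν : 0 ≤ ν)
    {Q : Measure Ω'} [IsProbabilityMeasure Q] {a : ℕ → Ω' → ℝ}
    (ha : IsStationaryState P L ν Q a) : IsGaussianProcess a Q := by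
  classical
  refine ⟨fun I => ⟨isGaussian_of_map_eq_gaussianReal fun ℓ => ?_⟩⟩
  set c : ℕ → ℝ := fun i => if h : i ∈ I then ℓ (Pi.single ⟨i, h⟩ 1) else 0 with hc
  have hmeas : AEMeasurable (fun ω => I.restrict (a · ω)) Q :=
    aemeasurable_pi_lambda _ fun i => ha.aemeasurable i
  rw [AEMeasurable.map_map_of_aemeasurable (by fun_prop) hmeas]
  have h : (ℓ ∘ fun ω => I.restrict (a · ω)) = fun ω => ∑ i ∈ I, c i * a i ω := by
    funext ω
    rw [Function.comp_apply, ← ContinuousLinearMap.coe_coe, LinearMap.pi_apply_eq_sum_univ,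
      ← Finset.sum_coe_sort I]
    refine Finset.sum_congr rfl fun i _ => ?_
    simp only [hc, Finset.coe_mem, dite_true, smul_eq_mul, Finset.restrict, Subtype.coe_eta,
      ContinuousLinearMap.coe_coe]
    rw [mul_comm]
    congr 2
    funext j
    simp [Pi.single_apply, eq_comm]
  rw [h]
  exact ⟨_, _, (ha.hasGaussianLaw_sum hW hν I c).1.map_eq_gaussianReal⟩

theorem IsStationaryState.integral_mul (hW : IsWienerIntegral P L σ W) {ν : ℝ} (hν : 0 ≤ ν)
    {Q : Measure Ω'} [IsProbabilityMeasure Q] {a : ℕ → Ω' → ℝ} (ha : IsStationaryState P L ν Q a)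
    (m n : ℕ) : Integrable (fun ω => a m ω * a n ω) Q ∧
      ∫ ω, a m ω * a n ω ∂Q
        = σ ^ 2 * ∫ r in Ioi 0, besselKernel ν m r * besselKernel ν n r := by
  have hm := ha.hasGaussianLaw hW hν m
  have hn := ha.hasGaussianLaw hW hν n
  have hint : Integrable (fun ω => a m ω * a n ω) Q :=
    hm.1.memLp_two.integrable_mul hn.1.memLp_two
  refine ⟨hint, ?_⟩
  -- Off the diagonal, compare the variances of `a m`, `a n` and their sum; the case `m = n` is
  -- separate since `{m, n}` would then have one element.
  rcases eq_or_ne m n with rfl | hmn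
  · simpa only [sq] using hm.2.2
  have h := (ha.hasGaussianLaw_sum hW hν {m, n} fun _ => 1).2.2
  simp only [Finset.sum_pair hmn, one_mul] at h
  rw [integral_add_sq hm.1.memLp_two.integrable_sq hn.1.memLp_two.integrable_sq hint,
    integral_add_sq (integrableOn_besselKernel_sq hν m) (integrableOn_besselKernel_sq hν n)
      (integrableOn_besselKernel_mul hν m n), hm.2.2, hn.2.2] at h
  linarith

theorem IsStationaryState.charFun_eq (hW : IsWienerIntegral P L σ W) {ν : ℝ} (hν : 0 ≤ ν)
    {Q : Measure Ω'} [IsProbabilityMeasure Q] {a : ℕ → Ω' → ℝ} (ha : IsStationaryState P L ν Q a)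
    (n : ℕ) (t : ℝ) : charFun (Q.map (a n)) t = Complex.exp (-(t ^ 2 * (σ ^ 2 *
      ∫ r in Ioi 0, besselKernel ν n r * besselKernel ν n r) / 2 : ℝ)) := by
  have h := ha.charFun_sum hW hν {n} (fun _ => 1) t
  simpa only [Finset.sum_singleton, one_mul, sq (besselKernel ν n _)] using h

end

/-! ### The stationary state: assembly -/

theorem mainTheorem5 {Ω : Type*} [MeasurableSpace Ω] (P : Measure Ω) [IsProbabilityMeasure P]
    (L : ℝ≥0 → Ω → ℝ) (hL : IsLevyProcess P L) (σ : ℝ) (hσ : 0 ≤ σ)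
    (hΨ : HasCumulant P L (fun lam => -(σ : ℂ) ^ 2 * (lam : ℂ) ^ 2 / 2)) :
    -- the hypergeometric functions below exist, as principal branches on `ℂ \ [1, ∞)`
    (∀ n : ℕ, 1 ≤ n → IsHypergeometricBranch
      {(n : ℂ) - 1 / 2, (n : ℂ), (n : ℂ) + 1 / 2} {(n : ℂ) + 1, 2 * (n : ℂ) + 1} (hyp32 n)) ∧
    (∀ m n : ℕ, 1 ≤ m → 1 ≤ n → IsHypergeometricBranch
      {((m : ℂ) + n - 1) / 2, ((m : ℂ) + n) / 2, ((m : ℂ) + n + 1) / 2, ((m : ℂ) + n) / 2 + 1}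
      {(m : ℂ) + 1, (n : ℂ) + 1, (m : ℂ) + n + 1} (hyp43 m n)) ∧
    -- the integrals `∫_0^∞ H_n^ν(r) dL(r)` exist and realise the stationary state
    (∀ ν : ℝ, 0 ≤ ν → ∃ X : ℕ → Ω → ℝ,
      ∀ n, IsStochIntegralIoi P (timeShift L 0) (besselKernel ν n) 0 (X n)) ∧
    (∀ ν : ℝ, 0 ≤ ν → ∀ X : ℕ → Ω → ℝ,
      (∀ n, IsStochIntegralIoi P (timeShift L 0) (besselKernel ν n) 0 (X n)) →
      IsStationaryState P L ν P X) ∧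
    -- every version of the stationary state
    (∀ {Ω' : Type*} [MeasurableSpace Ω'] (Q : Measure Ω') [IsProbabilityMeasure Q],
      -- general viscosity: Gaussianity, characteristic functions, covariances as integrals
      (∀ ν : ℝ, 0 ≤ ν → ∀ a : ℕ → Ω' → ℝ, IsStationaryState P L ν Q a →
        IsGaussianProcess a Q ∧
        (∀ n : ℕ, ∫ ω, a n ω ∂Q = 0) ∧
        (∀ m n : ℕ, 1 ≤ m → 1 ≤ n →
          Integrable (fun ω => a m ω * a n ω) Q ∧
          IntegrableOn (fun r => besselKernel ν m r * besselKernel ν n r) (Ioi 0) ∧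
          ∫ ω, a m ω * a n ω ∂Q
            = σ ^ 2 * ∫ r in Ioi 0, besselKernel ν m r * besselKernel ν n r) ∧
        (∀ n : ℕ, 1 ≤ n → ∀ lam : ℝ, charFun (Q.map (a n)) lam =
          (Real.exp (-lam ^ 2 * (σ ^ 2 / 2) * ∫ r in Ioi 0, besselKernel ν n r ^ 2) : ℂ))) ∧
      -- positive viscosity: hypergeometric formulas
      (∀ ν : ℝ, 0 < ν → ∀ a : ℕ → Ω' → ℝ, IsStationaryState P L ν Q a →
        (∀ n : ℕ, 1 ≤ n → ∀ lam : ℝ, charFun (Q.map (a n)) lam =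
          Complex.exp (-((lam ^ 2 * σ ^ 2 / (4 * √Real.pi)
              * (Real.Gamma (n - 1 / 2) / Real.Gamma n) * ν ^ (1 - 2 * (n : ℤ)) : ℝ) : ℂ)
            * hyp32 n (-4 / (ν : ℂ) ^ 2))) ∧
        (∀ n : ℕ, 1 ≤ n → ((∫ ω, a n ω ^ 2 ∂Q : ℝ) : ℂ) =
          ((σ ^ 2 / (2 * √Real.pi)
              * (Real.Gamma (n - 1 / 2) / Real.Gamma n) * ν ^ (1 - 2 * (n : ℤ)) : ℝ) : ℂ)
            * hyp32 n (-4 / (ν : ℂ) ^ 2)) ∧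
        (∀ m n : ℕ, 1 ≤ m → 1 ≤ n → ((∫ ω, a m ω * a n ω ∂Q : ℝ) : ℂ) =
          ((σ ^ 2 * (2 * ν) ^ (1 - (m : ℤ) - (n : ℤ))
              * (((m + n - 2)! : ℝ) / (((m - 1)! : ℝ) * ((n - 1)! : ℝ))) : ℝ) : ℂ)
            * hyp43 m n (-4 / (ν : ℂ) ^ 2))) ∧
      -- zero viscosity
      (∀ a : ℕ → Ω' → ℝ, IsStationaryState P L 0 Q a →
        (∀ n : ℕ, 1 ≤ n → ∀ lam : ℝ, charFun (Q.map (a n)) lam =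
          (Real.exp (-(lam ^ 2 * σ ^ 2 / Real.pi) * (1 - 1 / (4 * (n : ℝ) ^ 2))⁻¹) : ℂ)) ∧
        (∀ n : ℕ, 1 ≤ n → ∫ ω, a n ω ^ 2 ∂Q
          = 2 / Real.pi * σ ^ 2 * (1 - 1 / (4 * (n : ℝ) ^ 2))⁻¹) ∧
        Tendsto (fun n : ℕ => ∫ ω, a n ω ^ 2 ∂Q) atTop (𝓝 (2 / Real.pi * σ ^ 2)) ∧
        (∀ m n : ℕ, 1 ≤ m → 1 ≤ n → m ≠ n + 1 → n ≠ m + 1 → ∫ ω, a m ω * a n ω ∂Q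
          = σ ^ 2 * (2 / Real.pi) * Real.cos (Real.pi * (((m : ℝ) - n) / 2))
            * (1 / (((m : ℝ) + n) ^ 2 - 1) - 1 / (((m : ℝ) - n) ^ 2 - 1))) ∧
        (∀ n : ℕ, 1 ≤ n → ∫ ω, a n ω * a (n + 1) ω ∂Q = σ ^ 2 / 2)) ∧
      -- the limit of vanishing viscosity
      (∀ a : ℝ → ℕ → Ω' → ℝ, (∀ ν : ℝ, 0 ≤ ν → IsStationaryState P L ν Q (a ν)) →
        (∀ n : ℕ, 1 ≤ n →
          (fun ν : ℝ => ∫ ω, a ν n ω ^ 2 ∂Q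
            - σ ^ 2 * (8 * (n : ℝ) ^ 2 / (Real.pi * (4 * (n : ℝ) ^ 2 - 1)) - n * ν))
            =o[𝓝[>] 0] (fun ν : ℝ => ν)) ∧
        (∀ n : ℕ, 1 ≤ n → ∀ lam : ℝ, Tendsto (fun ν : ℝ => charFun (Q.map (a ν n)) lam)
          (𝓝[>] 0) (𝓝 (charFun (Q.map (a 0 n)) lam))))) := by
  obtain ⟨W, hW⟩ := hL.exists_isWienerIntegral hσ hΨ
  have hsq : ∀ (ν : ℝ) (n : ℕ), ∫ r in Ioi 0, besselKernel ν n r ^ 2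
      = ∫ r in Ioi 0, besselKernel ν n r * besselKernel ν n r := fun ν n => by simp only [sq]
  refine ⟨fun n hn => isHypergeometricBranch_hyp32 n hn,
    fun m n hm hn => isHypergeometricBranch_hyp43 m n hm hn, fun ν hν => ?_,
    fun ν hν X hX => hW.isStationaryState hν hX, fun Q _ => ⟨fun ν hν a ha => ?_,
    fun ν hν a ha => ?_, fun a ha => ?_, fun a ha => ?_⟩⟩
  · have h := fun n => exists_Lp_ae_eq_indicator (continuous_besselKernel ν n) measurableSet_Ioi
      (integrableOn_besselKernel_sq hν n)
    choose g hg using h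
    exact ⟨fun n => W (g n), fun n => hW.isStochIntegralIoi (continuous_besselKernel ν n)
      (integrableOn_besselKernel_sq hν n) (hg n)⟩
  · refine ⟨ha.isGaussianProcess hW hν, fun n => (ha.hasGaussianLaw hW hν n).2.1,
      fun m n _ _ => ⟨(ha.integral_mul hW hν m n).1, integrableOn_besselKernel_mul hν m n,
        (ha.integral_mul hW hν m n).2⟩, fun n _ lam => ?_⟩
    rw [ha.charFun_eq hW hν, hsq, Complex.ofReal_exp, ← Complex.ofReal_neg]
    congr 2
    ring
  · refine ⟨fun n hn lam => ?_, fun n hn => ?_, fun m n hm hn => ?_⟩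
    · rw [ha.charFun_eq hW hν.le]
      push_cast
      rw [integral_besselKernel_sq_eq_hyp32 hν hn]
      congr 1
      push_cast
      ring
    · rw [(ha.hasGaussianLaw hW hν.le n).2.2, hsq]
      push_cast
      rw [integral_besselKernel_sq_eq_hyp32 hν hn]
      push_cast
      ring
    · rw [(ha.integral_mul hW hν.le m n).2]
      push_cast
      rw [integral_besselKernel_mul_eq_hyp43 hν hm hn]
      push_cast
      ring
  · have hself : ∀ n : ℕ, 1 ≤ n → ∫ r in Ioi 0, besselKernel 0 n r * besselKernel 0 n r
        = 2 / Real.pi * (1 - 1 / (4 * (n : ℝ) ^ 2))⁻¹ := by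
      intro n hn
      have hn' : (1 : ℝ) ≤ n := by exact_mod_cast hn
      have h1 : 4 * (n : ℝ) ^ 2 - 1 ≠ 0 := by nlinarith
      rw [integral_besselKernel_zero, besselCov_self n hn]
      have h2 : 1 - 1 / (4 * (n : ℝ) ^ 2) = (4 * (n : ℝ) ^ 2 - 1) / (4 * (n : ℝ) ^ 2) := by
        field_simp
      rw [h2, inv_div]
      field_simp
      ring
    have hvar : ∀ n : ℕ, 1 ≤ n → ∫ ω, a n ω ^ 2 ∂Q
        = 2 / Real.pi * σ ^ 2 * (1 - 1 / (4 * (n : ℝ) ^ 2))⁻¹ := by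
      intro n hn
      rw [(ha.hasGaussianLaw hW le_rfl n).2.2, hsq, hself n hn]
      ring
    refine ⟨fun n hn lam => ?_, hvar, ?_, fun m n hm hn h1 h2 => ?_, fun n hn => ?_⟩
    · rw [ha.charFun_eq hW le_rfl, hself n hn, Complex.ofReal_exp, ← Complex.ofReal_neg]
      congr 2
      ring
    · have h1 : Tendsto (fun n : ℕ => 1 / (4 * (n : ℝ) ^ 2)) atTop (𝓝 0) :=
        tendsto_const_nhds.div_atTop (((tendsto_pow_atTop two_ne_zero).comp
          tendsto_natCast_atTop_atTop).const_mul_atTop four_pos)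
      have h2 := ((h1.const_sub 1).inv₀ (by norm_num)).const_mul (2 / Real.pi * σ ^ 2)
      rw [sub_zero, inv_one, mul_one] at h2
      refine h2.congr' ?_
      filter_upwards [eventually_ge_atTop 1] with n hn
      exact (hvar n hn).symm
    · rw [(ha.integral_mul hW le_rfl m n).2, integral_besselKernel_zero, besselCov_eq h1 h2]
      ring
    · obtain ⟨k, rfl⟩ : ∃ k, n = k + 1 := ⟨n - 1, by omega⟩
      rw [(ha.integral_mul hW le_rfl _ _).2, integral_besselKernel_zero, besselCov_succ]
      ring
  · refine ⟨fun n hn => ?_, fun n hn lam => ?_⟩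
    · refine ((isLittleO_integral_besselKernel_sq n hn).const_mul_left (σ ^ 2)).congr' ?_
        EventuallyEq.rfl
      filter_upwards [self_mem_nhdsWithin] with ν hν
      have hν' : 0 ≤ ν := le_of_lt hν
      rw [((ha ν hν').hasGaussianLaw hW hν' n).2.2, hsq]
      ring
    · rw [(ha 0 le_rfl).charFun_eq hW le_rfl]
      have hc : Continuous fun x : ℝ =>
          Complex.exp ((-(lam ^ 2 * (σ ^ 2 * x) / 2) : ℝ) : ℂ) := by fun_prop
      have h := (hc.tendsto _).comp (tendsto_integral_besselKernel_sq n hn)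
      simp only [Function.comp_def, Complex.ofReal_neg] at h
      refine h.congr' ?_
      filter_upwards [self_mem_nhdsWithin] with ν hν
      have hν' : 0 ≤ ν := le_of_lt hν
      rw [(ha ν hν').charFun_eq hW hν']
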